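/- **Setting.** Let $d\ge 2$, and let $\mathfrak g$ be a real Lie subalgebra of the Lie algebra $\mathfrak u(N)$ of skew-Hermitian $N\times N$ matrices (for instance the Lie algebra of a compact Lie group $G\subseteq \mathrm U(N)$), with norm $|S|=\operatorname{Tr}(S^*S)^{1/2}$ and the induced Euclidean norm on $\mathfrak g^d$. Let $\mathbb T^d=\mathbb R^d/\mathbb Z^d$, let $e^{t\Delta}$ be the heat semigroup on $\mathbb T^d$, and put $\|f\|_{C^0}=\sup|f|$, $\|f\|_{C^1}=\max\{\|f\|_{C^0},\|\partial_1f\|_{C^0},\dots,\|\partial_df\|_{C^0}\}$. For $\gamma\ge 0$, $T>0$ let $\mathcal Q^\gamma_T$ be the space of continuous $A:(0,T]\to C^1(\mathbb T^d,\mathfrak g^d)$ with $$\|A\|_{\mathcal Q^\gamma_T}=\sup_{0<t\le T}t^{\gamma}\|A(t)\|_{C^0}+\sup_{0<t\le T}t^{1/2+\gamma}\|A(t)\|_{C^1}<\infty ,$$ and $\mathcal Q^\gamma_{T,M}=\{A\in\mathcal Q^\gamma_T:\|A\|_{\mathcal Q^\gamma_T}\le M\}$. For $A\in C^1(\mathbb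 T^d,\mathfrak g^d)$ let $X=X^{(2)}+X^{(3)}$ with $$X^{(2)}_i(A)=\sum_{j=1}^d[A_j,2\partial_jA_i-\partial_iA_j],\qquad X^{(3)}_i(A)=\sum_{j=1}^d[A_j,[A_j,A_i]],$$ and $Y(A,B)=X(A+B)-X(A)-X(B)$. Put $\rho(A)(t)=\int_0^te^{(t-s)\Delta}X(A(s))\,ds$ and $\eta(A,B)(t)=\int_0^te^{(t-s)\Delta}Y(A(s),B(s))\,ds$; these are called well-defined on $(0,T]$ if the integrals (for $\rho$: those of $X^{(2)}$ and $X^{(3)}$ separately) converge absolutely in $C^1$ for all $t\in(0,T]$. The ZDDS equation is $$\partial_tA_i=\Delta A_i+\sum_{j=1}^d[A_j,2\partial_jA_i-\partial_iA_j+[A_j,A_i]],\qquad 1\le i\le d;$$ a solution on $(0,T)$ is an $A\in C^\infty((0,T)\times\mathbb T^d,\mathfrak g^d)$ that satisfies it on $(0,T)\times\mathbb T^d$. Given $\gamma_1,\gamma_2$, *data* are pairs $(A^1,B^1)$ with $A^1\in\mathcal Q^{\gamma_1}_1$, $A^1(t)=e^{(t-s)\Delta}A^1(s)$ for all $0<s<t\le1$,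 and $B^1\in\mathcal Q^{\gamma_2}_1$ a *first nonlinear part* for $A^1$: for all $t_0\in(0,1)$ and $t\in[0,1-t_0]$, $$B^1(t_0+t)=e^{t\Delta}B^1(t_0)+\int_0^te^{(t-s)\Delta}X(A^1(t_0+s))\,ds .$$ The size of the data is $R=\max\{\|A^1\|_{\mathcal Q^{\gamma_1}_1},\|B^1\|_{\mathcal Q^{\gamma_2}_1}\}$. **Theorem.** Let $\gamma_1\in[0,1/2)$, $\gamma_2\in[0,1/4)$ with $\gamma_1+\gamma_2<1/2$. There are a continuous non-increasing function $\tau:[0,\infty)\to(0,1]$ and a constant $C$, depending only on $\gamma_1,\gamma_2,d,\mathfrak g$, with $$\tau(R)^{-1}\le C\bigl(1+R^{4/(1-2\max\{\gamma_1,\gamma_2\})}\bigr)\qquad (R\ge0),$$ such that the following holds for all data $(A^1,B^1)$, with $R$ their size and $T=\tau(R)$. 1. There is $B\in\mathcal Q^{\gamma_2}_{T,3R}$ such that $\rho(B)$ and $\eta(A^1,B)$ are well-defined on $(0,T]$, $$B=B^1+\rho(B)+\eta(A^1,B)\quad\text{on }(0,T],\tag{$*$}$$ and $A=A^1+B$ is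 a (smooth) solution to ZDDS on $(0,T)$. 2. Let $B\in\mathcal Q^{\gamma_2}_{T,3R}$ satisfy $(*)$ with well-defined $\rho(B)$, $\eta(A^1,B)$. Let $(A^1_n,B^1_n)$, $n\ge1$, be data of sizes $R_n$, let $T_n=\tau(R_n)$, and let $B_n\in\mathcal Q^{\gamma_2}_{T_n,3R_n}$ satisfy the analogue of $(*)$ for $(A^1_n,B^1_n)$ on $(0,T_n]$, with well-defined $\rho(B_n)$, $\eta(A^1_n,B_n)$. If $\|A^1_n-A^1\|_{\mathcal Q^{\gamma_1}_1}\to0$ and $\|B^1_n-B^1\|_{\mathcal Q^{\gamma_2}_1}\to0$, then $T_n\to T$, and for every $T_0\in(0,T)$ $$\|B_n-B\|_{\mathcal Q^{\gamma_2}_{T_0}}\to0,\qquad \|(A^1_n+B_n)-(A^1+B)\|_{\mathcal Q^{\max\{\gamma_1,\gamma_2\}}_{T_0}}\to0 .$$ -/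

import Mathlib

open MeasureTheory Filter Topology Set
open scoped ENNReal NNReal ContDiff

/-- Euclidean space `ℝ ^ d`. Functions on the torus `𝕋 ^ d = ℝ ^ d / ℤ ^ d` are identified with
`ℤ ^ d`-periodic functions on `ℝ ^ d`. -/
abbrev Euc (d : ℕ) : Type := EuclideanSpace ℝ (Fin d)

/-- Complex `N × N` matrices, with their usual ring structure, adjoint and real algebra structure,
and with the Hilbert-Schmidt norm, `‖S‖ ^ 2 = Tr (S * S)` with `S *` the adjoint. -/
def HSMat (N : ℕ) : Type := Matrix (Fin N) (Fin N) ℂ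

noncomputable instance HSMat.instNormedRing (N : ℕ) : NormedRing (HSMat N) :=
  (Matrix.frobeniusNormedRing : NormedRing (Matrix (Fin N) (Fin N) ℂ))

noncomputable instance HSMat.instNormedAlgebra (N : ℕ) : NormedAlgebra ℝ (HSMat N) :=
  (Matrix.frobeniusNormedAlgebra :
    @NormedAlgebra ℝ (Matrix (Fin N) (Fin N) ℂ) _ Matrix.frobeniusNormedRing.toSeminormedRing)

noncomputable instance HSMat.instStarRing (N : ℕ) : StarRing (HSMat N) :=
  (inferInstance : StarRing (Matrix (Fin N) (Fin N) ℂ))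

instance HSMat.instFiniteDimensional (N : ℕ) : FiniteDimensional ℝ (HSMat N) :=
  (inferInstance : FiniteDimensional ℝ (Matrix (Fin N) (Fin N) ℂ))

/-! Matrices carry the commutator bracket `⁅S, S'⁆ = S * S' - S' * S`. -/
attribute [local instance] LieRing.ofAssociativeRing

/-- The value space `𝔤 ^ d` of `𝔤`-valued 1-forms on `𝕋 ^ d`, with the Hilbert norm induced by the
Hilbert-Schmidt norm on `𝔤`. -/
abbrev FormVal {N : ℕ} (𝔤 : LieSubalgebra ℝ (HSMat N)) (d : ℕ) : Type :=
  PiLp 2 (fun _ : Fin d => 𝔤)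

noncomputable section

section TorusFunctions

variable {d : ℕ} {V : Type*} [NormedAddCommGroup V] [NormedSpace ℝ V]

/-- `f` is `ℤ ^ d`-periodic, i.e. a function on the torus. -/
def IsTorusFun (f : Euc d → V) : Prop :=
  ∀ (i : Fin d) (x : Euc d), f (x + EuclideanSpace.single i 1) = f x

/-- `f ∈ C ^ 1 (𝕋 ^ d, V)`. -/
def IsC1 (f : Euc d → V) : Prop :=
  IsTorusFun f ∧ ContDiff ℝ 1 f

/-- The partial derivative `∂ᵢ f`. -/
def pd (i : Fin d) (f : Euc d → V) (x : Euc d) : V :=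
  fderiv ℝ f x (EuclideanSpace.single i 1)

/-- The norm `‖f‖_{C ^ 0} = sup |f|`, as an extended nonnegative number. -/
def c0Norm (f : Euc d → V) : ℝ≥0∞ :=
  ⨆ x, ‖f x‖ₑ

/-- The norm `‖f‖_{C ^ 1} = max (‖f‖_{C ^ 0}, ‖∂₁ f‖_{C ^ 0}, …, ‖∂_d f‖_{C ^ 0})`. -/
def c1Norm (f : Euc d → V) : ℝ≥0∞ :=
  max (c0Norm f) (⨆ i : Fin d, c0Norm (pd i f))

/-- The heat semigroup `exp (t Δ) f` on functions on the torus: the identity for `t = 0`, and for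
`t > 0` the convolution of the periodic function `f` with the Gaussian heat kernel of `ℝ ^ d`
(equivalently, of `f` with the periodized kernel `∑ₙ exp (-4 π² |n|² t) exp (2 π i n · x)`). -/
def heat (t : ℝ) (f : Euc d → V) (x : Euc d) : V :=
  if t ≤ 0 then f x
  else ∫ y : Euc d,
    ((4 * Real.pi * t) ^ (-(d : ℝ) / 2) * Real.exp (-‖x - y‖ ^ 2 / (4 * t))) • f y

/-- The norm `‖A‖_{Q_T ^ γ}` of a path `A` defined on `(0, T]`, as an extended number. Only the
values `A t` with `0 < t ≤ T` enter. -/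
def qNorm (T γ : ℝ) (A : ℝ → Euc d → V) : ℝ≥0∞ :=
  (⨆ t ∈ Ioc 0 T, ENNReal.ofReal (t ^ γ) * c0Norm (A t)) +
    ⨆ t ∈ Ioc 0 T, ENNReal.ofReal (t ^ (1 / 2 + γ)) * c1Norm (A t)

/-- `A ∈ Q_T ^ γ`: `A` is a continuous path `(0, T] → C ^ 1 (𝕋 ^ d, V)` with `‖A‖_{Q_T ^ γ} < ∞`. -/
structure MemQ (T γ : ℝ) (A : ℝ → Euc d → V) : Prop where
  isC1 : ∀ t ∈ Ioc 0 T, IsC1 (A t)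
  continuous : ∀ t ∈ Ioc 0 T, Tendsto (fun s => c1Norm (A s - A t)) (𝓝[Ioc 0 T] t) (𝓝 0)
  finite : qNorm T γ A < ⊤

/-- `A` is a caloric path on `(0, 1]`: `A t = exp ((t - s) Δ) (A s)` for `0 < s < t ≤ 1`. -/
def IsCaloric (A : ℝ → Euc d → V) : Prop :=
  ∀ s ∈ Ioc (0 : ℝ) 1, ∀ t ∈ Ioc (0 : ℝ) 1, s < t → A t = heat (t - s) (A s)

/-- The Duhamel integral `∫₀ᵗ exp ((t - s) Δ) (F s) ds`. -/
def duhamel (F : ℝ → Euc d → V) (t : ℝ) (x : Euc d) : V :=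
  ∫ s in 0..t, heat (t - s) (F s) x

/-- The Duhamel integrals of `F` up to the times `t ∈ (0, T]` converge absolutely in `C ^ 1`. -/
def DuhamelConverges (T : ℝ) (F : ℝ → Euc d → V) : Prop :=
  ∀ t ∈ Ioc 0 T, (∀ s ∈ Ioo 0 t, IsC1 (heat (t - s) (F s))) ∧
    ∫⁻ s in Ioo 0 t, c1Norm (heat (t - s) (F s)) < ⊤

end TorusFunctions

section YangMills

variable {N d : ℕ} {𝔤 : LieSubalgebra ℝ (HSMat N)}

/-- `X⁽²⁾ᵢ(A) = ∑ⱼ [Aⱼ, 2 ∂ⱼ Aᵢ - ∂ᵢ Aⱼ]`. -/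
def nonlin2 (A : Euc d → FormVal 𝔤 d) (x : Euc d) : FormVal 𝔤 d :=
  WithLp.toLp 2 fun i => ∑ j, ⁅A x j, (2 : ℝ) • pd j A x i - pd i A x j⁆

/-- `X⁽³⁾ᵢ(A) = ∑ⱼ [Aⱼ, [Aⱼ, Aᵢ]]`. -/
def nonlin3 (A : Euc d → FormVal 𝔤 d) (x : Euc d) : FormVal 𝔤 d :=
  WithLp.toLp 2 fun i => ∑ j, ⁅A x j, ⁅A x j, A x i⁆⁆

/-- The nonlinearity `Xᵢ(A) = ∑ⱼ [Aⱼ, 2 ∂ⱼ Aᵢ - ∂ᵢ Aⱼ + [Aⱼ, Aᵢ]]`. -/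
def nonlin (A : Euc d → FormVal 𝔤 d) (x : Euc d) : FormVal 𝔤 d :=
  WithLp.toLp 2 fun i => ∑ j, ⁅A x j, (2 : ℝ) • pd j A x i - pd i A x j + ⁅A x j, A x i⁆⁆

/-- The cross terms `Y(A, B) = X(A + B) - X(A) - X(B)`. -/
def crossTerm (A B : Euc d → FormVal 𝔤 d) : Euc d → FormVal 𝔤 d :=
  nonlin (A + B) - nonlin A - nonlin B

/-- `ρ(A)(t) = ∫₀ᵗ exp ((t - s) Δ) X(A(s)) ds`. -/
def rho (A : ℝ → Euc d → FormVal 𝔤 d) : ℝ → Euc d → FormVal 𝔤 d :=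
  duhamel fun s => nonlin (A s)

/-- `η(A, B)(t) = ∫₀ᵗ exp ((t - s) Δ) Y(A(s), B(s)) ds`. -/
def eta (A B : ℝ → Euc d → FormVal 𝔤 d) : ℝ → Euc d → FormVal 𝔤 d :=
  duhamel fun s => crossTerm (A s) (B s)

/-- `B₁` is a first nonlinear part for `A₁`: for all `t₀ ∈ (0, 1)` and `t ∈ [0, 1 - t₀]`,
`B₁(t₀ + t) = exp (t Δ) B₁(t₀) + ρ(A₁(t₀ + ·))(t)`. -/
def IsFirstNonlinearPart (A₁ B₁ : ℝ → Euc d → FormVal 𝔤 d) : Prop :=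
  ∀ t₀ ∈ Ioo (0 : ℝ) 1, ∀ t ∈ Icc (0 : ℝ) (1 - t₀),
    B₁ (t₀ + t) = heat t (B₁ t₀) + rho (fun s => A₁ (t₀ + s)) t

/-- The data of the problem: a caloric path `A₁ ∈ Q₁ ^ γ₁` together with a first nonlinear part
`B₁ ∈ Q₁ ^ γ₂` for it. -/
structure IsData (γ₁ γ₂ : ℝ) (A₁ B₁ : ℝ → Euc d → FormVal 𝔤 d) : Prop where
  memQ_A : MemQ 1 γ₁ A₁
  caloric : IsCaloric A₁
  memQ_B : MemQ 1 γ₂ B₁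
  firstNonlinearPart : IsFirstNonlinearPart A₁ B₁

/-- The size `R = max (‖A₁‖_{Q₁ ^ γ₁}, ‖B₁‖_{Q₁ ^ γ₂})` of the data. -/
def dataSize (γ₁ γ₂ : ℝ) (A₁ B₁ : ℝ → Euc d → FormVal 𝔤 d) : ℝ≥0 :=
  (max (qNorm 1 γ₁ A₁) (qNorm 1 γ₂ B₁)).toNNReal

/-- `B` is the remainder constructed from the data `(A₁, B₁)` on `(0, T]`, with bound `M`:
`B ∈ Q_T ^ γ₂`, `‖B‖_{Q_T ^ γ₂} ≤ M`, and `B = B₁ + ρ(B) + η(A₁, B)` on `(0, T]`, where `ρ(B)` and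
`η(A₁, B)` are well-defined. -/
structure IsRemainder (γ₂ T : ℝ) (M : ℝ≥0) (A₁ B₁ B : ℝ → Euc d → FormVal 𝔤 d) : Prop where
  memQ : MemQ T γ₂ B
  norm_le : qNorm T γ₂ B ≤ M
  rho2_wellDefined : DuhamelConverges T fun s => nonlin2 (B s)
  rho3_wellDefined : DuhamelConverges T fun s => nonlin3 (B s)
  eta_wellDefined : DuhamelConverges T fun s => crossTerm (A₁ s) (B s)
  eq : ∀ t ∈ Ioc 0 T, B t = B₁ t + rho B t + eta A₁ B t

/-- `A` is a solution to the ZDDS equation on `(0, T)`: `A ∈ C ^ ∞ ((0, T) × 𝕋 ^ d, 𝔤 ^ d)` and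
`∂ₜ Aᵢ = Δ Aᵢ + ∑ⱼ [Aⱼ, 2 ∂ⱼ Aᵢ - ∂ᵢ Aⱼ + [Aⱼ, Aᵢ]]` on `(0, T) × 𝕋 ^ d`. -/
structure IsZDDSSolution (T : ℝ) (A : ℝ → Euc d → FormVal 𝔤 d) : Prop where
  periodic : ∀ t ∈ Ioo 0 T, IsTorusFun (A t)
  smooth : ContDiffOn ℝ ∞ (fun p : ℝ × Euc d => A p.1 p.2) (Ioo 0 T ×ˢ univ)
  eq : ∀ t ∈ Ioo 0 T, ∀ x : Euc d,
    deriv (fun s => A s x) t = ∑ j : Fin d, pd j (pd j (A t)) x + nonlin (A t) x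

end YangMills

end

/-!
The remainder equation `B = B₁ + ρ(B) + η(A₁, B)` is solved by the contraction principle, and
smoothness of `A₁ + B` is read off from the mild form of the equation.

*Heat estimates.* `heat t` is convolution with the Gaussian; it contracts the supremum norm, and one
spatial derivative costs `t ^ (-1/2)`. Hence a source that blows up like `s ^ (-a)` with `a < 1` has
a Duhamel integral that converges absolutely in `C¹`, and whose value and gradient at time `t` are
bounded by multiples of `t ^ (1 - a)` and `t ^ (1/2 - a)`.

*Existence.* The nonlinearity is a sum of a bilinear term in `(A, ∇A)` and a trilinear term in `A`.
On arguments whose jets are weighted by `γ₁` and `γ₂`, with at least one of them the remainder, the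
source blows up with exponent `1/2 + γ + γ₂`, where `γ = max γ₁ γ₂`; the conditions on the exponents
make this smaller than one. The powers of `T` gained turn the right-hand side of the equation into a
contraction of a ball of weighted jets once `T` is a small multiple of a power of `1 / (1 + R)`,
which determines `existenceTime`. The fixed point is found in `exists_remainder`, as a jet whose
derivative components turn out to be derivatives of its values; the same Lipschitz bound, applied to
two data, is the stability estimate `qNorm_remainder_sub_le`.

*Smoothness.* By the equation for the first nonlinear part and that for the remainder, `A₁ + B`
satisfies Duhamel's formula from every positive time on (`isMild_of_remainder`). On a short time
interval the formula is a smooth fixed-point problem, so by the inverse function theorem its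
solution depends differentiably on the initial value. Translations commute with the equation, and
the initial value, being `C¹`, is differentiable along them; this yields one more spatial derivative
than the norm controls (`jetCont_pd_of_mild`). The jet of a mild solution is again a mild
solution of an equation of the same form (`IsMild.jet`), so the argument can be repeated, and time
derivatives are expressed through spatial ones (`IsMild.hasDerivAt`, `IsMild.contDiffOn`).
-/

set_option linter.unusedSectionVars false

/-! ### Functions on the torus -/


section Torus

variable {d : ℕ} {V : Type*} [NormedAddCommGroup V] [NormedSpace ℝ V]

/-- The unit cube, a compact set meeting every `ℤ ^ d`-orbit. -/
def unitCube (d : ℕ) : Set (Euc d) :=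
  (EuclideanSpace.equiv (Fin d) ℝ) ⁻¹' (Set.univ.pi fun _ => Icc (0 : ℝ) 1)

/-- The representative in the unit cube of a point modulo `ℤ ^ d`. -/
noncomputable def cubeRep (x : Euc d) : Euc d :=
  WithLp.toLp 2 fun i => Int.fract (x i)

lemma isCompact_unitCube : IsCompact (unitCube d) := by
  have h : IsCompact (Set.univ.pi fun _ : Fin d => Icc (0 : ℝ) 1) :=
    isCompact_univ_pi fun _ => isCompact_Icc
  exact (EuclideanSpace.equiv (Fin d) ℝ).toHomeomorph.isCompact_preimage.2 h

lemma cubeRep_mem (x : Euc d) : cubeRep x ∈ unitCube d := by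
  simp only [unitCube, cubeRep, mem_preimage, mem_univ_pi]
  intro i
  exact ⟨Int.fract_nonneg _, (Int.fract_lt_one _).le⟩

lemma IsTorusFun.apply_cubeRep {f : Euc d → V} (hf : IsTorusFun f) (x : Euc d) :
    f (cubeRep x) = f x := by
  have key : ∀ (s : Finset (Fin d)) (y : Euc d),
      f (y + ∑ i ∈ s, ⌊x i⌋ • EuclideanSpace.single i (1 : ℝ)) = f y := by
    intro s
    induction s using Finset.induction_on with
    | empty => simp
    | insert i s hi ih =>
      intro y
      rw [Finset.sum_insert hi, ← add_assoc, ih]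
      exact (Function.Periodic.zsmul (hf i) ⌊x i⌋) y
  rw [← key Finset.univ (cubeRep x)]
  congr 1
  ext j
  simp [cubeRep, Finset.sum_apply, Pi.single_apply]

lemma IsTorusFun.exists_bound {f : Euc d → V} (hf : IsTorusFun f) (hc : Continuous f) :
    ∃ C, ∀ x, ‖f x‖ ≤ C := by
  obtain ⟨C, hC⟩ := isCompact_unitCube.exists_bound_of_continuousOn
    (hc.continuousOn (s := unitCube d))
  exact ⟨C, fun x => by rw [← hf.apply_cubeRep x]; exact hC _ (cubeRep_mem x)⟩

/-- A jointly continuous family of functions on the torus is continuous in the parameter, uniformly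
in space. -/
lemma eventually_forall_norm_sub_le {F : ℝ → Euc d → V} {S : Set ℝ} {t : ℝ}
    (hF : ∀ s ∈ S, IsTorusFun (F s))
    (hc : ContinuousOn (fun p : ℝ × Euc d => F p.1 p.2) (S ×ˢ univ)) (ht : t ∈ S)
    {ε : ℝ} (hε : 0 < ε) : ∀ᶠ s in 𝓝[S] t, ∀ x, ‖F s x - F t x‖ ≤ ε := by
  have h1 : ∀ᶠ s in 𝓝[S] t, ∀ x ∈ unitCube d, ‖F s x - F t x‖ < ε := by
    suffices h : ∀ᶠ s in 𝓝 t, ∀ x ∈ unitCube d, s ∈ S → ‖F s x - F t x‖ < ε from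
      eventually_nhdsWithin_iff.2 (h.mono fun s hs hsS x hx => hs x hx hsS)
    refine isCompact_unitCube.eventually_forall_of_forall_eventually fun x _ => ?_
    have h2 : ContinuousWithinAt (fun p : ℝ × Euc d => ‖F p.1 p.2 - F t p.2‖) (S ×ˢ univ)
        (t, x) := by
      refine ((hc (t, x) ⟨ht, mem_univ _⟩).sub ?_).norm
      exact (hc (t, x) ⟨ht, mem_univ _⟩).comp (t := S ×ˢ univ)
        (g := fun p : ℝ × Euc d => F p.1 p.2)
        (f := fun p : ℝ × Euc d => (t, p.2)) (x := (t, x)) (s := S ×ˢ univ)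
        (by fun_prop : Continuous fun p : ℝ × Euc d => (t, p.2)).continuousWithinAt
        fun p _ => ⟨ht, mem_univ _⟩
    have h3 := h2.tendsto.eventually_lt_const (u := ε) (by simpa using hε)
    filter_upwards [eventually_nhdsWithin_iff.1 h3] with p hp hpS
    exact hp ⟨hpS, mem_univ _⟩
  filter_upwards [h1, self_mem_nhdsWithin] with s hs hsS x
  rw [← (hF s hsS).apply_cubeRep x, ← (hF t ht).apply_cubeRep x]
  exact (hs _ (cubeRep_mem x)).le

/-! ### Partial derivatives -/

lemma pd_add {f g : Euc d → V} {x : Euc d} (hf : DifferentiableAt ℝ f x)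
    (hg : DifferentiableAt ℝ g x) (i : Fin d) : pd i (f + g) x = pd i f x + pd i g x := by
  simp [pd, fderiv_add hf hg]

lemma pd_sub {f g : Euc d → V} {x : Euc d} (hf : DifferentiableAt ℝ f x)
    (hg : DifferentiableAt ℝ g x) (i : Fin d) : pd i (f - g) x = pd i f x - pd i g x := by
  simp [pd, fderiv_sub hf hg]

lemma pd_const_smul (c : ℝ) (f : Euc d → V) (x : Euc d) (i : Fin d) :
    pd i (c • f) x = c • pd i f x := by
  simp [pd, fderiv_const_smul_field]

lemma pd_zero (i : Fin d) : pd i (0 : Euc d → V) = 0 := by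
  ext x
  simp [pd]

lemma HasFDerivAt.pd_eq {f : Euc d → V} {f' : Euc d →L[ℝ] V} {x : Euc d} (h : HasFDerivAt f f' x)
    (i : Fin d) : pd i f x = f' (EuclideanSpace.single i 1) := by
  rw [pd, h.fderiv]

lemma clm_eq_sum_single (L : Euc d →L[ℝ] V) :
    L = ∑ i, (EuclideanSpace.proj i : Euc d →L[ℝ] ℝ).smulRight (L (EuclideanSpace.single i 1)) := by
  ext v
  have hv : v = ∑ i, v i • EuclideanSpace.single i (1 : ℝ) := by
    ext j
    simp [Pi.single_apply]
  conv_lhs => rw [hv]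
  simp

lemma fderiv_eq_sum_pd (f : Euc d → V) (x : Euc d) :
    fderiv ℝ f x = ∑ i, (EuclideanSpace.proj i : Euc d →L[ℝ] ℝ).smulRight (pd i f x) :=
  clm_eq_sum_single _

lemma fderiv_apply_eq_sum_pd (f : Euc d → V) (x v : Euc d) :
    fderiv ℝ f x v = ∑ i, v i • pd i f x := by
  rw [fderiv_eq_sum_pd]
  simp

lemma contDiff_one_of_pd {f : Euc d → V} (hf : Differentiable ℝ f)
    (h : ∀ i, Continuous (pd i f)) : ContDiff ℝ 1 f := by
  rw [contDiff_one_iff_fderiv]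
  refine ⟨hf, ?_⟩
  rw [show fderiv ℝ f = _ from funext (fderiv_eq_sum_pd f)]
  have : ∀ i : Fin d, Continuous fun x => ContinuousLinearMap.smulRightL ℝ (Euc d) V
      (EuclideanSpace.proj i : Euc d →L[ℝ] ℝ) (pd i f x) := fun i =>
    (ContinuousLinearMap.continuous _).comp (h i)
  exact continuous_finsetSum _ fun i _ => this i

lemma continuous_pd {f : Euc d → V} (hf : ContDiff ℝ 1 f) (i : Fin d) : Continuous (pd i f) :=
  (hf.continuous_fderiv one_ne_zero).clm_apply continuous_const

lemma isTorusFun_fderiv {f : Euc d → V} (hf : IsTorusFun f) : IsTorusFun (fderiv ℝ f) := by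
  intro j x
  have : (fun y => f (y + EuclideanSpace.single j 1)) = f := funext (hf j)
  rw [← fderiv_comp_add_right, this]

lemma IsTorusFun.pd {f : Euc d → V} (hf : IsTorusFun f) (i : Fin d) : IsTorusFun (pd i f) := by
  intro j x
  rw [_root_.pd, _root_.pd, isTorusFun_fderiv hf]

lemma IsC1.differentiable {f : Euc d → V} (hf : IsC1 f) : Differentiable ℝ f :=
  hf.2.differentiable one_ne_zero

lemma IsC1.continuous_pd {f : Euc d → V} (hf : IsC1 f) (i : Fin d) : Continuous (pd i f) :=
  _root_.continuous_pd hf.2 i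

lemma IsC1.add {f g : Euc d → V} (hf : IsC1 f) (hg : IsC1 g) : IsC1 (f + g) :=
  ⟨fun i x => by simp [hf.1 i x, hg.1 i x], hf.2.add hg.2⟩

lemma IsC1.sub {f g : Euc d → V} (hf : IsC1 f) (hg : IsC1 g) : IsC1 (f - g) :=
  ⟨fun i x => by simp [hf.1 i x, hg.1 i x], hf.2.sub hg.2⟩

/-! ### The norms -/

lemma c0Norm_le_iff {f : Euc d → V} {C : ℝ} (hC : 0 ≤ C) :
    c0Norm f ≤ ENNReal.ofReal C ↔ ∀ x, ‖f x‖ ≤ C := by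
  simp only [c0Norm, iSup_le_iff, ← ofReal_norm]
  exact forall_congr' fun x => ENNReal.ofReal_le_ofReal_iff hC

lemma c1Norm_le_iff {f : Euc d → V} {C : ℝ} (hC : 0 ≤ C) :
    c1Norm f ≤ ENNReal.ofReal C ↔ (∀ x, ‖f x‖ ≤ C) ∧ ∀ i x, ‖pd i f x‖ ≤ C := by
  simp only [c1Norm, max_le_iff, iSup_le_iff, c0Norm_le_iff hC]

lemma c0Norm_add_le (f g : Euc d → V) : c0Norm (f + g) ≤ c0Norm f + c0Norm g :=
  iSup_le fun x => (enorm_add_le _ _).trans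
    (add_le_add (le_iSup (fun x => ‖f x‖ₑ) x) (le_iSup (fun x => ‖g x‖ₑ) x))

lemma c1Norm_add_le {f g : Euc d → V} (hf : Differentiable ℝ f) (hg : Differentiable ℝ g) :
    c1Norm (f + g) ≤ c1Norm f + c1Norm g := by
  refine max_le ((c0Norm_add_le f g).trans (add_le_add (le_max_left _ _) (le_max_left _ _)))
    (iSup_le fun i => ?_)
  rw [show pd i (f + g) = pd i f + pd i g from funext fun x => pd_add (hf x) (hg x) i]
  exact (c0Norm_add_le _ _).trans (add_le_add
    ((le_iSup (fun i => c0Norm (pd i f)) i).trans (le_max_right _ _))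
    ((le_iSup (fun i => c0Norm (pd i g)) i).trans (le_max_right _ _)))

lemma c0Norm_neg (f : Euc d → V) : c0Norm (-f) = c0Norm f := by
  simp [c0Norm]

lemma c1Norm_neg (f : Euc d → V) : c1Norm (-f) = c1Norm f := by
  have : ∀ i, pd i (-f) = -pd i f := fun i => by
    ext x
    simp [pd, fderiv_neg]
  simp [c1Norm, c0Norm_neg, this]

lemma qNorm_neg (T γ : ℝ) (A : ℝ → Euc d → V) : qNorm T γ (-A) = qNorm T γ A := by
  simp [qNorm, c0Norm_neg, c1Norm_neg]

lemma qNorm_add_le {T γ : ℝ} {A B : ℝ → Euc d → V} (hA : ∀ t ∈ Ioc 0 T, IsC1 (A t))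
    (hB : ∀ t ∈ Ioc 0 T, IsC1 (B t)) : qNorm T γ (A + B) ≤ qNorm T γ A + qNorm T γ B := by
  unfold qNorm
  rw [add_add_add_comm]
  refine add_le_add (iSup₂_le fun t ht => ?_) (iSup₂_le fun t ht => ?_)
  · refine (mul_le_mul_right (c0Norm_add_le (A t) (B t)) _).trans ?_
    rw [mul_add]
    exact add_le_add (le_iSup₂ (f := fun t _ => ENNReal.ofReal (t ^ γ) * c0Norm (A t)) t ht)
      (le_iSup₂ (f := fun t _ => ENNReal.ofReal (t ^ γ) * c0Norm (B t)) t ht)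
  · refine (mul_le_mul_right
      (c1Norm_add_le (hA t ht).differentiable (hB t ht).differentiable) _).trans ?_
    rw [mul_add]
    exact add_le_add
      (le_iSup₂ (f := fun t _ => ENNReal.ofReal (t ^ (1 / 2 + γ)) * c1Norm (A t)) t ht)
      (le_iSup₂ (f := fun t _ => ENNReal.ofReal (t ^ (1 / 2 + γ)) * c1Norm (B t)) t ht)

lemma qNorm_sub_le {T γ : ℝ} {A B : ℝ → Euc d → V} (hA : ∀ t ∈ Ioc 0 T, IsC1 (A t))
    (hB : ∀ t ∈ Ioc 0 T, IsC1 (B t)) : qNorm T γ (A - B) ≤ qNorm T γ A + qNorm T γ B := by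
  rw [sub_eq_add_neg, ← qNorm_neg T γ B]
  exact qNorm_add_le hA fun t ht => ⟨fun i x => by simp [(hB t ht).1 i x], (hB t ht).2.neg⟩

lemma qNorm_mono {T T' γ γ' : ℝ} (hT : T ≤ T') (hT1 : T ≤ 1) (hγ : γ ≤ γ')
    (A : ℝ → Euc d → V) : qNorm T γ' A ≤ qNorm T' γ A := by
  have hpow : ∀ t ∈ Ioc 0 T, ∀ a b : ℝ, a ≤ b → ENNReal.ofReal (t ^ b) ≤ ENNReal.ofReal (t ^ a) :=
    fun t ht a b hab => ENNReal.ofReal_le_ofReal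
      (Real.rpow_le_rpow_of_exponent_ge ht.1 (ht.2.trans hT1) hab)
  refine add_le_add (iSup₂_le fun t ht => ?_) (iSup₂_le fun t ht => ?_)
  · exact (mul_le_mul_left (hpow t ht _ _ hγ) _).trans
      (le_iSup₂ (f := fun t _ => ENNReal.ofReal (t ^ γ) * c0Norm (A t)) t ⟨ht.1, ht.2.trans hT⟩)
  · exact (mul_le_mul_left (hpow t ht _ _ (by linarith)) _).trans
      (le_iSup₂ (f := fun t _ => ENNReal.ofReal (t ^ (1 / 2 + γ)) * c1Norm (A t)) t
        ⟨ht.1, ht.2.trans hT⟩)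

/-- The pointwise bounds `‖A t‖ ≤ M t ^ {-γ}` and `‖∂ᵢ A t‖ ≤ M t ^ {-1/2 - γ}` on `(0, T]`,
equivalent up to a factor `2` to `‖A‖_{Q_T ^ γ} ≤ M`. -/
def JetBound (T γ M : ℝ) (A : ℝ → Euc d → V) : Prop :=
  ∀ t ∈ Ioc 0 T, ∀ x, ‖A t x‖ ≤ M * t ^ (-γ) ∧ ∀ i, ‖pd i (A t) x‖ ≤ M * t ^ (-(1 / 2 + γ))

lemma ofReal_rpow_mul_le_iff {t γ M : ℝ} (ht : 0 < t) (c : ℝ≥0∞) :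
    ENNReal.ofReal (t ^ γ) * c ≤ ENNReal.ofReal M ↔ c ≤ ENNReal.ofReal (M * t ^ (-γ)) := by
  have h0 : 0 < t ^ γ := Real.rpow_pos_of_pos ht _
  rw [mul_comm M, ENNReal.ofReal_mul (Real.rpow_nonneg ht.le _), Real.rpow_neg ht.le,
    ENNReal.ofReal_inv_of_pos h0, ENNReal.mul_le_iff_le_inv (by simpa using h0) (by simp)]

lemma JetBound.qNorm_le {T γ M : ℝ} {A : ℝ → Euc d → V} (h : JetBound T γ M A) (hM : 0 ≤ M)
    (hT : T ≤ 1) : qNorm T γ A ≤ ENNReal.ofReal (2 * M) := by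
  rw [two_mul, ENNReal.ofReal_add hM hM]
  refine add_le_add (iSup₂_le fun t ht => ?_) (iSup₂_le fun t ht => ?_)
  · rw [ofReal_rpow_mul_le_iff ht.1, c0Norm_le_iff (by have := ht.1; positivity)]
    exact fun x => (h t ht x).1
  · rw [ofReal_rpow_mul_le_iff ht.1, c1Norm_le_iff (by have := ht.1; positivity)]
    refine ⟨fun x => (h t ht x).1.trans ?_, fun i x => (h t ht x).2 i⟩
    exact mul_le_mul_of_nonneg_left
      (Real.rpow_le_rpow_of_exponent_ge ht.1 (ht.2.trans hT) (by linarith)) hM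

lemma jetBound_of_qNorm_le {T γ M : ℝ} {A : ℝ → Euc d → V} (hM : 0 ≤ M)
    (h : qNorm T γ A ≤ ENNReal.ofReal M) : JetBound T γ M A := by
  intro t ht x
  have h0 := (ofReal_rpow_mul_le_iff ht.1 _).1 <|
    (le_iSup₂ (f := fun t _ => ENNReal.ofReal (t ^ γ) * c0Norm (A t)) t ht).trans
      (le_self_add.trans h)
  have h1 := (ofReal_rpow_mul_le_iff ht.1 _).1 <|
    (le_iSup₂ (f := fun t _ => ENNReal.ofReal (t ^ (1 / 2 + γ)) * c1Norm (A t)) t ht).trans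
      (le_add_self.trans h)
  rw [c0Norm_le_iff (by have := ht.1; positivity)] at h0
  rw [c1Norm_le_iff (by have := ht.1; positivity)] at h1
  exact ⟨h0 x, fun i => h1.2 i x⟩

lemma JetBound.mono {T T' γ M M' : ℝ} {A : ℝ → Euc d → V} (h : JetBound T' γ M A) (hT : T ≤ T')
    (hM : M ≤ M') : JetBound T γ M' A := fun t ht x =>
  have h' := h t ⟨ht.1, ht.2.trans hT⟩ x
  ⟨h'.1.trans (mul_le_mul_of_nonneg_right hM (Real.rpow_nonneg ht.1.le _)),
    fun i => (h'.2 i).trans (mul_le_mul_of_nonneg_right hM (Real.rpow_nonneg ht.1.le _))⟩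

/-- A path of `C ^ 1` functions on the torus, over the times in `S`, which is jointly continuous in
time and space together with its partial derivatives. -/
structure JetCont (S : Set ℝ) (A : ℝ → Euc d → V) : Prop where
  isC1 : ∀ t ∈ S, IsC1 (A t)
  cont : ContinuousOn (fun p : ℝ × Euc d => A p.1 p.2) (S ×ˢ univ)
  cont_pd : ∀ i, ContinuousOn (fun p : ℝ × Euc d => pd i (A p.1) p.2) (S ×ˢ univ)

lemma JetCont.mono {S S' : Set ℝ} {A : ℝ → Euc d → V} (h : JetCont S' A) (hS : S ⊆ S') :
    JetCont S A :=
  ⟨fun t ht => h.isC1 t (hS ht), h.cont.mono (prod_mono_left hS),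
    fun i => (h.cont_pd i).mono (prod_mono_left hS)⟩

lemma JetCont.add {S : Set ℝ} {A B : ℝ → Euc d → V} (hA : JetCont S A) (hB : JetCont S B) :
    JetCont S (A + B) := by
  refine ⟨fun t ht => (hA.isC1 t ht).add (hB.isC1 t ht), hA.cont.add hB.cont, fun i => ?_⟩
  refine ((hA.cont_pd i).add (hB.cont_pd i)).congr fun p hp => ?_
  exact pd_add ((hA.isC1 _ hp.1).differentiable _) ((hB.isC1 _ hp.1).differentiable _) i

lemma continuousOn_of_uniform {F : ℝ → Euc d → V} {S : Set ℝ} (hF : ∀ t ∈ S, Continuous (F t))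
    (h : ∀ t ∈ S, ∀ ε > 0, ∀ᶠ s in 𝓝[S] t, ∀ x, ‖F s x - F t x‖ ≤ ε) :
    ContinuousOn (fun p : ℝ × Euc d => F p.1 p.2) (S ×ˢ univ) := by
  rintro ⟨t, x⟩ ⟨ht, -⟩
  rw [ContinuousWithinAt, nhdsWithin_prod_eq, nhdsWithin_univ, Metric.tendsto_nhds]
  intro ε hε
  have h1 := h t ht (ε / 2) (by positivity)
  have h2 : ∀ᶠ y in 𝓝 x, dist (F t y) (F t x) < ε / 2 :=
    Metric.tendsto_nhds.1 (hF t ht).continuousAt _ (by positivity)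
  filter_upwards [h1.prod_mk h2] with p hp
  have h3 := hp.1 p.2
  have h4 := hp.2
  rw [← dist_eq_norm] at h3
  calc dist (F p.1 p.2) (F t x) ≤ dist (F p.1 p.2) (F t p.2) + dist (F t p.2) (F t x) :=
        dist_triangle _ _ _
    _ < ε := by linarith

lemma MemQ.jetCont {T γ : ℝ} {A : ℝ → Euc d → V} (h : MemQ T γ A) : JetCont (Ioc 0 T) A := by
  have key : ∀ t ∈ Ioc 0 T, ∀ ε > 0, ∀ᶠ s in 𝓝[Ioc 0 T] t,
      (∀ x, ‖A s x - A t x‖ ≤ ε) ∧ ∀ i x, ‖pd i (A s) x - pd i (A t) x‖ ≤ ε := by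
    intro t ht ε hε
    filter_upwards [(h.continuous t ht).eventually (Iio_mem_nhds (ENNReal.ofReal_pos.2 hε)),
      self_mem_nhdsWithin] with s hs hsT
    have := (c1Norm_le_iff hε.le).1 (le_of_lt hs)
    refine ⟨this.1, fun i x => ?_⟩
    rw [← pd_sub ((h.isC1 s hsT).differentiable x) ((h.isC1 t ht).differentiable x)]
    exact this.2 i x
  exact ⟨h.isC1,
    continuousOn_of_uniform (fun t ht => (h.isC1 t ht).2.continuous)
      fun t ht ε hε => (key t ht ε hε).mono fun s hs => hs.1,
    fun i => continuousOn_of_uniform (F := fun t => pd i (A t))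
      (fun t ht => (h.isC1 t ht).continuous_pd i)
      fun t ht ε hε => (key t ht ε hε).mono fun s hs => hs.2 i⟩

lemma JetCont.memQ {T γ : ℝ} {A : ℝ → Euc d → V} (h : JetCont (Ioc 0 T) A)
    (hfin : qNorm T γ A < ⊤) : MemQ T γ A := by
  refine ⟨h.isC1, fun t ht => ?_, hfin⟩
  rw [ENNReal.tendsto_nhds_zero]
  intro ε hε
  obtain ⟨δ, hδ, hδε⟩ := ENNReal.lt_iff_exists_nnreal_btwn.1 hε
  have hδ' : (0 : ℝ) < δ := by exact_mod_cast hδ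
  have h1 := eventually_forall_norm_sub_le (fun s hs => (h.isC1 s hs).1) h.cont ht hδ'
  have h2 : ∀ᶠ s in 𝓝[Ioc 0 T] t, ∀ i, ∀ x, ‖pd i (A s) x - pd i (A t) x‖ ≤ δ :=
    eventually_all.2 fun i => eventually_forall_norm_sub_le (F := fun t => pd i (A t))
      (fun s hs => (h.isC1 s hs).1.pd i) (h.cont_pd i) ht hδ'
  filter_upwards [h1, h2, self_mem_nhdsWithin] with s hs1 hs2 hsT
  refine le_trans ?_ hδε.le
  rw [← ENNReal.ofReal_coe_nnreal, c1Norm_le_iff hδ'.le]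
  refine ⟨hs1, fun i x => ?_⟩
  rw [pd_sub ((h.isC1 s hsT).differentiable x) ((h.isC1 t ht).differentiable x)]
  exact hs2 i x

end Torus

/-! ### The heat semigroup -/

section Heat

variable {d : ℕ} {V : Type*} [NormedAddCommGroup V] [NormedSpace ℝ V] [CompleteSpace V]

/-- The density of the heat kernel at time `1`. -/
noncomputable def gaussDensity (z : Euc d) : ℝ :=
  (4 * Real.pi) ^ (-(d : ℝ) / 2) * Real.exp (-(1 / 4) * ‖z‖ ^ 2)

/-- The heat kernel at time `1` as a measure, i.e. the centred Gaussian measure with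
covariance `2`. -/
noncomputable def heatMeasure (d : ℕ) : Measure (Euc d) :=
  volume.withDensity fun z => ENNReal.ofReal (gaussDensity z)

lemma gaussDensity_nonneg (z : Euc d) : 0 ≤ gaussDensity z := by
  unfold gaussDensity; positivity

lemma continuous_gaussDensity : Continuous (gaussDensity (d := d)) := by
  unfold gaussDensity; fun_prop

lemma integral_heatMeasure (f : Euc d → V) :
    ∫ z, f z ∂heatMeasure d = ∫ z, gaussDensity z • f z := by
  rw [heatMeasure, integral_withDensity_eq_integral_toReal_smul
    (by have := continuous_gaussDensity (d := d); fun_prop) (by simp)]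
  simp [ENNReal.toReal_ofReal, gaussDensity_nonneg]

lemma integrable_heatMeasure_iff {f : Euc d → V} :
    Integrable f (heatMeasure d) ↔ Integrable fun z => gaussDensity z • f z := by
  rw [heatMeasure, integrable_withDensity_iff_integrable_smul'
    (by have := continuous_gaussDensity (d := d); fun_prop) (by simp)]
  simp [ENNReal.toReal_ofReal, gaussDensity_nonneg]

lemma integrable_exp_neg_mul_sq_norm {b : ℝ} (hb : 0 < b) :
    Integrable fun z : Euc d => Real.exp (-b * ‖z‖ ^ 2) := by
  have h := (GaussianFourier.integrable_cexp_neg_mul_sq_norm_add (V := Euc d) (b := (b : ℂ))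
    (by simpa using hb) 0 0).norm
  refine h.congr (Eventually.of_forall fun z => ?_)
  simp [Complex.norm_exp, ← Complex.ofReal_pow]

instance : IsProbabilityMeasure (heatMeasure d) := by
  constructor
  have h1 : ∫ z : Euc d, gaussDensity z = 1 := by
    unfold gaussDensity
    rw [integral_const_mul, GaussianFourier.integral_rexp_neg_mul_sq_norm (by norm_num)]
    rw [finrank_euclideanSpace_fin, show Real.pi / (1 / 4) = 4 * Real.pi by ring,
      ← Real.rpow_add (by positivity)]
    simp [neg_div]
  rw [heatMeasure, withDensity_apply _ MeasurableSet.univ, Measure.restrict_univ,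
    ← ofReal_integral_eq_lintegral_ofReal _ (Eventually.of_forall gaussDensity_nonneg), h1]
  · simp
  · exact (integrable_exp_neg_mul_sq_norm (by norm_num)).const_mul _

lemma integrable_norm_heatMeasure : Integrable (fun z : Euc d => ‖z‖) (heatMeasure d) := by
  rw [integrable_heatMeasure_iff]
  have h := ((integrable_exp_neg_mul_sq_norm (d := d) (b := 1 / 8) (by norm_num)).const_mul
    ((4 * Real.pi) ^ (-(d : ℝ) / 2) * 3))
  refine h.mono' (by have := continuous_gaussDensity (d := d); fun_prop)
    (Eventually.of_forall fun z => ?_)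
  rw [smul_eq_mul, norm_mul, norm_norm, Real.norm_of_nonneg (gaussDensity_nonneg z), gaussDensity,
    mul_assoc, mul_assoc]
  refine mul_le_mul_of_nonneg_left ?_ (by positivity)
  rw [show -(1 / 4) * ‖z‖ ^ 2 = -(1 / 8) * ‖z‖ ^ 2 + -(1 / 8 * ‖z‖ ^ 2) by ring, Real.exp_add,
    mul_assoc, mul_comm (3 : ℝ)]
  refine mul_le_mul_of_nonneg_left ?_ (Real.exp_pos _).le
  rw [Real.exp_neg, inv_mul_le_iff₀ (Real.exp_pos _)]
  nlinarith [Real.add_one_le_exp (1 / 8 * ‖z‖ ^ 2), sq_nonneg (‖z‖ - 2), norm_nonneg z]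

lemma heat_eq (t : ℝ) (f : Euc d → V) (x : Euc d) :
    heat t f x = ∫ z, f (x + √t • z) ∂heatMeasure d := by
  by_cases ht : t ≤ 0
  · simp [heat, ht, Real.sqrt_eq_zero_of_nonpos ht]
  push Not at ht
  have hs : 0 < √t := Real.sqrt_pos.2 ht
  rw [heat, if_neg (not_le.2 ht), integral_heatMeasure]
  have h1 := Measure.integral_comp_smul (μ := volume)
    (fun y : Euc d =>
      ((4 * Real.pi * t) ^ (-(d : ℝ) / 2) * Real.exp (-‖y‖ ^ 2 / (4 * t))) • f (x + y)) (√t)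
  have h2 :
      ∫ y : Euc d, ((4 * Real.pi * t) ^ (-(d : ℝ) / 2) * Real.exp (-‖x - y‖ ^ 2 / (4 * t))) • f y =
      ∫ y : Euc d,
        ((4 * Real.pi * t) ^ (-(d : ℝ) / 2) * Real.exp (-‖y‖ ^ 2 / (4 * t))) • f (x + y) := by
    rw [← integral_add_left_eq_self _ x]
    congr 1
    ext y
    rw [show x - (x + y) = -y by abel, norm_neg]
  have h3 : ∀ z : Euc d, (4 * Real.pi * t) ^ (-(d : ℝ) / 2) * Real.exp (-‖√t • z‖ ^ 2 / (4 * t))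
      = t ^ (-(d : ℝ) / 2) * gaussDensity z := by
    intro z
    rw [gaussDensity, Real.mul_rpow (by positivity) ht.le, norm_smul, mul_pow,
      Real.norm_of_nonneg hs.le, Real.sq_sqrt ht.le,
      show -(t * ‖z‖ ^ 2) / (4 * t) = -(1 / 4) * ‖z‖ ^ 2 by field_simp]
    ring
  rw [h2]
  simp_rw [h3, mul_smul, integral_smul] at h1
  have h4 : |(√t ^ Module.finrank ℝ (Euc d))⁻¹| = t ^ (-(d : ℝ) / 2) := by
    rw [finrank_euclideanSpace_fin, abs_of_pos (by positivity), Real.sqrt_eq_rpow,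
      ← Real.rpow_natCast, ← Real.rpow_mul ht.le, ← Real.rpow_neg ht.le]
    congr 1; ring
  rw [h4] at h1
  simp_rw [mul_smul, integral_smul]
  exact (smul_right_injective V (Real.rpow_pos_of_pos ht _).ne' h1).symm

lemma heat_of_nonpos {t : ℝ} (ht : t ≤ 0) (f : Euc d → V) : heat t f = f := by
  ext x; simp [heat, ht]

lemma heat_zero (f : Euc d → V) : heat 0 f = f := heat_of_nonpos le_rfl f

lemma integrable_heat {f : Euc d → V} (hf : Continuous f) {C : ℝ} (hC : ∀ x, ‖f x‖ ≤ C) (t : ℝ)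
    (x : Euc d) : Integrable (fun z => f (x + √t • z)) (heatMeasure d) :=
  Integrable.mono' (integrable_const C) (by fun_prop) (Eventually.of_forall fun z => hC _)

lemma norm_heat_le {f : Euc d → V} {C : ℝ} (hC : ∀ x, ‖f x‖ ≤ C) (t : ℝ) (x : Euc d) :
    ‖heat t f x‖ ≤ C := by
  rw [heat_eq]
  refine (norm_integral_le_of_norm_le_const (Eventually.of_forall fun z => hC _)).trans ?_
  simp

lemma heat_add_fun {f g : Euc d → V} (hf : Continuous f) {C : ℝ} (hC : ∀ x, ‖f x‖ ≤ C)
    (hg : Continuous g) {C' : ℝ} (hC' : ∀ x, ‖g x‖ ≤ C') (t : ℝ) :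
    heat t (f + g) = heat t f + heat t g := by
  ext x
  simp only [heat_eq, Pi.add_apply]
  exact integral_add (integrable_heat hf hC t x) (integrable_heat hg hC' t x)

lemma heat_smul_fun (c : ℝ) (f : Euc d → V) (t : ℝ) : heat t (c • f) = c • heat t f := by
  ext x
  simp only [heat_eq, Pi.smul_apply, integral_smul]

lemma heat_sub_fun {f g : Euc d → V} (hf : Continuous f) {C : ℝ} (hC : ∀ x, ‖f x‖ ≤ C)
    (hg : Continuous g) {C' : ℝ} (hC' : ∀ x, ‖g x‖ ≤ C') (t : ℝ) :
    heat t (f - g) = heat t f - heat t g := by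
  ext x
  simp only [heat_eq, Pi.sub_apply]
  exact integral_sub (integrable_heat hf hC t x) (integrable_heat hg hC' t x)

lemma heat_comp_add_right (f : Euc d → V) (t : ℝ) (v x : Euc d) :
    heat t (fun y => f (y + v)) x = heat t f (x + v) := by
  simp only [heat_eq]
  congr 1; ext z; congr 1; abel

lemma IsTorusFun.heat {f : Euc d → V} (hf : IsTorusFun f) (t : ℝ) : IsTorusFun (heat t f) := by
  intro i x
  rw [← heat_comp_add_right]
  congr 1
  ext y
  exact hf i y

/-- Joint continuity of `heat r f` in the time `r`, the point, and a parameter in `f`, for functions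
which are bounded locally uniformly in the parameter. -/
lemma continuousOn_heat {P : Type*} [TopologicalSpace P] [FirstCountableTopology P] {Q : Set P}
    {f : P → Euc d → V} {r c : P → ℝ} {x : P → Euc d}
    (hf : ContinuousOn (fun p : P × Euc d => f p.1 p.2) (Q ×ˢ univ)) (hc : ContinuousOn c Q)
    (hb : ∀ q ∈ Q, ∀ y, ‖f q y‖ ≤ c q) (hr : ContinuousOn r Q) (hx : ContinuousOn x Q) :
    ContinuousOn (fun q => heat (r q) (f q) (x q)) Q := by
  have hfq : ∀ q ∈ Q, Continuous (f q) := fun q hq => by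
    rw [← continuousOn_univ]
    exact hf.comp (f := fun y => (q, y)) (by fun_prop) fun y _ => ⟨hq, mem_univ _⟩
  simp only [heat_eq]
  intro q₀ hq₀
  refine continuousWithinAt_of_dominated (bound := fun _ => c q₀ + 1) ?_ ?_ (integrable_const _) ?_
  · filter_upwards [self_mem_nhdsWithin] with q hq
    have := hfq q hq
    fun_prop
  · filter_upwards [self_mem_nhdsWithin,
      (hc q₀ hq₀).tendsto.eventually_lt_const (lt_add_one (c q₀))] with q hq hq'
    exact Eventually.of_forall fun z => (hb q hq _).trans (le_of_lt hq')
  · refine Eventually.of_forall fun z => ?_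
    have h : ContinuousOn (fun q => (q, x q + √(r q) • z)) Q := by fun_prop
    exact (hf.comp h fun q hq => ⟨hq, mem_univ _⟩) q₀ hq₀

/-! ### Smoothing by the heat semigroup -/

lemma hasFDerivAt_gaussDensity (z : Euc d) :
    HasFDerivAt gaussDensity (-(gaussDensity z / 2) • innerSL ℝ z) z := by
  have h1 : HasFDerivAt (fun z : Euc d => ‖z‖ ^ 2) (2 • innerSL ℝ z) z :=
    (hasStrictFDerivAt_norm_sq z).hasFDerivAt
  have h2 := ((h1.const_mul (-(1 / 4))).exp).const_mul ((4 * Real.pi) ^ (-(d : ℝ) / 2))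
  refine h2.congr_fderiv ?_
  ext v
  simp [gaussDensity]
  ring

/-- The derivative of `y ↦ ∫ φ (z + y) dz` with respect to the Gaussian measure, for a continuous
bounded `φ`: the derivative falls on the Gaussian density. -/
lemma hasFDerivAt_integral_heatMeasure {φ : Euc d → V} (hφ : Continuous φ) {C : ℝ}
    (hC : ∀ z, ‖φ z‖ ≤ C) :
    HasFDerivAt (fun y => ∫ z, φ (z + y) ∂heatMeasure d)
      (∫ z, ((1 / 2 : ℝ) • innerSL ℝ z).smulRight (φ z) ∂heatMeasure d) 0 := by
  have hC0 : 0 ≤ C := (norm_nonneg _).trans (hC 0)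
  have h1 : (fun y => ∫ z, φ (z + y) ∂heatMeasure d) =
      fun y : Euc d => ∫ z, gaussDensity (z - y) • φ z := by
    ext y
    rw [integral_heatMeasure, ← integral_sub_right_eq_self _ y]
    simp
  have hb : Integrable (fun z : Euc d => C * ((4 * Real.pi) ^ (-(d : ℝ) / 2) * Real.exp (1 / 4) * 6)
      * Real.exp (-(1 / 16) * ‖z‖ ^ 2)) :=
    (integrable_exp_neg_mul_sq_norm (by norm_num)).const_mul _
  have hcont := continuous_gaussDensity (d := d)
  have key := hasFDerivAt_integral_of_dominated_of_fderiv_le (𝕜 := ℝ) (μ := volume)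
    (F := fun (y z : Euc d) => gaussDensity (z - y) • φ z)
    (F' := fun (y z : Euc d) => ((gaussDensity (z - y) / 2) • innerSL ℝ (z - y)).smulRight (φ z))
    (x₀ := 0) (Metric.ball_mem_nhds (0 : Euc d) one_pos)
    (Eventually.of_forall fun y => by fun_prop) ?_ ?_
    (Eventually.of_forall fun z y hy => ?_) hb (Eventually.of_forall fun z y hy => ?_)
  · rw [h1]
    refine key.congr_fderiv ?_
    rw [integral_heatMeasure]
    congr 1
    ext z v
    simp [smul_smul]
    ring_nf
  · have : Integrable φ (heatMeasure d) :=
      Integrable.mono' (integrable_const C) (by fun_prop) (Eventually.of_forall hC)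
    simpa using integrable_heatMeasure_iff.1 this
  · have : Continuous fun z : Euc d => ContinuousLinearMap.smulRightL ℝ (Euc d) V
      ((gaussDensity (z - 0) / 2) • innerSL ℝ (z - 0)) (φ z) := by fun_prop
    exact this.aestronglyMeasurable
  · rw [ContinuousLinearMap.norm_smulRight_apply, norm_smul, innerSL_apply_norm,
      Real.norm_of_nonneg (by have := gaussDensity_nonneg (z - y); positivity), mul_comm, mul_assoc]
    refine mul_le_mul (hC z) ?_ (by have := gaussDensity_nonneg (z - y); positivity) hC0
    have hy1 : ‖y‖ < 1 := by simpa using hy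
    have e1 : ‖z‖ ^ 2 ≤ 2 * ‖z - y‖ ^ 2 + 2 := by
      have : ‖z‖ ≤ ‖z - y‖ + ‖y‖ := by simpa using norm_add_le (z - y) y
      nlinarith [norm_nonneg z, norm_nonneg y, sq_nonneg (‖z - y‖ - ‖y‖), norm_nonneg (z - y)]
    -- half of the Gaussian decay absorbs the factor `‖z - y‖`, and the rest is centred at `z`
    have e2 : ‖z - y‖ ≤ 12 * Real.exp (1 / 8 * ‖z - y‖ ^ 2) := by
      nlinarith [Real.add_one_le_exp (1 / 8 * ‖z - y‖ ^ 2), sq_nonneg (‖z - y‖ - 2)]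
    have e3 : Real.exp (-(1 / 4) * ‖z - y‖ ^ 2) * Real.exp (1 / 8 * ‖z - y‖ ^ 2) ≤
        Real.exp (1 / 4) * Real.exp (-(1 / 16) * ‖z‖ ^ 2) := by
      rw [← Real.exp_add, ← Real.exp_add]
      exact Real.exp_le_exp.2 (by linarith)
    have hπ : 0 ≤ (4 * Real.pi) ^ (-(d : ℝ) / 2) := by positivity
    calc gaussDensity (z - y) / 2 * ‖z - y‖
        ≤ gaussDensity (z - y) / 2 * (12 * Real.exp (1 / 8 * ‖z - y‖ ^ 2)) :=
          mul_le_mul_of_nonneg_left e2 (by have := gaussDensity_nonneg (z - y); positivity)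
      _ = 6 * (4 * Real.pi) ^ (-(d : ℝ) / 2) *
          (Real.exp (-(1 / 4) * ‖z - y‖ ^ 2) * Real.exp (1 / 8 * ‖z - y‖ ^ 2)) := by
          rw [gaussDensity]; ring
      _ ≤ 6 * (4 * Real.pi) ^ (-(d : ℝ) / 2) *
          (Real.exp (1 / 4) * Real.exp (-(1 / 16) * ‖z‖ ^ 2)) :=
          mul_le_mul_of_nonneg_left e3 (by positivity)
      _ = _ := by ring
  · have h2 : HasFDerivAt (fun y : Euc d => gaussDensity (z - y))
        (-(-(gaussDensity (z - y) / 2) • innerSL ℝ (z - y))) y := by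
      have := (hasFDerivAt_gaussDensity (z - y)).comp y ((hasFDerivAt_id y).const_sub z)
      refine this.congr_fderiv ?_
      ext v; simp
    refine (h2.smul_const (φ z)).congr_fderiv ?_
    ext v; simp

/-- Half the first absolute moment of the Gaussian measure, the constant in the gradient bound for
the heat semigroup. -/
noncomputable def heatConst (d : ℕ) : ℝ := 1 / 2 * ∫ z, ‖z‖ ∂heatMeasure d

lemma heatConst_nonneg : 0 ≤ heatConst d := by
  unfold heatConst; positivity

/-- The gradient of the heat semigroup, at the cost of a factor `t ^ {-1/2}`. -/
lemma hasFDerivAt_heat {f : Euc d → V} (hf : Continuous f) {C : ℝ} (hC : ∀ x, ‖f x‖ ≤ C) {t : ℝ}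
    (ht : 0 < t) (x : Euc d) :
    HasFDerivAt (heat t f) ((√t)⁻¹ •
      ∫ z, ((1 / 2 : ℝ) • innerSL ℝ z).smulRight (f (x + √t • z)) ∂heatMeasure d) x := by
  have hs : √t ≠ 0 := (Real.sqrt_pos.2 ht).ne'
  have h := hasFDerivAt_integral_heatMeasure (φ := fun z => f (x + √t • z)) (by fun_prop)
    fun z => hC _
  have h1 : HasFDerivAt (fun y : Euc d => (√t)⁻¹ • (y - x))
      ((√t)⁻¹ • ContinuousLinearMap.id ℝ (Euc d)) x :=
    ((hasFDerivAt_id (𝕜 := ℝ) x).sub_const x).fun_const_smul _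
  have h2 := HasFDerivAt.comp (g := fun y => ∫ z, f (x + √t • (z + y)) ∂heatMeasure d) x
    (by simpa using h) h1
  refine (h2.congr_of_eventuallyEq (Eventually.of_forall fun y => ?_)).congr_fderiv ?_
  · rw [heat_eq]
    simp only [Function.comp]
    congr 1; ext z; congr 1
    rw [smul_add, smul_smul, mul_inv_cancel₀ hs, one_smul]
    abel
  · ext v; simp

lemma integrable_coord_smul {f : Euc d → V} (hf : Continuous f) {C : ℝ} (hC : ∀ x, ‖f x‖ ≤ C)
    (i : Fin d) : Integrable (fun z => z i • f z) (heatMeasure d) := by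
  refine (integrable_norm_heatMeasure.mul_const C).mono' (by fun_prop)
    (Eventually.of_forall fun z => ?_)
  rw [norm_smul]
  exact mul_le_mul (PiLp.norm_apply_le z i) (hC _) (norm_nonneg _) (norm_nonneg _)

lemma pd_heat {f : Euc d → V} (hf : Continuous f) {C : ℝ} (hC : ∀ x, ‖f x‖ ≤ C) {t : ℝ}
    (ht : 0 < t) (i : Fin d) (x : Euc d) :
    pd i (heat t f) x = (2 * √t)⁻¹ • ∫ z, z i • f (x + √t • z) ∂heatMeasure d := by
  rw [(hasFDerivAt_heat hf hC ht x).pd_eq, _root_.smul_apply,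
    ContinuousLinearMap.integral_apply]
  · rw [mul_inv, mul_comm, mul_smul, ← integral_smul (2⁻¹ : ℝ)]
    congr 2
    ext z
    simp [EuclideanSpace.inner_single_right, smul_smul]
  · refine ((integrable_norm_heatMeasure.mul_const (1 / 2 * C))).mono' ?_
      (Eventually.of_forall fun z => ?_)
    · have : Continuous fun z : Euc d => ContinuousLinearMap.smulRightL ℝ (Euc d) V
        ((1 / 2 : ℝ) • innerSL ℝ z) (f (x + √t • z)) := by fun_prop
      exact this.aestronglyMeasurable
    · rw [ContinuousLinearMap.norm_smulRight_apply, norm_smul, innerSL_apply_norm]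
      have := hC (x + √t • z)
      have := mul_le_mul_of_nonneg_left this (norm_nonneg z)
      norm_num
      linarith

lemma norm_pd_heat_le {f : Euc d → V} (hf : Continuous f) {C : ℝ} (hC : ∀ x, ‖f x‖ ≤ C) {t : ℝ}
    (ht : 0 < t) (i : Fin d) (x : Euc d) :
    ‖pd i (heat t f) x‖ ≤ heatConst d * C * t ^ (-(1 / 2) : ℝ) := by
  rw [pd_heat hf hC ht, norm_smul, Real.rpow_neg ht.le, ← Real.sqrt_eq_rpow]
  have h1 : ‖∫ z, z i • f (x + √t • z) ∂heatMeasure d‖ ≤ ∫ z, ‖z‖ * C ∂heatMeasure d := by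
    refine norm_integral_le_of_norm_le (integrable_norm_heatMeasure.mul_const C)
      (Eventually.of_forall fun z => ?_)
    rw [norm_smul]
    exact mul_le_mul (PiLp.norm_apply_le z i) (hC _) (norm_nonneg _) (norm_nonneg _)
  rw [integral_mul_const] at h1
  have hs : 0 < √t := Real.sqrt_pos.2 ht
  rw [Real.norm_of_nonneg (by positivity), heatConst]
  calc (2 * √t)⁻¹ * ‖∫ z, z i • f (x + √t • z) ∂heatMeasure d‖
      ≤ (2 * √t)⁻¹ * ((∫ z, ‖z‖ ∂heatMeasure d) * C) :=
        mul_le_mul_of_nonneg_left h1 (by positivity)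
    _ = _ := by rw [mul_inv]; ring

lemma differentiable_heat {f : Euc d → V} (hf : Continuous f) {C : ℝ} (hC : ∀ x, ‖f x‖ ≤ C) {t : ℝ}
    (ht : 0 < t) : Differentiable ℝ (heat t f) :=
  fun x => (hasFDerivAt_heat hf hC ht x).differentiableAt

/-- Joint continuity of `∂ᵢ (heat r f)` in the time `r > 0`, the point, and a parameter in `f`, for
functions which are bounded locally uniformly in the parameter. -/
lemma continuousOn_pd_heat {P : Type*} [TopologicalSpace P] [FirstCountableTopology P] {Q : Set P}
    {f : P → Euc d → V} {r c : P → ℝ} {x : P → Euc d}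
    (hf : ContinuousOn (fun p : P × Euc d => f p.1 p.2) (Q ×ˢ univ)) (hc : ContinuousOn c Q)
    (hb : ∀ q ∈ Q, ∀ y, ‖f q y‖ ≤ c q) (hr : ContinuousOn r Q) (hr0 : ∀ q ∈ Q, 0 < r q)
    (hx : ContinuousOn x Q) (i : Fin d) :
    ContinuousOn (fun q => pd i (heat (r q) (f q)) (x q)) Q := by
  have hfq : ∀ q ∈ Q, Continuous (f q) := fun q hq => by
    rw [← continuousOn_univ]
    exact hf.comp (f := fun y => (q, y)) (by fun_prop) fun y _ => ⟨hq, mem_univ _⟩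
  have h1 : ContinuousOn (fun q => (2 * √(r q))⁻¹ •
      ∫ z, z i • f q (x q + √(r q) • z) ∂heatMeasure d) Q := by
    refine ContinuousOn.smul ?_ ?_
    · refine ContinuousOn.inv₀ (by fun_prop) fun q hq => ?_
      have := Real.sqrt_pos.2 (hr0 q hq)
      positivity
    intro q₀ hq₀
    refine continuousWithinAt_of_dominated (bound := fun z => ‖z‖ * (c q₀ + 1)) ?_ ?_
      (integrable_norm_heatMeasure.mul_const _) ?_
    · filter_upwards [self_mem_nhdsWithin] with q hq
      have := hfq q hq
      fun_prop
    · filter_upwards [self_mem_nhdsWithin,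
        (hc q₀ hq₀).tendsto.eventually_lt_const (lt_add_one (c q₀))] with q hq hq'
      refine Eventually.of_forall fun z => ?_
      rw [norm_smul]
      exact mul_le_mul (PiLp.norm_apply_le z i) ((hb q hq _).trans (le_of_lt hq')) (norm_nonneg _)
        (norm_nonneg _)
    · refine Eventually.of_forall fun z => ?_
      have h : ContinuousOn (fun q => (q, x q + √(r q) • z)) Q := by fun_prop
      exact ((hf.comp h fun q hq => ⟨hq, mem_univ _⟩) q₀ hq₀).const_smul _
  exact h1.congr fun q hq => pd_heat (hfq q hq) (hb q hq) (hr0 q hq) i _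

lemma continuous_pd_heat {f : Euc d → V} (hf : Continuous f) {C : ℝ} (hC : ∀ x, ‖f x‖ ≤ C) {t : ℝ}
    (ht : 0 < t) (i : Fin d) : Continuous (pd i (heat t f)) := by
  rw [← continuousOn_univ]
  exact continuousOn_pd_heat (f := fun _ : Euc d => f) (c := fun _ => C) (r := fun _ => t)
    (x := fun y => y) (by fun_prop) (by fun_prop) (fun _ _ y => hC y) (by fun_prop)
    (fun _ _ => ht) (by fun_prop) i

lemma isC1_heat {f : Euc d → V} (hf : Continuous f) (hper : IsTorusFun f) {t : ℝ} (ht : 0 < t) :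
    IsC1 (heat t f) := by
  obtain ⟨C, hC⟩ := hper.exists_bound hf
  exact ⟨hper.heat t, contDiff_one_of_pd (differentiable_heat hf hC ht)
    fun i => continuous_pd_heat hf hC ht i⟩

/-- The heat semigroup commutes with derivatives. -/
lemma pd_heat_eq_heat_pd {f : Euc d → V} (hf : IsC1 f) (t : ℝ) (i : Fin d) (x : Euc d) :
    pd i (heat t f) x = heat t (pd i f) x := by
  obtain ⟨C, hC⟩ := hf.1.exists_bound hf.2.continuous
  have hcf : Continuous (fderiv ℝ f) := hf.2.continuous_fderiv one_ne_zero
  have hper := isTorusFun_fderiv hf.1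
  obtain ⟨C', hC'⟩ := hper.exists_bound hcf
  have key := hasFDerivAt_integral_of_dominated_of_fderiv_le (𝕜 := ℝ) (μ := heatMeasure d)
    (F := fun (y z : Euc d) => f (y + √t • z))
    (F' := fun (y z : Euc d) => fderiv ℝ f (y + √t • z)) (bound := fun _ => C')
    (x₀ := x) (Metric.ball_mem_nhds x one_pos)
    (Eventually.of_forall fun y => by have := hf.2.continuous; fun_prop)
    (integrable_heat hf.2.continuous hC t x) (by fun_prop)
    (Eventually.of_forall fun z y _ => hC' _) (integrable_const _)
    (Eventually.of_forall fun z y _ => by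
      have := (hf.differentiable (y + √t • z)).hasFDerivAt
      exact (this.comp (f := fun y => y + √t • z) y
        ((hasFDerivAt_id y).add_const _)).congr_fderiv (by ext; simp))
  have h1 : heat t f = fun y => ∫ z, f (y + √t • z) ∂heatMeasure d := funext (heat_eq t f)
  rw [h1, key.pd_eq, heat_eq, ContinuousLinearMap.integral_apply]
  · rfl
  · exact Integrable.mono' (integrable_const C') (by fun_prop)
      (Eventually.of_forall fun z => hC' _)

/-! ### The semigroup law and the generator -/

lemma charFun_heatMeasure (ξ : Euc d) :
    charFun (heatMeasure d) ξ = Complex.exp (-(‖ξ‖ ^ 2 : ℝ)) := by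
  rw [charFun_apply, integral_heatMeasure]
  have h := GaussianFourier.integral_cexp_neg_mul_sq_norm_add (V := Euc d) (b := (1 / 4 : ℂ))
    (by norm_num) Complex.I ξ
  have h1 : ∀ z : Euc d, gaussDensity z • Complex.exp ((inner ℝ z ξ : ℝ) * Complex.I) =
      (((4 * Real.pi) ^ (-(d : ℝ) / 2) : ℝ) : ℂ) *
        Complex.exp (-(1 / 4) * ‖z‖ ^ 2 + Complex.I * (inner ℝ ξ z : ℝ)) := by
    intro z
    rw [gaussDensity, Complex.exp_add, real_inner_comm, Complex.real_smul]
    push_cast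
    rw [mul_comm Complex.I]
    ring
  simp_rw [h1]
  rw [integral_const_mul, h, ← mul_assoc, finrank_euclideanSpace_fin]
  have h2 : (((4 * Real.pi) ^ (-(d : ℝ) / 2) : ℝ) : ℂ) * (Real.pi / (1 / 4)) ^ (d / 2 : ℂ) = 1 := by
    rw [show (Real.pi / (1 / 4) : ℂ) ^ (d / 2 : ℂ) = (((4 * Real.pi) ^ ((d : ℝ) / 2) : ℝ) : ℂ) by
      rw [Complex.ofReal_cpow (by positivity)]; push_cast; congr 1; ring]
    rw [← Complex.ofReal_mul, ← Real.rpow_add (by positivity)]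
    simp [neg_div]
  rw [h2, one_mul]
  congr 1
  push_cast
  rw [Complex.I_sq]
  ring

/-- Gaussian measures convolve by addition of their variances. -/
lemma map_prod_heatMeasure {s t : ℝ} (hs : 0 ≤ s) (ht : 0 ≤ t) :
    ((heatMeasure d).prod (heatMeasure d)).map (fun p => √t • p.1 + √s • p.2) =
      (heatMeasure d).map (fun z => √(t + s) • z) := by
  have : IsFiniteMeasure (((heatMeasure d).prod (heatMeasure d)).map
      (fun p => √t • p.1 + √s • p.2)) := Measure.isFiniteMeasure_map _ _
  have : IsFiniteMeasure ((heatMeasure d).map (fun z => √(t + s) • z)) :=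
    Measure.isFiniteMeasure_map _ _
  refine Measure.ext_of_charFun ?_
  ext ξ
  rw [charFun_map_smul, charFun_heatMeasure, charFun_apply,
    integral_map (by fun_prop) (by fun_prop)]
  have h1 : ∀ p : Euc d × Euc d,
      Complex.exp ((inner ℝ (√t • p.1 + √s • p.2) ξ : ℝ) * Complex.I) =
      Complex.exp ((inner ℝ p.1 (√t • ξ) : ℝ) * Complex.I) *
      Complex.exp ((inner ℝ p.2 (√s • ξ) : ℝ) * Complex.I) := by
    intro p
    rw [← Complex.exp_add, inner_add_left, real_inner_smul_left, real_inner_smul_left,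
      real_inner_smul_right, real_inner_smul_right]
    push_cast
    ring_nf
  simp_rw [h1]
  rw [integral_prod_mul (fun z : Euc d => Complex.exp ((inner ℝ z (√t • ξ) : ℝ) * Complex.I))
    (fun z : Euc d => Complex.exp ((inner ℝ z (√s • ξ) : ℝ) * Complex.I)), ← charFun_apply,
    ← charFun_apply, charFun_heatMeasure, charFun_heatMeasure, ← Complex.exp_add]
  congr 1
  simp only [norm_smul, mul_pow, Real.norm_of_nonneg (Real.sqrt_nonneg _), Real.sq_sqrt hs,
    Real.sq_sqrt ht, Real.sq_sqrt (add_nonneg ht hs)]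
  push_cast
  ring

lemma heat_heat {f : Euc d → V} (hf : Continuous f) {C : ℝ} (hC : ∀ x, ‖f x‖ ≤ C) {s t : ℝ}
    (hs : 0 ≤ s) (ht : 0 ≤ t) (x : Euc d) : heat t (heat s f) x = heat (t + s) f x := by
  have h2 : ∫ y, f (x + y) ∂((heatMeasure d).map (fun z => √(t + s) • z)) = heat (t + s) f x := by
    rw [heat_eq, integral_map (by fun_prop) (by fun_prop)]
  rw [← h2, ← map_prod_heatMeasure hs ht, integral_map (by fun_prop) (by fun_prop),
    integral_prod, heat_eq]
  · congr 1
    ext z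
    rw [heat_eq]
    congr 1
    ext w
    rw [add_assoc]
  · exact Integrable.mono' (integrable_const C) (by fun_prop) (Eventually.of_forall fun z => hC _)

/-- The Laplacian, `∑ᵢ ∂ᵢ ∂ᵢ f`. -/
noncomputable def lap (f : Euc d → V) (x : Euc d) : V := ∑ i, pd i (pd i f) x

/-- Gaussian integration by parts turns the time derivative of `f (x + √t z)` into the Laplacian. -/
lemma hasDerivAt_heat {f : Euc d → V} (hf : IsC1 f) (hf' : ∀ i, IsC1 (pd i f)) {t : ℝ} (ht : 0 < t)
    (x : Euc d) : HasDerivAt (fun s => heat s f x) (heat t (lap f) x) t := by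
  obtain ⟨C, hC⟩ := hf.1.exists_bound hf.2.continuous
  have hcf : Continuous (fderiv ℝ f) := hf.2.continuous_fderiv one_ne_zero
  have hper := isTorusFun_fderiv hf.1
  obtain ⟨C', hC'⟩ := hper.exists_bound hcf
  have hs : 0 < √t := Real.sqrt_pos.2 ht
  have key := (hasDerivAt_integral_of_dominated_loc_of_deriv_le (𝕜 := ℝ) (μ := heatMeasure d)
    (F := fun (s : ℝ) (z : Euc d) => f (x + √s • z))
    (F' := fun (s : ℝ) (z : Euc d) => fderiv ℝ f (x + √s • z) ((1 / (2 * √s)) • z))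
    (bound := fun z => (C' * (1 / (2 * √(t / 2)))) * ‖z‖)
    (x₀ := t) (Ioi_mem_nhds (show t / 2 < t by linarith))
    (Eventually.of_forall fun y => by have := hf.2.continuous; fun_prop)
    (integrable_heat hf.2.continuous hC t x) (by fun_prop)
    (Eventually.of_forall fun z s hs => ?_) (integrable_norm_heatMeasure.const_mul _)
    (Eventually.of_forall fun z s hs => ?_)).2
  · have h1 : (fun s => heat s f x) = fun s => ∫ z, f (x + √s • z) ∂heatMeasure d :=
      funext fun s => heat_eq s f x
    rw [h1]
    refine key.congr_deriv ?_
    -- the formula for `∂ᵢ heat t (∂ᵢ f)` is the integration by parts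
    have h2 : ∀ i, heat t (pd i (pd i f)) x =
        (2 * √t)⁻¹ • ∫ z, z i • pd i f (x + √t • z) ∂heatMeasure d := fun i => by
      obtain ⟨Ci, hCi⟩ := (hf' i).1.exists_bound (hf' i).2.continuous
      rw [← pd_heat_eq_heat_pd (hf' i), pd_heat (hf' i).2.continuous hCi ht]
    have h3 : heat t (lap f) x = ∑ i, heat t (pd i (pd i f)) x := by
      simp only [heat_eq, lap]
      refine integral_finsetSum _ fun i _ => ?_
      obtain ⟨Ci, hCi⟩ := ((hf' i).1.pd i).exists_bound ((hf' i).continuous_pd i)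
      exact integrable_heat ((hf' i).continuous_pd i) hCi t x
    rw [h3, Finset.sum_congr rfl fun i _ => h2 i, ← Finset.smul_sum, ← integral_finsetSum,
      ← integral_smul]
    · congr 1
      ext z
      rw [map_smul, fderiv_apply_eq_sum_pd, one_div]
    · intro i _
      obtain ⟨Ci, hCi⟩ := (hf' i).1.exists_bound (hf' i).2.continuous
      exact integrable_coord_smul (f := fun z => pd i f (x + √t • z))
        (by have := (hf' i).2.continuous; fun_prop) (fun z => hCi _) i
  · have hs' : t / 2 < s := hs
    have hC'0 : 0 ≤ C' := (norm_nonneg _).trans (hC' 0)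
    refine (ContinuousLinearMap.le_opNorm _ _).trans ?_
    rw [norm_smul, mul_assoc]
    refine mul_le_mul (hC' _) (mul_le_mul_of_nonneg_right ?_ (norm_nonneg _)) (by positivity) hC'0
    rw [Real.norm_of_nonneg (by positivity)]
    have : 0 < √(t / 2) := Real.sqrt_pos.2 (by positivity)
    gcongr
  · have hs' : 0 < s := (half_pos ht).trans hs
    have h1 : HasDerivAt (fun s : ℝ => x + √s • z) ((1 / (2 * √s)) • z) s :=
      ((Real.hasDerivAt_sqrt hs'.ne').smul_const z).const_add x
    exact (hf.differentiable _).hasFDerivAt.comp_hasDerivAt s h1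

lemma isTorusFun_lap {f : Euc d → V} (hf : IsTorusFun f) : IsTorusFun (lap f) := fun i x => by
  simp only [lap]
  exact Finset.sum_congr rfl fun j _ => ((hf.pd j).pd j) i x

/-- The Laplacian is the generator of the heat semigroup. -/
lemma hasDerivWithinAt_heat_zero {f : Euc d → V} (hf : IsC1 f)
    (hf' : ∀ i, IsC1 (pd i f)) (x : Euc d) :
    HasDerivWithinAt (fun s => heat s f x) (lap f x) (Ici 0) 0 := by
  obtain ⟨C, hC⟩ := hf.1.exists_bound hf.2.continuous
  have hlc : Continuous (lap f) := by
    have := fun i => (hf' i).continuous_pd i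
    unfold lap
    fun_prop
  obtain ⟨C', hC'⟩ := (isTorusFun_lap hf.1).exists_bound hlc
  have hcont : ∀ {g : Euc d → V} {C : ℝ}, Continuous g → (∀ x, ‖g x‖ ≤ C) →
      Continuous fun s => heat s g x := fun {g C} hg hC => by
    rw [← continuousOn_univ]
    exact continuousOn_heat (f := fun _ : ℝ => g) (c := fun _ => C) (r := fun s => s)
      (x := fun _ => x) (by fun_prop) (by fun_prop) (fun _ _ y => hC y) (by fun_prop) (by fun_prop)
  have := hasDerivWithinAt_Ici_of_tendsto_deriv (s := Ioi 0) (f := fun s => heat s f x)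
    (e := lap f x) (a := 0)
    (fun s hs => (hasDerivAt_heat hf hf' hs x).differentiableAt.differentiableWithinAt)
    (hcont hf.2.continuous hC).continuousWithinAt self_mem_nhdsWithin ?_
  · exact this
  · have h1 : Tendsto (fun s => heat s (lap f) x) (𝓝[>] 0) (𝓝 (lap f x)) := by
      have := ((hcont hlc hC').tendsto 0).mono_left (nhdsWithin_le_nhds (s := Ioi 0))
      rwa [heat_zero] at this
    refine h1.congr' ?_
    filter_upwards [self_mem_nhdsWithin] with s hs
    exact (hasDerivAt_heat hf hf' hs x).deriv.symm

end Heat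

/-! ### Duhamel integrals of sources with a singularity at time zero -/

section Duhamel

variable {d : ℕ} {V : Type*} [NormedAddCommGroup V] [NormedSpace ℝ V] [CompleteSpace V]

/-- A continuous source on `(0, T]` of size at most `M s ^ {-a}`. -/
structure IsSource (T a M : ℝ) (F : ℝ → Euc d → V) : Prop where
  cont : ContinuousOn (fun p : ℝ × Euc d => F p.1 p.2) (Ioc 0 T ×ˢ univ)
  bound : ∀ s ∈ Ioc 0 T, ∀ x, ‖F s x‖ ≤ M * s ^ (-a)

variable {T a M : ℝ} {F : ℝ → Euc d → V}

lemma IsSource.continuous (hF : IsSource T a M F) {s : ℝ} (hs : s ∈ Ioc 0 T) :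
    Continuous (F s) := by
  rw [← continuousOn_univ]
  exact hF.cont.comp (f := fun y => (s, y)) (by fun_prop) fun y _ => ⟨hs, mem_univ _⟩

lemma continuousOn_mul_rpow_neg {P : Type*} [TopologicalSpace P] {Q : Set P} {s : P → ℝ}
    (hs : ContinuousOn s Q) (h0 : ∀ q ∈ Q, 0 < s q) (M a : ℝ) :
    ContinuousOn (fun q => M * s q ^ (-a)) Q :=
  (hs.rpow_const fun q hq => Or.inl (h0 q hq).ne').const_mul _

lemma aestronglyMeasurable_uIoc {E : Type*} [TopologicalSpace E]
    [TopologicalSpace.PseudoMetrizableSpace E] {f : ℝ → E} {t : ℝ} (ht : 0 < t)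
    (hf : ContinuousOn f (Ioo 0 t)) : AEStronglyMeasurable f (volume.restrict (uIoc 0 t)) := by
  rw [uIoc_of_le ht.le, ← Measure.restrict_congr_set Ioo_ae_eq_Ioc]
  exact hf.aestronglyMeasurable measurableSet_Ioo

lemma ae_uIoc_of_Ioo {t : ℝ} (ht : 0 < t) {P : ℝ → Prop} (h : ∀ s ∈ Ioo 0 t, P s) :
    ∀ᵐ s ∂volume.restrict (uIoc 0 t), P s := by
  rw [uIoc_of_le ht.le, ← Measure.restrict_congr_set Ioo_ae_eq_Ioc]
  exact (ae_restrict_iff' measurableSet_Ioo).2 (Eventually.of_forall h)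

/-! #### The time kernel -/

lemma intervalIntegrable_rpow_neg {a : ℝ} (ha : a < 1) (t : ℝ) :
    IntervalIntegrable (fun s : ℝ => s ^ (-a)) volume 0 t :=
  intervalIntegral.intervalIntegrable_rpow' (by linarith)

lemma integral_rpow_neg {a : ℝ} (ha : a < 1) (t : ℝ) :
    ∫ s in 0..t, s ^ (-a) = t ^ (1 - a) / (1 - a) := by
  rw [integral_rpow (Or.inl (by linarith)), Real.zero_rpow (by linarith), sub_zero]
  congr 1 <;> [congr 1; skip] <;> ring

lemma intervalIntegrable_sub_rpow (t : ℝ) :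
    IntervalIntegrable (fun s : ℝ => (t - s) ^ (-(1 / 2) : ℝ)) volume 0 t := by
  simpa using ((intervalIntegrable_rpow_neg (a := 1 / 2) (by norm_num) t).comp_sub_left t).symm

lemma integral_sub_rpow (t : ℝ) :
    ∫ s in 0..t, (t - s) ^ (-(1 / 2) : ℝ) = 2 * t ^ (1 / 2 : ℝ) := by
  rw [intervalIntegral.integral_comp_sub_left (fun s : ℝ => s ^ (-(1 / 2) : ℝ)) t, sub_self,
    sub_zero, integral_rpow_neg (by norm_num) t]
  norm_num
  ring

/-- A majorant of the kernel `s ^ {-a} (t - s) ^ {-1/2}` with a singularity at one end in each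
term, instead of an evaluation of the Beta integral. -/
noncomputable def betaMajorant (a t s : ℝ) : ℝ :=
  2 * t ^ (-(1 / 2) : ℝ) * s ^ (-a) + 2 * t ^ (-a) * (t - s) ^ (-(1 / 2) : ℝ)

lemma rpow_neg_le_two_mul {b t s : ℝ} (hb0 : 0 ≤ b) (hb : b ≤ 1) (ht : 0 < t) (hs : t / 2 ≤ s) :
    s ^ (-b) ≤ 2 * t ^ (-b) := by
  calc s ^ (-b) ≤ (t / 2) ^ (-b) :=
        Real.rpow_le_rpow_of_nonpos (by positivity) hs (by linarith)
    _ = 2 ^ b * t ^ (-b) := by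
        rw [Real.div_rpow ht.le zero_le_two, Real.rpow_neg zero_le_two, div_inv_eq_mul, mul_comm]
    _ ≤ 2 * t ^ (-b) := by
        refine mul_le_mul_of_nonneg_right ?_ (by positivity)
        calc (2 : ℝ) ^ b ≤ 2 ^ (1 : ℝ) := Real.rpow_le_rpow_of_exponent_le one_le_two hb
          _ = 2 := Real.rpow_one 2

lemma mul_rpow_le_betaMajorant {a t s : ℝ} (ha0 : 0 ≤ a) (ha : a < 1) (hs : s ∈ Ioo 0 t) :
    s ^ (-a) * (t - s) ^ (-(1 / 2) : ℝ) ≤ betaMajorant a t s := by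
  have hs0 := hs.1
  have hts : 0 < t - s := sub_pos.2 hs.2
  have ht : 0 < t := hs0.trans hs.2
  unfold betaMajorant
  rcases le_total s (t / 2) with h | h
  · have := rpow_neg_le_two_mul (b := 1 / 2) (by norm_num) (by norm_num) ht
      (show t / 2 ≤ t - s by linarith)
    calc s ^ (-a) * (t - s) ^ (-(1 / 2) : ℝ) ≤ s ^ (-a) * (2 * t ^ (-(1 / 2) : ℝ)) :=
          mul_le_mul_of_nonneg_left this (by positivity)
      _ = 2 * t ^ (-(1 / 2) : ℝ) * s ^ (-a) := by ring
      _ ≤ _ := le_add_of_nonneg_right (by positivity)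
  · have := rpow_neg_le_two_mul ha0 ha.le ht h
    calc s ^ (-a) * (t - s) ^ (-(1 / 2) : ℝ) ≤ 2 * t ^ (-a) * (t - s) ^ (-(1 / 2) : ℝ) :=
          mul_le_mul_of_nonneg_right this (by positivity)
      _ ≤ _ := le_add_of_nonneg_left (by positivity)

lemma intervalIntegrable_betaMajorant {a : ℝ} (ha : a < 1) (t : ℝ) :
    IntervalIntegrable (betaMajorant a t) volume 0 t :=
  ((intervalIntegrable_rpow_neg ha t).const_mul _).add
    ((intervalIntegrable_sub_rpow t).const_mul _)

lemma integral_betaMajorant {a t : ℝ} (ha : a < 1) (ht : 0 < t) :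
    ∫ s in 0..t, betaMajorant a t s = (2 / (1 - a) + 4) * t ^ (1 / 2 - a) := by
  unfold betaMajorant
  rw [intervalIntegral.integral_add ((intervalIntegrable_rpow_neg ha t).const_mul _)
    ((intervalIntegrable_sub_rpow t).const_mul _), intervalIntegral.integral_const_mul,
    intervalIntegral.integral_const_mul, integral_rpow_neg ha t, integral_sub_rpow t]
  have h1 : t ^ (1 / 2 - a) = t ^ (-(1 / 2) : ℝ) * t ^ (1 - a) := by
    rw [← Real.rpow_add ht]; congr 1; ring
  have h2 : t ^ (1 / 2 - a) = t ^ (-a) * t ^ (1 / 2 : ℝ) := by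
    rw [← Real.rpow_add ht]; congr 1; ring
  rw [add_mul]
  nth_rewrite 1 [h1]
  rw [h2]
  ring

/-! #### Bounds and regularity -/

lemma continuousOn_duhamel_integrand (hF : IsSource T a M F) {t : ℝ} (ht : t ∈ Ioc 0 T)
    (x : Euc d) :
    ContinuousOn (fun s => heat (t - s) (F s) x) (Ioo 0 t) := by
  have hsub : Ioo 0 t ⊆ Ioc 0 T := fun s hs => ⟨hs.1, (hs.2.trans_le ht.2).le⟩
  exact continuousOn_heat (c := fun s => M * s ^ (-a)) (hF.cont.mono (prod_mono_left hsub))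
    (continuousOn_mul_rpow_neg continuousOn_id (fun s hs => hs.1) M a)
    (fun s hs => hF.bound s (hsub hs)) (by fun_prop) (by fun_prop)

lemma continuousOn_pd_duhamel_integrand (hF : IsSource T a M F) {t : ℝ} (ht : t ∈ Ioc 0 T)
    (x : Euc d) (i : Fin d) :
    ContinuousOn (fun s => pd i (heat (t - s) (F s)) x) (Ioo 0 t) := by
  have hsub : Ioo 0 t ⊆ Ioc 0 T := fun s hs => ⟨hs.1, (hs.2.trans_le ht.2).le⟩
  exact continuousOn_pd_heat (c := fun s => M * s ^ (-a)) (hF.cont.mono (prod_mono_left hsub))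
    (continuousOn_mul_rpow_neg continuousOn_id (fun s hs => hs.1) M a)
    (fun s hs => hF.bound s (hsub hs)) (by fun_prop) (fun s hs => sub_pos.2 hs.2) (by fun_prop) i

lemma norm_pd_duhamel_integrand_le (hF : IsSource T a M F) (ha0 : 0 ≤ a) (ha : a < 1) (hM : 0 ≤ M)
    {t s : ℝ} (ht : t ∈ Ioc 0 T) (hs : s ∈ Ioo 0 t) (x : Euc d) (i : Fin d) :
    ‖pd i (heat (t - s) (F s)) x‖ ≤ heatConst d * M * betaMajorant a t s := by
  have hsT : s ∈ Ioc 0 T := ⟨hs.1, (hs.2.trans_le ht.2).le⟩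
  refine (norm_pd_heat_le (hF.continuous hsT) (hF.bound s hsT) (sub_pos.2 hs.2) i x).trans ?_
  calc heatConst d * (M * s ^ (-a)) * (t - s) ^ (-(1 / 2) : ℝ)
      = heatConst d * M * (s ^ (-a) * (t - s) ^ (-(1 / 2) : ℝ)) := by ring
    _ ≤ _ := mul_le_mul_of_nonneg_left (mul_rpow_le_betaMajorant ha0 ha hs)
        (mul_nonneg heatConst_nonneg hM)

lemma intervalIntegrable_duhamel (hF : IsSource T a M F) (ha : a < 1) {t : ℝ} (ht : t ∈ Ioc 0 T)
    (x : Euc d) : IntervalIntegrable (fun s => heat (t - s) (F s) x) volume 0 t := by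
  rw [intervalIntegrable_iff]
  refine Integrable.mono'
    (intervalIntegrable_iff.1 ((intervalIntegrable_rpow_neg ha t).const_mul M))
    (aestronglyMeasurable_uIoc ht.1 (continuousOn_duhamel_integrand hF ht x))
    (ae_uIoc_of_Ioo ht.1 fun s hs => ?_)
  exact norm_heat_le (hF.bound s ⟨hs.1, (hs.2.trans_le ht.2).le⟩) _ _

lemma norm_duhamel_le (hF : IsSource T a M F) (ha : a < 1) {t : ℝ} (ht : t ∈ Ioc 0 T)
    (x : Euc d) : ‖duhamel F t x‖ ≤ M * (t ^ (1 - a) / (1 - a)) := by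
  rw [duhamel, ← integral_rpow_neg ha t, ← intervalIntegral.integral_const_mul]
  refine intervalIntegral.norm_integral_le_of_norm_le ht.1.le ?_
    ((intervalIntegrable_rpow_neg ha t).const_mul M)
  refine Eventually.of_forall fun s hs => ?_
  exact norm_heat_le (hF.bound s ⟨hs.1, hs.2.trans ht.2⟩) _ _

lemma hasFDerivAt_duhamel (hF : IsSource T a M F) (ha0 : 0 ≤ a) (ha : a < 1) (hM : 0 ≤ M) {t : ℝ}
    (ht : t ∈ Ioc 0 T) (x : Euc d) :
    HasFDerivAt (duhamel F t) (∑ i, (EuclideanSpace.proj i : Euc d →L[ℝ] ℝ).smulRight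
      (∫ s in 0..t, pd i (heat (t - s) (F s)) x)) x := by
  have hint : ∀ i, IntervalIntegrable (fun s => pd i (heat (t - s) (F s)) x) volume 0 t := by
    intro i
    rw [intervalIntegrable_iff]
    exact Integrable.mono' (intervalIntegrable_iff.1
        ((intervalIntegrable_betaMajorant ha t).const_mul (heatConst d * M)))
      (aestronglyMeasurable_uIoc ht.1 (continuousOn_pd_duhamel_integrand hF ht x i))
      (ae_uIoc_of_Ioo ht.1 fun s hs => norm_pd_duhamel_integrand_le hF ha0 ha hM ht hs x i)
  have hfd : ∀ y, ContinuousOn (fun s => fderiv ℝ (heat (t - s) (F s)) y) (Ioo 0 t) := fun y => by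
    simp only [fderiv_eq_sum_pd]
    refine continuousOn_finsetSum _ fun i _ => ?_
    exact (ContinuousLinearMap.smulRightL ℝ (Euc d) V
      (EuclideanSpace.proj i : Euc d →L[ℝ] ℝ)).continuous.comp_continuousOn
        (continuousOn_pd_duhamel_integrand hF ht y i)
  have hbound : ∀ s ∈ Ioo 0 t, ∀ y, ‖fderiv ℝ (heat (t - s) (F s)) y‖ ≤
      ∑ i : Fin d, ‖(EuclideanSpace.proj i : Euc d →L[ℝ] ℝ)‖ *
        (heatConst d * M * betaMajorant a t s) := by
    intro s hs y
    rw [fderiv_eq_sum_pd]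
    refine norm_sum_le_of_le _ fun i _ => ?_
    rw [ContinuousLinearMap.norm_smulRight_apply]
    exact mul_le_mul_of_nonneg_left (norm_pd_duhamel_integrand_le hF ha0 ha hM ht hs y i)
      (norm_nonneg _)
  have key := intervalIntegral.hasFDerivAt_integral_of_dominated_of_fderiv_le (𝕜 := ℝ)
    (F := fun (y : Euc d) s => heat (t - s) (F s) y)
    (F' := fun (y : Euc d) s => fderiv ℝ (heat (t - s) (F s)) y) (a := 0) (b := t)
    (bound := fun s => ∑ i : Fin d, ‖(EuclideanSpace.proj i : Euc d →L[ℝ] ℝ)‖ *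
      (heatConst d * M * betaMajorant a t s))
    (x₀ := x) (Metric.ball_mem_nhds x one_pos)
    (Eventually.of_forall fun y => aestronglyMeasurable_uIoc ht.1
      (continuousOn_duhamel_integrand hF ht y))
    (intervalIntegrable_duhamel hF ha ht x) (aestronglyMeasurable_uIoc ht.1 (hfd x))
    ((ae_restrict_iff' measurableSet_uIoc).1
      (ae_uIoc_of_Ioo ht.1 fun s hs y _ => hbound s hs y))
    (by
      have := IntervalIntegrable.sum (μ := volume) (a := 0) (b := t) (Finset.univ : Finset (Fin d))
        (f := fun i s => ‖(EuclideanSpace.proj i : Euc d →L[ℝ] ℝ)‖ *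
          (heatConst d * M * betaMajorant a t s))
        fun i _ => ((intervalIntegrable_betaMajorant ha t).const_mul _).const_mul _
      simpa [Finset.sum_fn] using this)
    ((ae_restrict_iff' measurableSet_uIoc).1 (ae_uIoc_of_Ioo ht.1 fun s hs y _ =>
      ((differentiable_heat (hF.continuous ⟨hs.1, (hs.2.trans_le ht.2).le⟩)
        (hF.bound s ⟨hs.1, (hs.2.trans_le ht.2).le⟩) (sub_pos.2 hs.2)) y).hasFDerivAt))
  refine key.congr_fderiv ?_
  simp only [fderiv_eq_sum_pd]
  rw [intervalIntegral.integral_finsetSum]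
  · refine Finset.sum_congr rfl fun i _ => ?_
    exact (ContinuousLinearMap.smulRightL ℝ (Euc d) V
      (EuclideanSpace.proj i : Euc d →L[ℝ] ℝ)).intervalIntegral_comp_comm (hint i)
  · intro i _
    exact (intervalIntegrable_iff_integrableOn_Ioc_of_le ht.1.le).2
      ((ContinuousLinearMap.smulRightL ℝ (Euc d) V
        (EuclideanSpace.proj i : Euc d →L[ℝ] ℝ)).integrable_comp (hint i).1)

lemma pd_duhamel (hF : IsSource T a M F) (ha0 : 0 ≤ a) (ha : a < 1) (hM : 0 ≤ M) {t : ℝ}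
    (ht : t ∈ Ioc 0 T) (i : Fin d) (x : Euc d) :
    pd i (duhamel F t) x = ∫ s in 0..t, pd i (heat (t - s) (F s)) x := by
  rw [(hasFDerivAt_duhamel hF ha0 ha hM ht x).pd_eq]
  simp

lemma norm_pd_duhamel_le (hF : IsSource T a M F) (ha0 : 0 ≤ a) (ha : a < 1) (hM : 0 ≤ M) {t : ℝ}
    (ht : t ∈ Ioc 0 T) (i : Fin d) (x : Euc d) :
    ‖pd i (duhamel F t) x‖ ≤ heatConst d * M * ((2 / (1 - a) + 4) * t ^ (1 / 2 - a)) := by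
  rw [pd_duhamel hF ha0 ha hM ht, ← integral_betaMajorant ha ht.1,
    ← intervalIntegral.integral_const_mul]
  refine intervalIntegral.norm_integral_le_of_norm_le ht.1.le ?_
    ((intervalIntegrable_betaMajorant ha t).const_mul _)
  refine (ae_restrict_iff' measurableSet_Ioc).1 ?_
  rw [← uIoc_of_le ht.1.le]
  exact ae_uIoc_of_Ioo ht.1 fun s hs => norm_pd_duhamel_integrand_le hF ha0 ha hM ht hs x i

lemma duhamel_eq_smul_integral (F : ℝ → Euc d → V) (t : ℝ) (x : Euc d) :
    duhamel F t x = t • ∫ σ in (0 : ℝ)..1, heat (t * (1 - σ)) (F (t * σ)) x := by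
  have := intervalIntegral.smul_integral_comp_mul_left (a := 0) (b := 1)
    (fun s => heat (t - s) (F s) x) t
  rw [mul_zero, mul_one] at this
  rw [duhamel, ← this]
  simp only [mul_sub, mul_one]

lemma continuousOn_duhamel (hF : IsSource T a M F) (ha0 : 0 ≤ a) (ha : a < 1) (hM : 0 ≤ M) :
    ContinuousOn (fun p : ℝ × Euc d => duhamel F p.1 p.2) (Ioc 0 T ×ˢ univ) := by
  simp only [duhamel_eq_smul_integral]
  refine continuousOn_fst.smul ?_
  rintro ⟨t₀, x₀⟩ ⟨ht₀, -⟩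
  have hlow : ∀ᶠ p : ℝ × Euc d in 𝓝[Ioc 0 T ×ˢ univ] (t₀, x₀), t₀ / 2 < p.1 :=
    mem_nhdsWithin_of_mem_nhds (continuous_fst.continuousAt.eventually
      (lt_mem_nhds (show t₀ / 2 < t₀ from half_lt_self ht₀.1)))
  have hmem : ∀ p ∈ Ioc 0 T ×ˢ (univ : Set (Euc d)), ∀ σ ∈ Ioo (0 : ℝ) 1, p.1 * σ ∈ Ioc 0 T :=
    fun p hp σ hσ => ⟨mul_pos hp.1.1 hσ.1,
      (mul_le_of_le_one_right hp.1.1.le hσ.2.le).trans hp.1.2⟩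
  refine intervalIntegral.continuousWithinAt_of_dominated_interval
    (bound := fun σ => M * (t₀ / 2) ^ (-a) * σ ^ (-a)) ?_ ?_
    ((intervalIntegrable_rpow_neg ha 1).const_mul _) ?_
  · filter_upwards [self_mem_nhdsWithin] with p hp
    refine aestronglyMeasurable_uIoc one_pos ?_
    refine continuousOn_heat (c := fun σ => M * (p.1 * σ) ^ (-a)) ?_
      (continuousOn_mul_rpow_neg (by fun_prop) (fun σ hσ => (hmem p hp σ hσ).1) M a)
      (fun σ hσ => hF.bound _ (hmem p hp σ hσ)) (by fun_prop) (by fun_prop)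
    exact hF.cont.comp (f := fun q : ℝ × Euc d => (p.1 * q.1, q.2)) (by fun_prop)
      fun q hq => ⟨hmem p hp q.1 hq.1, mem_univ _⟩
  · filter_upwards [self_mem_nhdsWithin, hlow] with p hp hp2
    refine (ae_restrict_iff' measurableSet_uIoc).1 (ae_uIoc_of_Ioo one_pos fun σ hσ => ?_)
    refine (norm_heat_le (hF.bound _ (hmem p hp σ hσ)) _ _).trans ?_
    rw [mul_assoc, Real.mul_rpow hp.1.1.le hσ.1.le]
    refine mul_le_mul_of_nonneg_left (mul_le_mul_of_nonneg_right ?_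
      (Real.rpow_nonneg hσ.1.le _)) hM
    exact Real.rpow_le_rpow_of_nonpos (half_pos ht₀.1) hp2.le (by linarith)
  · refine (ae_restrict_iff' measurableSet_uIoc).1 (ae_uIoc_of_Ioo one_pos fun σ hσ => ?_)
    have : ContinuousOn (fun p : ℝ × Euc d => heat (p.1 * (1 - σ)) (F (p.1 * σ)) p.2)
        (Ioc 0 T ×ˢ univ) := by
      refine continuousOn_heat (c := fun p => M * (p.1 * σ) ^ (-a)) ?_
        (continuousOn_mul_rpow_neg (by fun_prop) (fun p hp => (hmem p hp σ hσ).1) M a)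
        (fun p hp => hF.bound _ (hmem p hp σ hσ)) (by fun_prop) (by fun_prop)
      exact hF.cont.comp (f := fun q : (ℝ × Euc d) × Euc d => (q.1.1 * σ, q.2)) (by fun_prop)
        fun q hq => ⟨hmem q.1 hq.1 σ hσ, mem_univ _⟩
    exact this (t₀, x₀) ⟨ht₀, mem_univ _⟩

lemma pd_duhamel_eq_smul_integral (hF : IsSource T a M F) (ha0 : 0 ≤ a) (ha : a < 1) (hM : 0 ≤ M)
    {t : ℝ} (ht : t ∈ Ioc 0 T) (i : Fin d) (x : Euc d) :
    pd i (duhamel F t) x = t • ∫ σ in (0 : ℝ)..1, pd i (heat (t * (1 - σ)) (F (t * σ))) x := by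
  have := intervalIntegral.smul_integral_comp_mul_left (a := 0) (b := 1)
    (fun s => pd i (heat (t - s) (F s)) x) t
  rw [mul_zero, mul_one] at this
  rw [pd_duhamel hF ha0 ha hM ht, ← this]
  simp only [mul_sub, mul_one]

lemma continuousOn_pd_duhamel (hF : IsSource T a M F) (ha0 : 0 ≤ a) (ha : a < 1) (hM : 0 ≤ M)
    (i : Fin d) :
    ContinuousOn (fun p : ℝ × Euc d => pd i (duhamel F p.1) p.2) (Ioc 0 T ×ˢ univ) := by
  suffices h : ContinuousOn (fun p : ℝ × Euc d => p.1 • ∫ σ in (0 : ℝ)..1,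
      pd i (heat (p.1 * (1 - σ)) (F (p.1 * σ))) p.2) (Ioc 0 T ×ˢ univ) from
    h.congr fun p hp => pd_duhamel_eq_smul_integral hF ha0 ha hM hp.1 i p.2
  refine continuousOn_fst.smul ?_
  rintro ⟨t₀, x₀⟩ ⟨ht₀, -⟩
  have hlow : ∀ᶠ p : ℝ × Euc d in 𝓝[Ioc 0 T ×ˢ univ] (t₀, x₀), t₀ / 2 < p.1 :=
    mem_nhdsWithin_of_mem_nhds (continuous_fst.continuousAt.eventually
      (lt_mem_nhds (show t₀ / 2 < t₀ from half_lt_self ht₀.1)))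
  have hmem : ∀ p ∈ Ioc 0 T ×ˢ (univ : Set (Euc d)), ∀ σ ∈ Ioo (0 : ℝ) 1, p.1 * σ ∈ Ioc 0 T :=
    fun p hp σ hσ => ⟨mul_pos hp.1.1 hσ.1,
      (mul_le_of_le_one_right hp.1.1.le hσ.2.le).trans hp.1.2⟩
  refine intervalIntegral.continuousWithinAt_of_dominated_interval
    (bound := fun σ => heatConst d * M * (t₀ / 2) ^ (-a) * (t₀ / 2) ^ (-(1 / 2) : ℝ) *
      betaMajorant a 1 σ) ?_ ?_
    ((intervalIntegrable_betaMajorant ha 1).const_mul _) ?_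
  · filter_upwards [self_mem_nhdsWithin] with p hp
    refine aestronglyMeasurable_uIoc one_pos ?_
    refine continuousOn_pd_heat (c := fun σ => M * (p.1 * σ) ^ (-a)) ?_
      (continuousOn_mul_rpow_neg (by fun_prop) (fun σ hσ => (hmem p hp σ hσ).1) M a)
      (fun σ hσ => hF.bound _ (hmem p hp σ hσ)) (by fun_prop)
      (fun σ hσ => mul_pos hp.1.1 (sub_pos.2 hσ.2)) (by fun_prop) i
    exact hF.cont.comp (f := fun q : ℝ × Euc d => (p.1 * q.1, q.2)) (by fun_prop)
      fun q hq => ⟨hmem p hp q.1 hq.1, mem_univ _⟩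
  · filter_upwards [self_mem_nhdsWithin, hlow] with p hp hp2
    refine (ae_restrict_iff' measurableSet_uIoc).1 (ae_uIoc_of_Ioo one_pos fun σ hσ => ?_)
    have hσ1 : 0 < 1 - σ := sub_pos.2 hσ.2
    refine (norm_pd_heat_le (hF.continuous (hmem p hp σ hσ)) (hF.bound _ (hmem p hp σ hσ))
      (mul_pos hp.1.1 hσ1) i _).trans ?_
    rw [Real.mul_rpow hp.1.1.le hσ.1.le, Real.mul_rpow hp.1.1.le hσ1.le]
    have e1 : p.1 ^ (-a) ≤ (t₀ / 2) ^ (-a) :=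
      Real.rpow_le_rpow_of_nonpos (half_pos ht₀.1) hp2.le (by linarith)
    have e2 : p.1 ^ (-(1 / 2) : ℝ) ≤ (t₀ / 2) ^ (-(1 / 2) : ℝ) :=
      Real.rpow_le_rpow_of_nonpos (half_pos ht₀.1) hp2.le (by norm_num)
    have e3 := mul_rpow_le_betaMajorant ha0 ha hσ
    have hp0 := hp.1.1
    have hσ0 := hσ.1
    have hc := heatConst_nonneg (d := d)
    have ht2 := half_pos ht₀.1
    calc heatConst d * (M * (p.1 ^ (-a) * σ ^ (-a))) *
          (p.1 ^ (-(1 / 2) : ℝ) * (1 - σ) ^ (-(1 / 2) : ℝ))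
        = heatConst d * M * p.1 ^ (-a) * p.1 ^ (-(1 / 2) : ℝ) *
          (σ ^ (-a) * (1 - σ) ^ (-(1 / 2) : ℝ)) := by ring
      _ ≤ heatConst d * M * (t₀ / 2) ^ (-a) * (t₀ / 2) ^ (-(1 / 2) : ℝ) * betaMajorant a 1 σ := by
          gcongr
  · refine (ae_restrict_iff' measurableSet_uIoc).1 (ae_uIoc_of_Ioo one_pos fun σ hσ => ?_)
    have : ContinuousOn (fun p : ℝ × Euc d => pd i (heat (p.1 * (1 - σ)) (F (p.1 * σ))) p.2)
        (Ioc 0 T ×ˢ univ) := by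
      refine continuousOn_pd_heat (c := fun p => M * (p.1 * σ) ^ (-a)) (x := fun p => p.2) ?_
        (continuousOn_mul_rpow_neg (by fun_prop) (fun p hp => (hmem p hp σ hσ).1) M a)
        (fun p hp => hF.bound _ (hmem p hp σ hσ)) (by fun_prop)
        (fun p hp => mul_pos hp.1.1 (sub_pos.2 hσ.2)) (by fun_prop) i
      exact hF.cont.comp (f := fun q : (ℝ × Euc d) × Euc d => (q.1.1 * σ, q.2)) (by fun_prop)
        fun q hq => ⟨hmem q.1 hq.1 σ hσ, mem_univ _⟩
    exact this (t₀, x₀) ⟨ht₀, mem_univ _⟩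

lemma differentiable_duhamel (hF : IsSource T a M F) (ha0 : 0 ≤ a) (ha : a < 1) (hM : 0 ≤ M) {t : ℝ}
    (ht : t ∈ Ioc 0 T) : Differentiable ℝ (duhamel F t) :=
  fun x => (hasFDerivAt_duhamel hF ha0 ha hM ht x).differentiableAt

lemma isTorusFun_duhamel {t : ℝ} (ht : 0 < t) (hper : ∀ s ∈ Ioc 0 t, IsTorusFun (F s)) :
    IsTorusFun (duhamel F t) := fun i x => by
  refine intervalIntegral.integral_congr_ae (Eventually.of_forall fun s hs => ?_)
  rw [uIoc_of_le ht.le] at hs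
  exact (hper s hs).heat _ i x

lemma jetCont_duhamel (hF : IsSource T a M F) (ha0 : 0 ≤ a) (ha : a < 1) (hM : 0 ≤ M)
    (hper : ∀ s ∈ Ioc 0 T, IsTorusFun (F s)) : JetCont (Ioc 0 T) (duhamel F) := by
  refine ⟨fun t ht => ⟨isTorusFun_duhamel ht.1 fun s hs => hper s ⟨hs.1, hs.2.trans ht.2⟩,
    contDiff_one_of_pd (differentiable_duhamel hF ha0 ha hM ht) fun i => ?_⟩,
    continuousOn_duhamel hF ha0 ha hM, continuousOn_pd_duhamel hF ha0 ha hM⟩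
  rw [← continuousOn_univ]
  exact (continuousOn_pd_duhamel hF ha0 ha hM i).comp (f := fun y : Euc d => (t, y))
    (by fun_prop) fun y _ => ⟨ht, mem_univ _⟩

lemma duhamel_congr {F G : ℝ → Euc d → V} {t : ℝ} (ht : 0 < t) (h : ∀ s ∈ Ioc 0 t, F s = G s) :
    duhamel F t = duhamel G t := by
  ext x
  refine intervalIntegral.integral_congr_ae (Eventually.of_forall fun s hs => ?_)
  rw [uIoc_of_le ht.le] at hs
  simp only [h s hs]

lemma duhamel_add {G : ℝ → Euc d → V} {a' M' : ℝ} (hF : IsSource T a M F)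
    (hG : IsSource T a' M' G) (ha : a < 1) (ha' : a' < 1) {t : ℝ} (ht : t ∈ Ioc 0 T) :
    duhamel (F + G) t = duhamel F t + duhamel G t := by
  ext x
  simp only [duhamel, Pi.add_apply]
  rw [← intervalIntegral.integral_add (intervalIntegrable_duhamel hF ha ht x)
    (intervalIntegrable_duhamel hG ha' ht x)]
  refine intervalIntegral.integral_congr_ae (Eventually.of_forall fun s hs => ?_)
  rw [uIoc_of_le ht.1.le] at hs
  have hs' : s ∈ Ioc 0 T := ⟨hs.1, hs.2.trans ht.2⟩
  rw [heat_add_fun (hF.continuous hs') (hF.bound s hs') (hG.continuous hs') (hG.bound s hs')]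
  rfl

lemma duhamel_smul (c : ℝ) (F : ℝ → Euc d → V) (t : ℝ) : duhamel (c • F) t = c • duhamel F t := by
  ext x
  simp only [duhamel, Pi.smul_apply, heat_smul_fun, intervalIntegral.integral_smul]

lemma duhamel_sub {G : ℝ → Euc d → V} {M' : ℝ} (hF : IsSource T a M F) (hG : IsSource T a M' G)
    (ha : a < 1) {t : ℝ} (ht : t ∈ Ioc 0 T) : duhamel (F - G) t = duhamel F t - duhamel G t := by
  have hG' : IsSource T a M' ((-1 : ℝ) • G) :=
    ⟨hG.cont.const_smul _, fun s hs x => by simpa using hG.bound s hs x⟩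
  have := duhamel_add hF hG' ha ha ht
  rw [duhamel_smul] at this
  simpa [sub_eq_add_neg] using this

lemma duhamelConverges (hF : IsSource T a M F) (ha0 : 0 ≤ a) (ha : a < 1) (hM : 0 ≤ M)
    (hper : ∀ s ∈ Ioc 0 T, IsTorusFun (F s)) : DuhamelConverges T F := by
  intro t ht
  have hsub : ∀ s ∈ Ioo 0 t, s ∈ Ioc 0 T := fun s hs => ⟨hs.1, (hs.2.trans_le ht.2).le⟩
  refine ⟨fun s hs => isC1_heat (hF.continuous (hsub s hs)) (hper s (hsub s hs))
    (sub_pos.2 hs.2), ?_⟩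
  have hint : IntegrableOn (fun s => M * s ^ (-a) + heatConst d * M * betaMajorant a t s)
      (Ioo 0 t) := by
    have := ((intervalIntegrable_rpow_neg ha t).const_mul M).add
      ((intervalIntegrable_betaMajorant ha t).const_mul (heatConst d * M))
    rw [intervalIntegrable_iff_integrableOn_Ioo_of_le ht.1.le] at this
    exact this
  refine lt_of_le_of_lt (setLIntegral_mono' measurableSet_Ioo fun s hs => ?_)
    hint.lintegral_lt_top
  have hs0 := hs.1
  have h1 : 0 ≤ M * s ^ (-a) := by positivity
  have h2 : 0 ≤ heatConst d * M * betaMajorant a t s := by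
    have := heatConst_nonneg (d := d)
    have h3 : 0 < t - s := sub_pos.2 hs.2
    have h4 := ht.1
    unfold betaMajorant
    positivity
  rw [c1Norm_le_iff (by positivity)]
  refine ⟨fun x => (norm_heat_le (hF.bound s (hsub s hs)) _ _).trans (by linarith), fun i x =>
    (norm_pd_duhamel_integrand_le hF ha0 ha hM ht hs x i).trans (by linarith)⟩

/-- The part of a Duhamel integral up to an intermediate time is propagated by the heat
semigroup. -/
lemma heat_duhamel (hF : IsSource T a M F) (ha : a < 1) {t₀ t : ℝ} (ht₀ : 0 < t₀) (ht : t₀ ≤ t)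
    (htT : t ≤ T) (x : Euc d) :
    heat (t - t₀) (duhamel F t₀) x = ∫ s in 0..t₀, heat (t - s) (F s) x := by
  have ht₀T : t₀ ∈ Ioc 0 T := ⟨ht₀, ht.trans htT⟩
  have hsub : ∀ s ∈ Ioo 0 t₀, s ∈ Ioc 0 T := fun s hs => ⟨hs.1, (hs.2.trans_le ht₀T.2).le⟩
  rw [heat_eq]
  simp only [duhamel, intervalIntegral.integral_of_le ht₀.le, integral_Ioc_eq_integral_Ioo]
  rw [integral_integral_swap]
  · refine setIntegral_congr_fun measurableSet_Ioo fun s hs => ?_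
    rw [← heat_eq (t - t₀) (heat (t₀ - s) (F s)) x,
      heat_heat (hF.continuous (hsub s hs)) (hF.bound s (hsub s hs))
        (sub_nonneg.2 hs.2.le) (sub_nonneg.2 ht)]
    congr 1
    ring
  · have hi : Integrable (fun s : ℝ => M * s ^ (-a)) (volume.restrict (Ioo 0 t₀)) :=
      (intervalIntegrable_iff_integrableOn_Ioo_of_le ht₀.le).1
        ((intervalIntegrable_rpow_neg ha t₀).const_mul M)
    have hprod : (heatMeasure d).prod (volume.restrict (Ioo 0 t₀)) =
        ((heatMeasure d).prod volume).restrict (univ ×ˢ Ioo 0 t₀) := by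
      rw [← Measure.prod_restrict, Measure.restrict_univ]
    refine Integrable.mono' (hi.comp_snd (heatMeasure d)) ?_ ?_
    · rw [hprod]
      refine ContinuousOn.aestronglyMeasurable ?_ (MeasurableSet.univ.prod measurableSet_Ioo)
      refine continuousOn_heat (P := Euc d × ℝ) (f := fun p => F p.2) (r := fun p => t₀ - p.2)
        (x := fun p => x + √(t - t₀) • p.1) (c := fun p => M * p.2 ^ (-a)) ?_
        (continuousOn_mul_rpow_neg (by fun_prop) (fun p hp => hp.2.1) M a)
        (fun p hp => hF.bound _ (hsub _ hp.2)) (by fun_prop) (by fun_prop)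
      exact hF.cont.comp (f := fun q : (Euc d × ℝ) × Euc d => (q.1.2, q.2)) (by fun_prop)
        fun q hq => ⟨hsub _ hq.1.2, mem_univ _⟩
    · rw [hprod]
      refine (ae_restrict_iff' (MeasurableSet.univ.prod measurableSet_Ioo)).2
        (Eventually.of_forall fun p hp => ?_)
      exact norm_heat_le (hF.bound _ (hsub _ hp.2)) _ _

end Duhamel

/-! ### Spaces of weighted jets -/

section JetSpace

variable {d : ℕ} {V : Type*} [NormedAddCommGroup V] [NormedSpace ℝ V] [CompleteSpace V]

open BoundedContinuousFunction

/-- Bounded continuous functions on `(0, T] × ℝ ^ d`. -/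
abbrev PathSpace (T : ℝ) (d : ℕ) (E : Type*) [NormedAddCommGroup E] : Type _ :=
  (Ioc (0 : ℝ) T × Euc d) →ᵇ E

/-- Values and first partial derivatives of a function at a point. For an element of
`PathSpace T d (Jet d V)`, the derivative components need not be the derivatives of the values. -/
abbrev Jet (d : ℕ) (V : Type*) : Type _ := V × (Fin d → V)

lemma ContinuousOn.comp_subtype {E : Type*} [TopologicalSpace E] {S : Set ℝ} {G : ℝ → Euc d → E}
    (h : ContinuousOn (fun p : ℝ × Euc d => G p.1 p.2) (S ×ˢ univ)) :
    Continuous fun p : S × Euc d => G p.1 p.2 := by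
  rw [← continuousOn_univ]
  exact h.comp (f := fun p : S × Euc d => ((p.1 : ℝ), p.2)) (by fun_prop)
    fun p _ => ⟨p.1.2, mem_univ _⟩

lemma continuousOn_of_comp_subtype {E : Type*} [TopologicalSpace E] {S : Set ℝ} {G : ℝ → Euc d → E}
    (h : Continuous fun p : S × Euc d => G p.1 p.2) :
    ContinuousOn (fun p : ℝ × Euc d => G p.1 p.2) (S ×ˢ univ) := by
  rw [continuousOn_iff_continuous_domRestrict]
  exact h.comp (f := fun p : (S ×ˢ (univ : Set (Euc d)) : Set (ℝ × Euc d)) =>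
    ((⟨p.1.1, p.2.1⟩ : S), p.1.2)) (by fun_prop)

/-- The source `s ^ {-a} F (s, x)` on `(0, T]`, extended by zero to other times. -/
noncomputable def pathSource (T a : ℝ) (F : PathSpace T d V) (s : ℝ) (x : Euc d) : V :=
  if h : s ∈ Ioc 0 T then s ^ (-a) • F (⟨s, h⟩, x) else 0

lemma pathSource_apply {T a : ℝ} (F : PathSpace T d V) (s : Ioc 0 T) (x : Euc d) :
    pathSource T a F s x = (s : ℝ) ^ (-a) • F (s, x) := by
  simp [pathSource]

lemma continuous_subtype_rpow (T c : ℝ) :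
    Continuous fun p : Ioc (0 : ℝ) T × Euc d => (p.1 : ℝ) ^ c :=
  Continuous.rpow_const (by fun_prop) fun p => Or.inl p.1.2.1.ne'

lemma isSource_pathSource {T a : ℝ} (F : PathSpace T d V) :
    IsSource T a ‖F‖ (pathSource T a F) := by
  refine ⟨continuousOn_of_comp_subtype ?_, fun s hs x => ?_⟩
  · simp only [pathSource_apply]
    exact (continuous_subtype_rpow T (-a)).smul F.continuous
  · rw [pathSource_apply F ⟨s, hs⟩, norm_smul, Real.norm_of_nonneg (Real.rpow_nonneg hs.1.le _),
      mul_comm]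
    exact mul_le_mul_of_nonneg_right (F.norm_coe_le_norm _) (Real.rpow_nonneg hs.1.le _)

/-- The weighted jet `(t ^ b B, t ^ {1/2 + b} ∂ᵢ B)` of a path `B`. -/
noncomputable def weightedJet (T b : ℝ) (B : ℝ → Euc d → V) (p : Ioc (0 : ℝ) T × Euc d) : Jet d V :=
  ((p.1 : ℝ) ^ b • B p.1 p.2, fun i => (p.1 : ℝ) ^ (1 / 2 + b) • pd i (B p.1) p.2)

lemma continuous_weightedJet {T b : ℝ} {B : ℝ → Euc d → V}
    (hc : ContinuousOn (fun p : ℝ × Euc d => B p.1 p.2) (Ioc 0 T ×ˢ univ))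
    (hp : ∀ i, ContinuousOn (fun p : ℝ × Euc d => pd i (B p.1) p.2) (Ioc 0 T ×ˢ univ)) :
    Continuous (weightedJet T b B) :=
  ((continuous_subtype_rpow T b).smul hc.comp_subtype).prodMk
    (continuous_pi fun i => (continuous_subtype_rpow T _).smul
      (ContinuousOn.comp_subtype (G := fun t x => pd i (B t) x) (hp i)))

lemma rpow_smul_norm_le {t c M : ℝ} (ht : 0 < t) {v : V} (h : ‖v‖ ≤ M * t ^ (-c)) :
    ‖t ^ c • v‖ ≤ M := by
  rw [norm_smul, Real.norm_of_nonneg (Real.rpow_nonneg ht.le _)]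
  calc t ^ c * ‖v‖ ≤ t ^ c * (M * t ^ (-c)) :=
        mul_le_mul_of_nonneg_left h (Real.rpow_nonneg ht.le _)
    _ = M * (t ^ c * t ^ (-c)) := by ring
    _ = M := by rw [← Real.rpow_add ht]; simp

lemma JetBound.norm_weightedJet_le {T b M : ℝ} {B : ℝ → Euc d → V} (hM : 0 ≤ M)
    (h : JetBound T b M B) (p : Ioc (0 : ℝ) T × Euc d) : ‖weightedJet T b B p‖ ≤ M := by
  have hp := h p.1 p.1.2 p.2
  refine max_le (rpow_smul_norm_le p.1.2.1 hp.1) ?_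
  exact (pi_norm_le_iff_of_nonneg hM).2 fun i => rpow_smul_norm_le p.1.2.1 (hp.2 i)

/-- The constant in the bound for the Duhamel integral of a source of size `s ^ {-a}`. -/
noncomputable def duhamelConst (d : ℕ) (a : ℝ) : ℝ :=
  1 / (1 - a) + heatConst d * (2 / (1 - a) + 4)

lemma duhamelConst_nonneg {a : ℝ} (ha : a < 1) : 0 ≤ duhamelConst d a := by
  have := heatConst_nonneg (d := d)
  have : 0 < 1 - a := by linarith
  unfold duhamelConst
  positivity

lemma jetBound_duhamel {T a b M : ℝ} {F : ℝ → Euc d → V} (hF : IsSource T a M F) (ha0 : 0 ≤ a)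
    (ha : a < 1) (hab : a ≤ 1 + b) (hM : 0 ≤ M) :
    JetBound T b (duhamelConst d a * T ^ (1 + b - a) * M) (duhamel F) := by
  intro t ht x
  have ht0 := ht.1
  have h1a : 0 < 1 - a := by linarith
  have hc := heatConst_nonneg (d := d)
  have hK := duhamelConst_nonneg (d := d) ha
  have hT : t ^ (1 + b - a) ≤ T ^ (1 + b - a) :=
    Real.rpow_le_rpow ht0.le ht.2 (by linarith)
  have h1 : 1 / (1 - a) ≤ duhamelConst d a := by
    unfold duhamelConst
    exact le_add_of_nonneg_right (by positivity)
  have h2 : heatConst d * (2 / (1 - a) + 4) ≤ duhamelConst d a := by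
    unfold duhamelConst
    exact le_add_of_nonneg_left (by positivity)
  refine ⟨(norm_duhamel_le hF ha ht x).trans ?_, fun i =>
    (norm_pd_duhamel_le hF ha0 ha hM ht i x).trans ?_⟩
  · have e : t ^ (1 - a) = t ^ (1 + b - a) * t ^ (-b) := by
      rw [← Real.rpow_add ht0]; congr 1; ring
    calc M * (t ^ (1 - a) / (1 - a)) = 1 / (1 - a) * t ^ (1 + b - a) * M * t ^ (-b) := by
          rw [e]; ring
      _ ≤ _ := by gcongr
  · have e : t ^ (1 / 2 - a) = t ^ (1 + b - a) * t ^ (-(1 / 2 + b)) := by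
      rw [← Real.rpow_add ht0]; congr 1; ring
    calc heatConst d * M * ((2 / (1 - a) + 4) * t ^ (1 / 2 - a)) =
          heatConst d * (2 / (1 - a) + 4) * t ^ (1 + b - a) * M * t ^ (-(1 / 2 + b)) := by
          rw [e]; ring
      _ ≤ _ := by gcongr

/-- The Duhamel integral, as an operator from sources to jets. -/
noncomputable def duhamelOp {T a b : ℝ} (d : ℕ) (V : Type*) [NormedAddCommGroup V] [NormedSpace ℝ V]
    [CompleteSpace V] (ha0 : 0 ≤ a) (ha : a < 1) (hab : a ≤ 1 + b) :
    PathSpace T d V →L[ℝ] PathSpace T d (Jet d V) :=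
  LinearMap.mkContinuous
    { toFun := fun F => BoundedContinuousFunction.ofNormedAddCommGroup
        (weightedJet T b (duhamel (pathSource T a F)))
        (continuous_weightedJet
          (continuousOn_duhamel (isSource_pathSource F) ha0 ha (norm_nonneg F))
          (continuousOn_pd_duhamel (isSource_pathSource F) ha0 ha (norm_nonneg F)))
        _ fun p => by
          refine ((jetBound_duhamel (isSource_pathSource F) ha0 ha hab
            (norm_nonneg F)).norm_weightedJet_le ?_ p)
          have := duhamelConst_nonneg (d := d) ha
          have := p.1.2.1.trans_le p.1.2.2
          positivity
      map_add' := fun F G => by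
        ext p : 1
        have hF := isSource_pathSource (T := T) (a := a) F
        have hG := isSource_pathSource (T := T) (a := a) G
        have e1 : pathSource T a (F + G) = pathSource T a F + pathSource T a G := by
          ext s x
          by_cases h : s ∈ Ioc 0 T <;> simp [pathSource, h]
        have e2 := duhamel_add hF hG ha ha p.1.2
        simp only [BoundedContinuousFunction.coe_ofNormedAddCommGroup, weightedJet, e1, e2,
          BoundedContinuousFunction.coe_add, Pi.add_apply, smul_add, Prod.mk_add_mk, Prod.mk.injEq,
          true_and]
        ext i : 1
        rw [pd_add (differentiable_duhamel hF ha0 ha (norm_nonneg F) p.1.2 _)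
          (differentiable_duhamel hG ha0 ha (norm_nonneg G) p.1.2 _), smul_add]
        rfl
      map_smul' := fun c F => by
        ext p : 1
        have e1 : pathSource T a (c • F) = c • pathSource T a F := by
          ext s x
          by_cases h : s ∈ Ioc 0 T <;> simp [pathSource, h, smul_comm c]
        simp only [BoundedContinuousFunction.coe_ofNormedAddCommGroup, weightedJet, e1,
          duhamel_smul, pd_const_smul, BoundedContinuousFunction.coe_smul, Pi.smul_apply,
          RingHom.id_apply, Prod.smul_mk, Prod.mk.injEq, smul_comm c, true_and]
        ext i : 1
        simp [smul_comm c] }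
    (duhamelConst d a * T ^ (1 + b - a)) fun F => by
      by_cases hT : 0 < T
      · have h0 : 0 ≤ duhamelConst d a * T ^ (1 + b - a) * ‖F‖ := by
          have := duhamelConst_nonneg (d := d) ha
          positivity
        exact (BoundedContinuousFunction.norm_le h0).2 fun p =>
          (jetBound_duhamel (isSource_pathSource F) ha0 ha hab
            (norm_nonneg F)).norm_weightedJet_le h0 p
      · have : IsEmpty (Ioc (0 : ℝ) T) := ⟨fun s => hT (s.2.1.trans_le s.2.2)⟩
        have h1 : F = 0 := by ext p; exact this.elim p.1
        rw [h1, norm_zero, mul_zero]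
        refine (BoundedContinuousFunction.norm_le le_rfl).2 fun p => this.elim p.1

variable {T a b : ℝ}

lemma duhamelOp_apply (ha0 : 0 ≤ a) (ha : a < 1) (hab : a ≤ 1 + b) (F : PathSpace T d V)
    (p : Ioc (0 : ℝ) T × Euc d) :
    duhamelOp d V ha0 ha hab F p = weightedJet T b (duhamel (pathSource T a F)) p := rfl

lemma norm_duhamelOp_le (hT : 0 < T) (ha0 : 0 ≤ a) (ha : a < 1) (hab : a ≤ 1 + b) :
    ‖(duhamelOp d V ha0 ha hab : PathSpace T d V →L[ℝ] PathSpace T d (Jet d V))‖ ≤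
      duhamelConst d a * T ^ (1 + b - a) :=
  LinearMap.mkContinuous_norm_le _ (by
    have := duhamelConst_nonneg (d := d) ha
    positivity) _

end JetSpace

/-! ### Quadratic and cubic nonlinearities -/

section Nonlinearity

variable {d : ℕ} {V : Type*} [NormedAddCommGroup V] [NormedSpace ℝ V]

/-- A nonlinearity `P(a, p) + Q(a, R(a, a))` as a function of a value `a` and of first
derivatives `p`, with `P`, `Q` and `R` bilinear. -/
noncomputable def jetNonlin (P Q : V →L[ℝ] (Fin d → V) →L[ℝ] V) (R : V →L[ℝ] V →L[ℝ] (Fin d → V))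
    (J : Jet d V) : V :=
  P J.1 J.2 + Q J.1 (R J.1 J.1)

/-- The nonlinearity `P(A, ∂A) + Q(A, R(A, A))` as an operator on functions. -/
noncomputable def funNonlin (P Q : V →L[ℝ] (Fin d → V) →L[ℝ] V) (R : V →L[ℝ] V →L[ℝ] (Fin d → V))
    (A : Euc d → V) (x : Euc d) : V :=
  jetNonlin P Q R (A x, fun i => pd i A x)

variable (P Q : V →L[ℝ] (Fin d → V) →L[ℝ] V) (R : V →L[ℝ] V →L[ℝ] (Fin d → V))

lemma norm_bilin_sub_le {X Y Z : Type*} [NormedAddCommGroup X] [NormedSpace ℝ X]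
    [NormedAddCommGroup Y] [NormedSpace ℝ Y] [NormedAddCommGroup Z] [NormedSpace ℝ Z]
    (P : X →L[ℝ] Y →L[ℝ] Z) (x x' : X) (y y' : Y) :
    ‖P x y - P x' y'‖ ≤ ‖P‖ * (‖x - x'‖ * ‖y‖ + ‖x'‖ * ‖y - y'‖) := by
  have : P x y - P x' y' = P (x - x') y + P x' (y - y') := by simp
  rw [this]
  have h1 := P.le_opNorm₂ (x - x') y
  have h2 := P.le_opNorm₂ x' (y - y')
  calc _ ≤ ‖P (x - x') y‖ + ‖P x' (y - y')‖ := norm_add_le _ _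
    _ ≤ _ := by linarith

lemma norm_trilin_sub_le {X Y Z : Type*} [NormedAddCommGroup X] [NormedSpace ℝ X]
    [NormedAddCommGroup Y] [NormedSpace ℝ Y] [NormedAddCommGroup Z] [NormedSpace ℝ Z]
    (Q : X →L[ℝ] Y →L[ℝ] Z) (R : X →L[ℝ] X →L[ℝ] Y) (x x' y y' z z' : X) :
    ‖Q x (R y z) - Q x' (R y' z')‖ ≤
      ‖Q‖ * ‖R‖ * (‖x - x'‖ * ‖y‖ * ‖z‖ + ‖x'‖ * ‖y - y'‖ * ‖z‖ + ‖x'‖ * ‖y'‖ * ‖z - z'‖) := by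
  calc ‖Q x (R y z) - Q x' (R y' z')‖
      ≤ ‖Q‖ * (‖x - x'‖ * ‖R y z‖ + ‖x'‖ * ‖R y z - R y' z'‖) := norm_bilin_sub_le _ _ _ _ _
    _ ≤ ‖Q‖ * (‖x - x'‖ * (‖R‖ * ‖y‖ * ‖z‖) +
        ‖x'‖ * (‖R‖ * (‖y - y'‖ * ‖z‖ + ‖y'‖ * ‖z - z'‖))) := by
        gcongr
        · exact R.le_opNorm₂ y z
        · exact norm_bilin_sub_le _ _ _ _ _
    _ = _ := by ring

/-- The constant in the Lipschitz bound for the nonlinearity. -/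
noncomputable def nonlinConst : ℝ := 13 * (‖P‖ + ‖Q‖ * ‖R‖)

lemma nonlinConst_nonneg : 0 ≤ nonlinConst P Q R := by unfold nonlinConst; positivity

/-- Local Lipschitz bound for the increment `J' ↦ X(J + J') - X(J)` of the nonlinearity, for jets
`J` of size `u` with derivatives of size `u q`, and jets `J'` of size `w ≤ u` with derivatives of
size `w q`. Every term contains a factor `J'`, whence the factor `w`. -/
lemma norm_increment_sub_le {u w q M D D' : ℝ} {J K J' K' : Jet d V} (hM : 0 ≤ M) (hD : 0 ≤ D)
    (hD' : 0 ≤ D') (hw : 0 ≤ w) (hwu : w ≤ u) (huq : u ≤ q)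
    (hJ₁ : ‖J.1‖ ≤ M * u) (hJ₂ : ‖J.2‖ ≤ M * (u * q)) (hJ'₁ : ‖J'.1‖ ≤ M * u)
    (hK₁ : ‖K.1‖ ≤ M * w) (hK₂ : ‖K.2‖ ≤ M * (w * q))
    (hK'₁ : ‖K'.1‖ ≤ M * w)
    (hJJ₁ : ‖J.1 - J'.1‖ ≤ D * u) (hJJ₂ : ‖J.2 - J'.2‖ ≤ D * (u * q))
    (hKK₁ : ‖K.1 - K'.1‖ ≤ D' * w) (hKK₂ : ‖K.2 - K'.2‖ ≤ D' * (w * q)) :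
    ‖(jetNonlin P Q R (J + K) - jetNonlin P Q R J) -
      (jetNonlin P Q R (J' + K') - jetNonlin P Q R J')‖ ≤
      nonlinConst P Q R * (1 + M) ^ 2 * (D + D') * (u * w * q) := by
  have hu : 0 ≤ u := hw.trans hwu
  have hq : 0 ≤ q := hu.trans huq
  set c := J.1 + K.1 with hc
  set c' := J'.1 + K'.1 with hc'
  have hcn : ‖c‖ ≤ 2 * M * u := by
    have : M * w ≤ M * u := mul_le_mul_of_nonneg_left hwu hM
    exact (norm_add_le _ _).trans (by linarith)
  have hcn' : ‖c'‖ ≤ 2 * M * u := by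
    have : M * w ≤ M * u := mul_le_mul_of_nonneg_left hwu hM
    exact (norm_add_le _ _).trans (by linarith)
  have hcc : ‖c - c'‖ ≤ (D + D') * u := by
    have e : c - c' = (J.1 - J'.1) + (K.1 - K'.1) := by rw [hc, hc']; abel
    have : D' * w ≤ D' * u := mul_le_mul_of_nonneg_left hwu hD'
    rw [e]
    exact (norm_add_le _ _).trans (by linarith)
  have hwq : w * q ≤ u * q := mul_le_mul_of_nonneg_right hwu hq
  have hp : ‖J.2 + K.2‖ ≤ 2 * M * (u * q) := by
    have : M * (w * q) ≤ M * (u * q) := mul_le_mul_of_nonneg_left hwq hM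
    exact (norm_add_le _ _).trans (by linarith)
  have hpp : ‖(J.2 + K.2) - (J'.2 + K'.2)‖ ≤ (D + D') * (u * q) := by
    have e : (J.2 + K.2) - (J'.2 + K'.2) = (J.2 - J'.2) + (K.2 - K'.2) := by abel
    have : D' * (w * q) ≤ D' * (u * q) := mul_le_mul_of_nonneg_left hwq hD'
    rw [e]
    exact (norm_add_le _ _).trans (by linarith)
  have e : ∀ J K : Jet d V, jetNonlin P Q R (J + K) - jetNonlin P Q R J =
      (P K.1 (J.2 + K.2) + P J.1 K.2) +
      (Q K.1 (R (J.1 + K.1) (J.1 + K.1)) + Q J.1 (R K.1 (J.1 + K.1)) + Q J.1 (R J.1 K.1)) := by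
    intro J K
    simp only [jetNonlin, Prod.fst_add, Prod.snd_add, map_add, _root_.add_apply]
    abel
  have e1 : (jetNonlin P Q R (J + K) - jetNonlin P Q R J) -
      (jetNonlin P Q R (J' + K') - jetNonlin P Q R J') =
      (P K.1 (J.2 + K.2) - P K'.1 (J'.2 + K'.2)) + (P J.1 K.2 - P J'.1 K'.2) +
      (Q K.1 (R c c) - Q K'.1 (R c' c')) + (Q J.1 (R K.1 c) - Q J'.1 (R K'.1 c')) +
      (Q J.1 (R J.1 K.1) - Q J'.1 (R J'.1 K'.1)) := by
    rw [e, e]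
    abel
  have b1 : ‖P K.1 (J.2 + K.2) - P K'.1 (J'.2 + K'.2)‖ ≤
      ‖P‖ * ((D' * w) * (2 * M * (u * q)) + (M * w) * ((D + D') * (u * q))) :=
    (norm_bilin_sub_le _ _ _ _ _).trans (by gcongr)
  have b2 : ‖P J.1 K.2 - P J'.1 K'.2‖ ≤
      ‖P‖ * ((D * u) * (M * (w * q)) + (M * u) * (D' * (w * q))) :=
    (norm_bilin_sub_le _ _ _ _ _).trans (by gcongr)
  have b3 : ‖Q K.1 (R c c) - Q K'.1 (R c' c')‖ ≤
      ‖Q‖ * ‖R‖ * ((D' * w) * (2 * M * u) * (2 * M * u) + (M * w) * ((D + D') * u) * (2 * M * u) +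
        (M * w) * (2 * M * u) * ((D + D') * u)) :=
    (norm_trilin_sub_le _ _ _ _ _ _ _ _).trans (by gcongr)
  have b4 : ‖Q J.1 (R K.1 c) - Q J'.1 (R K'.1 c')‖ ≤
      ‖Q‖ * ‖R‖ * ((D * u) * (M * w) * (2 * M * u) + (M * u) * (D' * w) * (2 * M * u) +
        (M * u) * (M * w) * ((D + D') * u)) :=
    (norm_trilin_sub_le _ _ _ _ _ _ _ _).trans (by gcongr)
  have b5 : ‖Q J.1 (R J.1 K.1) - Q J'.1 (R J'.1 K'.1)‖ ≤
      ‖Q‖ * ‖R‖ * ((D * u) * (M * u) * (M * w) + (M * u) * (D * u) * (M * w) +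
        (M * u) * (M * u) * (D' * w)) :=
    (norm_trilin_sub_le _ _ _ _ _ _ _ _).trans (by gcongr)
  have huwq : 0 ≤ u * w * q := by positivity
  have huw : u * u * w ≤ u * w * q := by
    have := mul_le_mul_of_nonneg_left huq (mul_nonneg hu hw)
    linarith only [this]
  have hDD : 0 ≤ D + D' := add_nonneg hD hD'
  -- the quadratic terms carry at most `4 M` and the cubic ones at most `13 M ^ 2`
  have s2 : (D' * w) * (2 * M * (u * q)) + (M * w) * ((D + D') * (u * q)) +
      ((D * u) * (M * (w * q)) + (M * u) * (D' * (w * q))) ≤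
      13 * (1 + M) ^ 2 * (D + D') * (u * w * q) := by
    have h1 : 2 * D + 4 * D' ≤ 4 * (D + D') := by linarith only [hD, hD']
    have h2 : 4 * M ≤ 13 * (1 + M) ^ 2 := by
      rw [show (1 + M) ^ 2 = 1 + 2 * M + M ^ 2 by ring]
      linarith only [sq_nonneg M, hM]
    calc _ = M * (2 * D + 4 * D') * (u * w * q) := by ring
      _ ≤ M * (4 * (D + D')) * (u * w * q) := by gcongr
      _ = 4 * M * ((D + D') * (u * w * q)) := by ring
      _ ≤ 13 * (1 + M) ^ 2 * ((D + D') * (u * w * q)) := by gcongr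
      _ = _ := by ring
  have s3 : ((D' * w) * (2 * M * u) * (2 * M * u) + (M * w) * ((D + D') * u) * (2 * M * u) +
        (M * w) * (2 * M * u) * ((D + D') * u)) +
      ((D * u) * (M * w) * (2 * M * u) + (M * u) * (D' * w) * (2 * M * u) +
        (M * u) * (M * w) * ((D + D') * u)) +
      ((D * u) * (M * u) * (M * w) + (M * u) * (D * u) * (M * w) +
        (M * u) * (M * u) * (D' * w)) ≤ 13 * (1 + M) ^ 2 * (D + D') * (u * w * q) := by
    have h1 : 9 * D + 12 * D' ≤ 13 * (D + D') := by linarith only [hD, hD']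
    have h2 : M ^ 2 ≤ (1 + M) ^ 2 := pow_le_pow_left₀ hM (by linarith only) 2
    calc _ = M ^ 2 * (9 * D + 12 * D') * (u * u * w) := by ring
      _ ≤ M ^ 2 * (13 * (D + D')) * (u * w * q) := by gcongr
      _ = 13 * M ^ 2 * ((D + D') * (u * w * q)) := by ring
      _ ≤ 13 * (1 + M) ^ 2 * ((D + D') * (u * w * q)) := by gcongr
      _ = _ := by ring
  have t2 := mul_le_mul_of_nonneg_left s2 (norm_nonneg P)
  have t3 := mul_le_mul_of_nonneg_left s3 (mul_nonneg (norm_nonneg Q) (norm_nonneg R))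
  rw [e1]
  refine (norm_add_le _ _).trans ((add_le_add ((norm_add_le _ _).trans (add_le_add
    ((norm_add₃_le).trans (add_le_add_three b1 b2 b3)) b4)) b5).trans ?_)
  unfold nonlinConst
  linarith only [t2, t3]

lemma continuous_jetNonlin : Continuous (jetNonlin P Q R) := by
  unfold jetNonlin
  fun_prop

end Nonlinearity

/-! ### The remainder equation -/

section Remainder

variable {d : ℕ} {V : Type*} [NormedAddCommGroup V] [NormedSpace ℝ V] [CompleteSpace V]
variable (P Q : V →L[ℝ] (Fin d → V) →L[ℝ] V) (R : V →L[ℝ] V →L[ℝ] (Fin d → V))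

/-- The value and the first partial derivatives of a function at a point. -/
noncomputable def jetAt (f : Euc d → V) (x : Euc d) : Jet d V := (f x, fun i => pd i f x)

/-- The increment `X(A + B) - X(A)` of the nonlinearity along two paths. -/
noncomputable def increment (A B : ℝ → Euc d → V) (s : ℝ) : Euc d → V :=
  funNonlin P Q R (A s + B s) - funNonlin P Q R (A s)

lemma jetAt_add {f g : Euc d → V} {x : Euc d} (hf : DifferentiableAt ℝ f x)
    (hg : DifferentiableAt ℝ g x) : jetAt (f + g) x = jetAt f x + jetAt g x := by
  ext
  · rfl
  · simp [jetAt, pd_add hf hg]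

lemma increment_apply {S : Set ℝ} {A B : ℝ → Euc d → V} (hA : JetCont S A) (hB : JetCont S B)
    {s : ℝ} (hs : s ∈ S) (x : Euc d) : increment P Q R A B s x =
      jetNonlin P Q R (jetAt (A s) x + jetAt (B s) x) - jetNonlin P Q R (jetAt (A s) x) := by
  rw [← jetAt_add ((hA.isC1 s hs).differentiable x) ((hB.isC1 s hs).differentiable x)]
  rfl

lemma JetCont.continuousOn_jetAt {S : Set ℝ} {A : ℝ → Euc d → V} (hA : JetCont S A) :
    ContinuousOn (fun p : ℝ × Euc d => jetAt (A p.1) p.2) (S ×ˢ univ) :=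
  hA.cont.prodMk (continuousOn_pi.2 hA.cont_pd)

lemma continuousOn_funNonlin {S : Set ℝ} {A : ℝ → Euc d → V} (hA : JetCont S A) :
    ContinuousOn (fun p : ℝ × Euc d => funNonlin P Q R (A p.1) p.2) (S ×ˢ univ) :=
  (continuous_jetNonlin P Q R).comp_continuousOn hA.continuousOn_jetAt

lemma continuousOn_increment {S : Set ℝ} {A B : ℝ → Euc d → V} (hA : JetCont S A)
    (hB : JetCont S B) :
    ContinuousOn (fun p : ℝ × Euc d => increment P Q R A B p.1 p.2) (S ×ˢ univ) :=
  (continuousOn_funNonlin P Q R (hA.add hB)).sub (continuousOn_funNonlin P Q R hA)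

lemma isTorusFun_funNonlin {f : Euc d → V} (hf : IsTorusFun f) : IsTorusFun (funNonlin P Q R f) :=
  fun i x => by
    simp only [funNonlin, hf i x, fun j => hf.pd j i x]

lemma isTorusFun_increment {S : Set ℝ} {A B : ℝ → Euc d → V} (hA : JetCont S A) (hB : JetCont S B)
    {s : ℝ} (hs : s ∈ S) : IsTorusFun (increment P Q R A B s) := fun i x => by
  simp only [increment, Pi.sub_apply,
    isTorusFun_funNonlin P Q R ((hA.isC1 s hs).add (hB.isC1 s hs)).1 i x,
    isTorusFun_funNonlin P Q R (hA.isC1 s hs).1 i x]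

lemma rpow_neg_half_add {s c : ℝ} (hs : 0 < s) :
    s ^ (-(1 / 2 + c)) = s ^ (-c) * s ^ (-(1 / 2) : ℝ) := by
  rw [← Real.rpow_add hs]; congr 1; ring

lemma JetBound.norm_jetAt_le {T γ M : ℝ} {A : ℝ → Euc d → V} (hM : 0 ≤ M) (h : JetBound T γ M A)
    {s : ℝ} (hs : s ∈ Ioc 0 T) (x : Euc d) :
    ‖(jetAt (A s) x).1‖ ≤ M * s ^ (-γ) ∧
      ‖(jetAt (A s) x).2‖ ≤ M * (s ^ (-γ) * s ^ (-(1 / 2) : ℝ)) := by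
  have hs0 := hs.1
  refine ⟨(h s hs x).1, (pi_norm_le_iff_of_nonneg (by positivity)).2 fun i => ?_⟩
  rw [← rpow_neg_half_add hs0]
  exact (h s hs x).2 i

lemma JetBound.weaken {T γ γ' M : ℝ} {A : ℝ → Euc d → V} (h : JetBound T γ M A) (hM : 0 ≤ M)
    (hT : T ≤ 1) (hγ : γ ≤ γ') : JetBound T γ' M A := fun t ht x =>
  ⟨(h t ht x).1.trans (mul_le_mul_of_nonneg_left
    (Real.rpow_le_rpow_of_exponent_ge ht.1 (ht.2.trans hT) (by linarith)) hM),
  fun i => ((h t ht x).2 i).trans (mul_le_mul_of_nonneg_left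
    (Real.rpow_le_rpow_of_exponent_ge ht.1 (ht.2.trans hT) (by linarith)) hM)⟩

lemma rpow_neg_mul_mul {s γ b : ℝ} (hs : 0 < s) :
    s ^ (-γ) * s ^ (-b) * s ^ (-(1 / 2) : ℝ) = s ^ (-(1 / 2 + γ + b)) := by
  rw [← Real.rpow_add hs, ← Real.rpow_add hs]; congr 1; ring

/-- Differences of increments are sources whose singularity is integrable when `γ + b < 1 / 2`. -/
lemma isSource_increment_sub {T γ b M D D' : ℝ} (hT : T ≤ 1) (hbγ : b ≤ γ)
    (hγ : γ ≤ 1 / 2) (hM : 0 ≤ M) (hD : 0 ≤ D) (hD' : 0 ≤ D') {A A' B B' : ℝ → Euc d → V}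
    (hA : JetCont (Ioc 0 T) A) (hA' : JetCont (Ioc 0 T) A') (hB : JetCont (Ioc 0 T) B)
    (hB' : JetCont (Ioc 0 T) B') (nA : JetBound T γ M A) (nA' : JetBound T γ M A')
    (nB : JetBound T b M B) (nB' : JetBound T b M B') (nAA : JetBound T γ D (A - A'))
    (nBB : JetBound T b D' (B - B')) :
    IsSource T (1 / 2 + γ + b) (nonlinConst P Q R * (1 + M) ^ 2 * (D + D'))
      (increment P Q R A B - increment P Q R A' B') := by
  refine ⟨(continuousOn_increment P Q R hA hB).sub (continuousOn_increment P Q R hA' hB'),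
    fun s hs x => ?_⟩
  have hs0 := hs.1
  have hs1 : s ≤ 1 := hs.2.trans hT
  have hsub : ∀ {A A' : ℝ → Euc d → V}, JetCont (Ioc 0 T) A → JetCont (Ioc 0 T) A' →
      jetAt (A s) x - jetAt (A' s) x = jetAt ((A - A') s) x := fun {A A'} h h' => by
    ext
    · rfl
    · simp [jetAt, pd_sub ((h.isC1 s hs).differentiable x) ((h'.isC1 s hs).differentiable x)]
  have dA := nAA.norm_jetAt_le hD hs x
  have dB := nBB.norm_jetAt_le hD' hs x
  rw [← hsub hA hA'] at dA
  rw [← hsub hB hB'] at dB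
  rw [← rpow_neg_mul_mul hs0, Pi.sub_apply, Pi.sub_apply, increment_apply P Q R hA hB hs,
    increment_apply P Q R hA' hB' hs]
  have mA := nA.norm_jetAt_le hM hs x
  have mA' := nA'.norm_jetAt_le hM hs x
  have mB := nB.norm_jetAt_le hM hs x
  have mB' := nB'.norm_jetAt_le hM hs x
  exact norm_increment_sub_le P Q R hM hD hD' (by positivity)
    (Real.rpow_le_rpow_of_exponent_ge hs0 hs1 (by linarith))
    (Real.rpow_le_rpow_of_exponent_ge hs0 hs1 (by linarith))
    mA.1 mA.2 mA'.1 mB.1 mB.2 mB'.1 dA.1 dA.2 dB.1 dB.2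

lemma jetCont_zero (S : Set ℝ) : JetCont S (0 : ℝ → Euc d → V) :=
  ⟨fun _ _ => ⟨fun _ _ => rfl, contDiff_const⟩, continuousOn_const,
    fun i => by simp only [Pi.zero_apply, pd_zero]; exact continuousOn_const⟩

lemma jetBound_zero (T γ : ℝ) {M : ℝ} (hM : 0 ≤ M) : JetBound T γ M (0 : ℝ → Euc d → V) :=
  fun t ht x => by
    have := ht.1
    simp only [Pi.zero_apply, pd_zero, norm_zero]
    exact ⟨by positivity, fun _ => by positivity⟩

lemma isSource_increment {T γ b M M' : ℝ} (hT : T ≤ 1) (hbγ : b ≤ γ) (hγ : γ ≤ 1 / 2)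
    (hM : 0 ≤ M) (hM' : 0 ≤ M') (hMM : M' ≤ M) {A B : ℝ → Euc d → V} (hA : JetCont (Ioc 0 T) A)
    (hB : JetCont (Ioc 0 T) B) (nA : JetBound T γ M A) (nB : JetBound T b M' B) :
    IsSource T (1 / 2 + γ + b) (nonlinConst P Q R * (1 + M) ^ 2 * M') (increment P Q R A B) := by
  have h := isSource_increment_sub P Q R hT hbγ hγ hM le_rfl hM' hA hA hB (jetCont_zero _) nA nA
    (nB.mono le_rfl hMM) (jetBound_zero T b hM) (by simpa using jetBound_zero T γ le_rfl)
    (by simpa using nB)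
  have e : increment P Q R A 0 = 0 := by ext; simp [increment]
  rwa [e, sub_zero, zero_add] at h

/-! #### Construction by the contraction principle -/

/-- The jet at `(s, x)` encoded by an element of the weighted jet space. -/
noncomputable def unweight (b : ℝ) {T : ℝ} (W : PathSpace T d (Jet d V))
    (p : Ioc (0 : ℝ) T × Euc d) : Jet d V :=
  ((p.1 : ℝ) ^ (-b) • (W p).1, (p.1 : ℝ) ^ (-(1 / 2 + b)) • (W p).2)

lemma unweight_of_eq_weightedJet {T b : ℝ} {W : PathSpace T d (Jet d V)} {B : ℝ → Euc d → V}
    {p : Ioc (0 : ℝ) T × Euc d} (h : W p = weightedJet T b B p) :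
    unweight b W p = jetAt (B p.1) p.2 := by
  have hp := p.1.2.1
  have e : ∀ c : ℝ, (p.1 : ℝ) ^ (-c) * (p.1 : ℝ) ^ c = 1 := fun c => by
    rw [← Real.rpow_add hp]; simp
  ext i
  · simp [unweight, h, weightedJet, jetAt, smul_smul, e]
  · simp only [unweight, h, weightedJet, jetAt, Pi.smul_apply, smul_smul, e, one_smul]

lemma continuous_unweight (b : ℝ) {T : ℝ} (W : PathSpace T d (Jet d V)) :
    Continuous (unweight b W) :=
  ((continuous_subtype_rpow T _).smul (continuous_fst.comp W.continuous)).prodMk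
    ((continuous_subtype_rpow T _).smul (continuous_snd.comp W.continuous))

lemma norm_unweight_le {b T M : ℝ} {W : PathSpace T d (Jet d V)} (hW : ‖W‖ ≤ M)
    (p : Ioc (0 : ℝ) T × Euc d) :
    ‖(unweight b W p).1‖ ≤ M * (p.1 : ℝ) ^ (-b) ∧
      ‖(unweight b W p).2‖ ≤ M * ((p.1 : ℝ) ^ (-b) * (p.1 : ℝ) ^ (-(1 / 2) : ℝ)) := by
  have hp := p.1.2.1
  have h := (W.norm_coe_le_norm p).trans hW
  have h1 := (norm_fst_le (W p)).trans h
  have h2 := (norm_snd_le (W p)).trans h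
  constructor
  · rw [unweight, norm_smul, Real.norm_of_nonneg (by positivity), mul_comm]
    exact mul_le_mul_of_nonneg_right h1 (by positivity)
  · rw [unweight, norm_smul, Real.norm_of_nonneg (by positivity), mul_comm,
      ← rpow_neg_half_add hp]
    exact mul_le_mul_of_nonneg_right h2 (by positivity)

lemma unweight_sub (b : ℝ) {T : ℝ} (W W' : PathSpace T d (Jet d V)) (p : Ioc (0 : ℝ) T × Euc d) :
    unweight b W p - unweight b W' p = unweight b (W - W') p := by
  ext <;> simp [unweight, smul_sub]

/-- The increment `s ^ a (X(A + B) - X(A))`, with `a = 1 / 2 + γ + b`, as a function of the weighted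
jet of `B`. -/
noncomputable def jetIncrement (γ b : ℝ) {T : ℝ} (A : ℝ → Euc d → V) (W : PathSpace T d (Jet d V))
    (p : Ioc (0 : ℝ) T × Euc d) : V :=
  (p.1 : ℝ) ^ (1 / 2 + γ + b) • (jetNonlin P Q R (jetAt (A p.1) p.2 + unweight b W p) -
    jetNonlin P Q R (jetAt (A p.1) p.2))

lemma continuous_jetIncrement {γ b T : ℝ} {A : ℝ → Euc d → V} (hA : JetCont (Ioc 0 T) A)
    (W : PathSpace T d (Jet d V)) : Continuous (jetIncrement P Q R γ b A W) := by
  have h1 : Continuous fun p : Ioc (0 : ℝ) T × Euc d => jetAt (A p.1) p.2 :=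
    ContinuousOn.comp_subtype (G := fun s x => jetAt (A s) x) hA.continuousOn_jetAt
  exact (continuous_subtype_rpow T _).smul
    (((continuous_jetNonlin P Q R).comp (h1.add (continuous_unweight b W))).sub
      ((continuous_jetNonlin P Q R).comp h1))

lemma norm_jetIncrement_sub_le {T γ b M : ℝ} (hT : T ≤ 1) (hbγ : b ≤ γ) (hγ : γ ≤ 1 / 2)
    (hM : 0 ≤ M) {A : ℝ → Euc d → V} (nA : JetBound T γ M A) {W W' : PathSpace T d (Jet d V)}
    (hW : ‖W‖ ≤ M) (hW' : ‖W'‖ ≤ M) (p : Ioc (0 : ℝ) T × Euc d) :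
    ‖jetIncrement P Q R γ b A W p - jetIncrement P Q R γ b A W' p‖ ≤
      nonlinConst P Q R * (1 + M) ^ 2 * ‖W - W'‖ := by
  have hs0 := p.1.2.1
  have hs1 : (p.1 : ℝ) ≤ 1 := p.1.2.2.trans hT
  have hA := nA.norm_jetAt_le hM p.1.2 p.2
  have dW := norm_unweight_le (b := b) (le_refl ‖W - W'‖) p
  rw [← unweight_sub] at dW
  have h := norm_increment_sub_le P Q R (D := 0) hM le_rfl (norm_nonneg (W - W'))
    (u := (p.1 : ℝ) ^ (-γ)) (w := (p.1 : ℝ) ^ (-b)) (q := (p.1 : ℝ) ^ (-(1 / 2) : ℝ))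
    (J := jetAt (A p.1) p.2) (J' := jetAt (A p.1) p.2) (by positivity)
    (Real.rpow_le_rpow_of_exponent_ge hs0 hs1 (by linarith))
    (Real.rpow_le_rpow_of_exponent_ge hs0 hs1 (by linarith))
    hA.1 hA.2 hA.1 (norm_unweight_le hW p).1 (norm_unweight_le hW p).2 (norm_unweight_le hW' p).1
    (by simp) (by simp) dW.1 dW.2
  rw [jetIncrement, jetIncrement, ← smul_sub]
  refine rpow_smul_norm_le hs0 ?_
  rw [← rpow_neg_mul_mul hs0]
  simpa using h

lemma jetIncrement_zero (γ b : ℝ) {T : ℝ} (A : ℝ → Euc d → V) (p : Ioc (0 : ℝ) T × Euc d) :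
    jetIncrement P Q R γ b A 0 p = 0 := by
  have : unweight b (0 : PathSpace T d (Jet d V)) p = 0 := by ext <;> simp [unweight]
  simp [jetIncrement, this]

/-- `jetIncrement` as a map between spaces of bounded continuous functions. -/
noncomputable def incrementMap {T γ b M : ℝ} (hT : T ≤ 1) (hbγ : b ≤ γ) (hγ : γ ≤ 1 / 2)
    {A : ℝ → Euc d → V} (hA : JetCont (Ioc 0 T) A) (nA : JetBound T γ M A)
    (W : PathSpace T d (Jet d V)) : PathSpace T d V :=
  BoundedContinuousFunction.ofNormedAddCommGroup (jetIncrement P Q R γ b A W)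
    (continuous_jetIncrement P Q R hA W)
    (nonlinConst P Q R * (1 + max ‖W‖ M) ^ 2 * ‖W‖) fun p => by
      have h := norm_jetIncrement_sub_le P Q R hT hbγ hγ (M := max ‖W‖ M)
        (le_max_of_le_left (norm_nonneg _)) (nA.mono le_rfl (le_max_right _ _)) (W' := 0)
        (le_max_left _ _) (by simp) p
      rwa [jetIncrement_zero, sub_zero, sub_zero] at h

lemma norm_incrementMap_sub_le {T γ b M M' : ℝ} (hT : T ≤ 1) (hbγ : b ≤ γ) (hγ : γ ≤ 1 / 2)
    (hM' : 0 ≤ M') (hMM' : M ≤ M') {A : ℝ → Euc d → V} (hA : JetCont (Ioc 0 T) A)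
    (nA : JetBound T γ M A) {W W' : PathSpace T d (Jet d V)} (hW : ‖W‖ ≤ M') (hW' : ‖W'‖ ≤ M') :
    ‖incrementMap P Q R hT hbγ hγ hA nA W - incrementMap P Q R hT hbγ hγ hA nA W'‖ ≤
      nonlinConst P Q R * (1 + M') ^ 2 * ‖W - W'‖ := by
  have := nonlinConst_nonneg P Q R
  refine (BoundedContinuousFunction.norm_le (by positivity)).2 fun p => ?_
  exact norm_jetIncrement_sub_le P Q R hT hbγ hγ hM' (nA.mono le_rfl hMM') hW hW' p

/-- Existence for the remainder equation `B = B₁ + ∫ exp ((t - s) Δ) (X(A + B) - X(A)) ds` on a time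
interval which is short in terms of the size `r` of `A` and `B₁`. -/
theorem exists_remainder {T γ b r : ℝ} (hT0 : 0 < T) (hT : T ≤ 1) (hb : 0 ≤ b) (hbγ : b ≤ γ)
    (hγ : γ < 1 / 2) (hγb : γ + b < 1 / 2) (hr : 0 ≤ r)
    (hsmall : duhamelConst d (1 / 2 + γ + b) * T ^ (1 / 2 - γ) *
      (nonlinConst P Q R * (1 + 2 * r) ^ 2) ≤ 1 / 4)
    {A B₁ : ℝ → Euc d → V} (hA : JetCont (Ioc 0 T) A) (hB₁ : JetCont (Ioc 0 T) B₁)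
    (nA : JetBound T γ r A) (nB₁ : JetBound T b r B₁) :
    ∃ B : ℝ → Euc d → V, JetCont (Ioc 0 T) B ∧ JetBound T b (2 * r) B ∧
      JetBound T b r (duhamel (increment P Q R A B)) ∧
      ∀ t ∈ Ioc 0 T, B t = B₁ t + duhamel (increment P Q R A B) t := by
  set a := 1 / 2 + γ + b with ha_def
  have ha0 : 0 ≤ a := by linarith
  have ha : a < 1 := by linarith
  have hab : a ≤ 1 + b := by linarith
  -- in weighted jets the equation reads `W = W₁ + 𝒟 (N W)`
  set 𝒟 : PathSpace T d V →L[ℝ] PathSpace T d (Jet d V) := duhamelOp d V ha0 ha hab with h𝒟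
  have h𝒟n : ‖𝒟‖ ≤ duhamelConst d a * T ^ (1 / 2 - γ) := by
    have := norm_duhamelOp_le (d := d) (V := V) hT0 ha0 ha hab
    rwa [show 1 + b - a = 1 / 2 - γ by rw [ha_def]; ring] at this
  set N := incrementMap P Q R hT hbγ hγ.le hA nA (b := b) with hN
  set W₁ : PathSpace T d (Jet d V) := BoundedContinuousFunction.ofNormedAddCommGroup
    (weightedJet T b B₁) (continuous_weightedJet hB₁.cont hB₁.cont_pd) r
    (nB₁.norm_weightedJet_le hr) with hW₁
  have hW₁n : ‖W₁‖ ≤ r := (BoundedContinuousFunction.norm_le hr).2 (nB₁.norm_weightedJet_le hr)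
  have hDN : ∀ W W' : PathSpace T d (Jet d V), ‖W‖ ≤ 2 * r → ‖W'‖ ≤ 2 * r →
      ‖𝒟 (N W) - 𝒟 (N W')‖ ≤ 1 / 4 * ‖W - W'‖ := by
    intro W W' hW hW'
    have h1 := norm_incrementMap_sub_le P Q R hT hbγ hγ.le (b := b) (M' := 2 * r) (by linarith)
      (by linarith) hA nA hW hW'
    have hK := duhamelConst_nonneg (d := d) ha
    have hk := nonlinConst_nonneg P Q R
    rw [← map_sub]
    calc ‖𝒟 (N W - N W')‖ ≤ ‖𝒟‖ * ‖N W - N W'‖ := 𝒟.le_opNorm _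
      _ ≤ (duhamelConst d a * T ^ (1 / 2 - γ)) *
          (nonlinConst P Q R * (1 + 2 * r) ^ 2 * ‖W - W'‖) := by gcongr
      _ = duhamelConst d a * T ^ (1 / 2 - γ) * (nonlinConst P Q R * (1 + 2 * r) ^ 2) *
          ‖W - W'‖ := by ring
      _ ≤ _ := mul_le_mul_of_nonneg_right hsmall (norm_nonneg _)
  have hN0 : N 0 = 0 := by
    ext p
    exact jetIncrement_zero P Q R γ b A p
  have hDN0 : ∀ W : PathSpace T d (Jet d V), ‖W‖ ≤ 2 * r → ‖𝒟 (N W)‖ ≤ r := by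
    intro W hW
    have := hDN W 0 hW (by simpa using hr)
    rw [hN0, map_zero, sub_zero, sub_zero] at this
    linarith
  -- periodicity is imposed as a closed condition on the jets
  set S : Set (PathSpace T d (Jet d V)) := {W | ‖W - W₁‖ ≤ r ∧
    ∀ (i : Fin d) (p : Ioc (0 : ℝ) T × Euc d), W (p.1, p.2 + EuclideanSpace.single i 1) = W p}
    with hS
  have hSn : ∀ W ∈ S, ‖W‖ ≤ 2 * r := fun W hW => by
    have := norm_add_le (W - W₁) W₁
    rw [sub_add_cancel] at this
    linarith [hW.1]
  have hSclosed : IsClosed S := by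
    refine IsClosed.inter (isClosed_le
      (continuous_norm.comp (continuous_id.sub continuous_const)) continuous_const) ?_
    have e : {W : PathSpace T d (Jet d V) | ∀ (i : Fin d) (p : Ioc (0 : ℝ) T × Euc d),
        W (p.1, p.2 + EuclideanSpace.single i 1) = W p} = ⋂ i, ⋂ p : Ioc (0 : ℝ) T × Euc d,
        {W | W (p.1, p.2 + EuclideanSpace.single i 1) = W p} := by
      ext; simp only [mem_ofPred_eq, mem_iInter]
    change IsClosed {W : PathSpace T d (Jet d V) | ∀ (i : Fin d) (p : Ioc (0 : ℝ) T × Euc d),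
        W (p.1, p.2 + EuclideanSpace.single i 1) = W p}
    rw [e]
    exact isClosed_iInter fun i => isClosed_iInter fun p => isClosed_eq
      (continuous_eval_const _)
      (continuous_eval_const _)
  -- the weight `s ^ a` in `N` cancels the singularity of the source
  have hsrc : ∀ W : PathSpace T d (Jet d V), ∀ p : Ioc (0 : ℝ) T × Euc d,
      pathSource T a (N W) p.1 p.2 = jetNonlin P Q R (jetAt (A p.1) p.2 + unweight b W p) -
        jetNonlin P Q R (jetAt (A p.1) p.2) := by
    intro W p
    rw [pathSource_apply]
    have : (p.1 : ℝ) ^ (-a) * (p.1 : ℝ) ^ a = 1 := by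
      rw [← Real.rpow_add p.1.2.1]; simp
    change (p.1 : ℝ) ^ (-a) • jetIncrement P Q R γ b A W p = _
    rw [jetIncrement, smul_smul, this, one_smul]
  have hper : ∀ W ∈ S, ∀ s ∈ Ioc 0 T, IsTorusFun (pathSource T a (N W) s) := by
    intro W hW s hs i x
    have h1 := hsrc W (⟨s, hs⟩, x)
    have h2 := hsrc W (⟨s, hs⟩, x + EuclideanSpace.single i 1)
    simp only at h1 h2
    rw [h1, h2]
    have e1 : jetAt (A s) (x + EuclideanSpace.single i 1) = jetAt (A s) x := by
      simp only [jetAt, (hA.isC1 s hs).1 i x, fun j => (hA.isC1 s hs).1.pd j i x]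
    have e2 : unweight b W (⟨s, hs⟩, x + EuclideanSpace.single i 1) =
        unweight b W (⟨s, hs⟩, x) := by
      simp only [unweight, hW.2 i (⟨s, hs⟩, x)]
    rw [e1, e2]
  have hjet : ∀ W ∈ S, JetCont (Ioc 0 T) (duhamel (pathSource T a (N W))) := fun W hW =>
    jetCont_duhamel (isSource_pathSource _) ha0 ha (norm_nonneg _) (hper W hW)
  have hmaps : MapsTo (fun W => W₁ + 𝒟 (N W)) S S := by
    intro W hW
    refine ⟨by simpa using hDN0 W (hSn W hW), fun i p => ?_⟩
    have e1 := (hB₁.isC1 p.1 p.1.2).1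
    have e2 := ((hjet W hW).isC1 p.1 p.1.2).1
    change weightedJet T b B₁ _ + weightedJet T b (duhamel (pathSource T a (N W))) _ =
      weightedJet T b B₁ _ + weightedJet T b (duhamel (pathSource T a (N W))) _
    simp only [weightedJet, e1 i p.2, e2 i p.2, fun j => e1.pd j i p.2, fun j => e2.pd j i p.2]
  have hcontr : ContractingWith (1 / 4) (hmaps.restrict (fun W => W₁ + 𝒟 (N W)) S S) := by
    refine ⟨by rw [← NNReal.coe_lt_coe]; norm_num, LipschitzWith.of_dist_le_mul fun W W' => ?_⟩
    rw [Subtype.dist_eq, Subtype.dist_eq, dist_eq_norm, dist_eq_norm]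
    simp only [MapsTo.val_restrict_apply, add_sub_add_left_eq_sub]
    simpa using hDN W W' (hSn W W.2) (hSn W' W'.2)
  have hW₁S : W₁ ∈ S := by
    refine ⟨by simpa using hr, fun i p => ?_⟩
    have e1 := (hB₁.isC1 p.1 p.1.2).1
    change weightedJet T b B₁ _ = weightedJet T b B₁ _
    simp only [weightedJet, e1 i p.2, fun j => e1.pd j i p.2]
  obtain ⟨W, hWS, hfix, -⟩ := hcontr.exists_fixedPoint' hSclosed.isComplete hmaps hW₁S
    (edist_ne_top _ _)
  have hfix' : W₁ + 𝒟 (N W) = W := hfix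
  set F := pathSource T a (N W) with hF
  set B : ℝ → Euc d → V := fun t => B₁ t + duhamel F t with hBdef
  have hBjet : JetCont (Ioc 0 T) B := hB₁.add (hjet W hWS)
  -- the fixed point is the jet of its own values, since both terms of `W₁ + 𝒟 (N W)` are jets
  have hWB : ∀ p, W p = weightedJet T b B p := by
    intro p
    have h1 := (hB₁.isC1 p.1 p.1.2).differentiable p.2
    have h2 : DifferentiableAt ℝ (duhamel F p.1) p.2 :=
      ((hjet W hWS).isC1 p.1 p.1.2).differentiable p.2
    conv_lhs => rw [← hfix']
    change weightedJet T b B₁ p + weightedJet T b (duhamel F) p = _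
    ext i
    · simp [weightedJet, hBdef]
    · simp only [weightedJet, hBdef, Prod.mk_add_mk, Pi.add_apply]
      rw [pd_add h1 h2, smul_add]
  have hFinc : ∀ s ∈ Ioc 0 T, F s = increment P Q R A B s := by
    intro s hs
    ext x
    rw [increment_apply P Q R hA hBjet hs, hF, hsrc W (⟨s, hs⟩, x),
      unweight_of_eq_weightedJet (hWB _)]
  have hnorm : ∀ {G : ℝ → Euc d → V} {c : ℝ}, (∀ p, ‖weightedJet T b G p‖ ≤ c) →
      JetBound T b c G := by
    intro G c hG t ht x
    have h := hG (⟨t, ht⟩, x)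
    have ht0 := ht.1
    have e : ∀ (e : ℝ) (v : V), ‖t ^ e • v‖ ≤ c → ‖v‖ ≤ c * t ^ (-e) := by
      intro e v hv
      rw [norm_smul, Real.norm_of_nonneg (by positivity)] at hv
      rw [Real.rpow_neg ht0.le, ← div_eq_mul_inv, le_div_iff₀ (by positivity), mul_comm]
      exact hv
    refine ⟨e _ _ ((norm_fst_le _).trans h), fun i => e _ _ ?_⟩
    exact (norm_le_pi_norm (weightedJet T b G (⟨t, ht⟩, x)).2 i).trans ((norm_snd_le _).trans h)
  have hcongr : ∀ t ∈ Ioc 0 T, duhamel F t = duhamel (increment P Q R A B) t := fun t ht =>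
    duhamel_congr ht.1 fun s hs => hFinc s ⟨hs.1, hs.2.trans ht.2⟩
  refine ⟨B, hBjet, hnorm fun p => ?_, fun t ht => ?_, fun t ht => ?_⟩
  · rw [← hWB]
    exact (W.norm_coe_le_norm p).trans (hSn W hWS)
  · rw [← hcongr t ht]
    refine (hnorm (G := duhamel F) fun p => ?_) t ht
    exact ((𝒟 (N W)).norm_coe_le_norm p).trans (hDN0 W (hSn W hWS))
  · rw [← hcongr t ht]

/-- Lipschitz dependence of solutions of the remainder equation on the data. -/
theorem jetBound_remainder_sub {T γ b M D D' : ℝ} (hT : T ≤ 1) (hb : 0 ≤ b) (hbγ : b ≤ γ)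
    (hγ : γ < 1 / 2) (hγb : γ + b < 1 / 2) (hM : 0 ≤ M) (hD : 0 ≤ D) (hD' : 0 ≤ D')
    {A A' B B' : ℝ → Euc d → V}
    (hA : JetCont (Ioc 0 T) A) (hA' : JetCont (Ioc 0 T) A') (hB : JetCont (Ioc 0 T) B)
    (hB' : JetCont (Ioc 0 T) B') (nA : JetBound T γ M A) (nA' : JetBound T γ M A')
    (nB : JetBound T b M B) (nB' : JetBound T b M B') (nAA : JetBound T γ D (A - A'))
    (nBB : JetBound T b D' (B - B')) :
    JetBound T b (duhamelConst d (1 / 2 + γ + b) * T ^ (1 / 2 - γ) *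
      (nonlinConst P Q R * (1 + M) ^ 2 * (D + D')))
      (duhamel (increment P Q R A B) - duhamel (increment P Q R A' B')) := by
  have hk := nonlinConst_nonneg P Q R
  have h := jetBound_duhamel (isSource_increment_sub P Q R hT hbγ hγ.le hM hD hD' hA hA' hB hB'
    nA nA' nB nB' nAA nBB) (b := b) (by linarith) (by linarith) (by linarith) (by positivity)
  rw [show 1 + b - (1 / 2 + γ + b) = 1 / 2 - γ by ring] at h
  intro t ht
  have e := duhamel_sub (isSource_increment P Q R hT hbγ hγ.le hM hM le_rfl hA hB nA nB)
    (isSource_increment P Q R hT hbγ hγ.le hM hM le_rfl hA' hB' nA' nB') (by linarith) ht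
  rw [Pi.sub_apply, ← e]
  exact h t ht

end Remainder

/-! ### Spatial regularity by differentiation along translations -/

/-- Differentiable dependence on a parameter of solutions `w` of `w - K w = S`, for `K` a
contraction of class `C ^ 1`. -/
lemma exists_hasFDerivAt_of_sub_eq {E F : Type*} [NormedAddCommGroup E] [NormedSpace ℝ E]
    [NormedAddCommGroup F] [NormedSpace ℝ F] [CompleteSpace F] {K : F → F} {S w : E → F} {M : ℝ}
    (hK : ContDiff ℝ 1 K)
    (hlip : ∀ W W' : F, ‖W‖ ≤ M + 1 → ‖W'‖ ≤ M + 1 → ‖K W - K W'‖ ≤ 1 / 2 * ‖W - W'‖)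
    (hw : ∀ h, ‖w h‖ ≤ M) (heq : ∀ h, w h - K (w h) = S h) {S' : E →L[ℝ] F} {h₀ : E}
    (hS : HasFDerivAt S S' h₀) : ∃ w' : E →L[ℝ] F, HasFDerivAt w w' h₀ := by
  have hstrict := (hK.contDiffAt (x := w h₀)).hasStrictFDerivAt one_ne_zero
  set K' := fderiv ℝ K (w h₀) with hK'
  -- `1 - K'` is invertible by a Neumann series, so that `1 - K` is locally invertible at `w h₀`
  have hK'n : ‖K'‖ ≤ ((1 / 2 : ℝ≥0) : ℝ) := by
    refine hstrict.hasFDerivAt.le_of_lipschitzOn (s := Metric.ball (w h₀) 1)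
      (Metric.ball_mem_nhds _ one_pos) (LipschitzOnWith.of_dist_le_mul fun W hW W' hW' => ?_)
    have hb : ∀ W ∈ Metric.ball (w h₀) 1, ‖W‖ ≤ M + 1 := fun W hW => by
      have h1 := norm_add_le (W - w h₀) (w h₀)
      rw [sub_add_cancel] at h1
      have h2 := hw h₀
      rw [mem_ball_iff_norm] at hW
      linarith
    rw [dist_eq_norm, dist_eq_norm]
    simpa using hlip W W' (hb W hW) (hb W' hW')
  have hK'1 : ‖K'‖ < 1 := hK'n.trans_lt (by norm_num)
  set Φ : F ≃L[ℝ] F := ContinuousLinearEquiv.unitsEquiv ℝ F (Units.oneSub K' hK'1) with hΦ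
  have hΦ' : (Φ : F →L[ℝ] F) = ContinuousLinearMap.id ℝ F - K' := by
    ext v
    simp [hΦ]
  have hfd : HasStrictFDerivAt (fun W => W - K W) (Φ : F →L[ℝ] F) (w h₀) := by
    rw [hΦ']
    exact (hasStrictFDerivAt_id (w h₀)).sub hstrict
  -- continuity of `w` puts `w h` in the domain of the local inverse
  have hwc : Tendsto w (𝓝 h₀) (𝓝 (w h₀)) := by
    rw [tendsto_iff_norm_sub_tendsto_zero]
    have h1 : Tendsto (fun h => 2 * ‖S h - S h₀‖) (𝓝 h₀) (𝓝 0) := by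
      simpa using (tendsto_iff_norm_sub_tendsto_zero.1 hS.continuousAt.tendsto).const_mul 2
    refine squeeze_zero (fun _ => norm_nonneg _) (fun h => ?_) h1
    have h2 := hlip (w h) (w h₀) ((hw h).trans (by linarith)) ((hw h₀).trans (by linarith))
    have h3 : w h - w h₀ = (S h - S h₀) + (K (w h) - K (w h₀)) := by
      rw [← heq h, ← heq h₀]; abel
    have h4 : ‖w h - w h₀‖ ≤ ‖S h - S h₀‖ + ‖K (w h) - K (w h₀)‖ := by
      conv_lhs => rw [h3]
      exact norm_add_le _ _
    linarith
  have h5 : ∀ᶠ h in 𝓝 h₀, w h = hfd.localInverse _ _ _ (S h) := by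
    filter_upwards [hwc.eventually hfd.eventually_left_inverse] with h hh
    rw [← heq h]
    exact hh.symm
  have h6 := hfd.to_localInverse.hasFDerivAt
  rw [heq h₀] at h6
  exact ⟨_, (h6.comp h₀ hS).congr_of_eventuallyEq h5⟩

section Lift

variable {α X Y Z : Type*} [TopologicalSpace α] [NormedAddCommGroup X] [NormedSpace ℝ X]
  [NormedAddCommGroup Y] [NormedSpace ℝ Y] [NormedAddCommGroup Z] [NormedSpace ℝ Z]

/-- The pointwise application of a continuous bilinear map to bounded continuous functions. -/
noncomputable def bcfBilin (α : Type*) [TopologicalSpace α] (P : X →L[ℝ] Y →L[ℝ] Z) :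
    BoundedContinuousFunction α X →L[ℝ] BoundedContinuousFunction α Y →L[ℝ]
      BoundedContinuousFunction α Z :=
  LinearMap.mkContinuous₂
    (LinearMap.mk₂ ℝ (fun f g => BoundedContinuousFunction.ofNormedAddCommGroup
        (fun a => P (f a) (g a)) (by fun_prop) (‖P‖ * ‖f‖ * ‖g‖) fun a =>
          (P.le_opNorm₂ _ _).trans (by
            gcongr
            · exact f.norm_coe_le_norm a
            · exact g.norm_coe_le_norm a))
      (fun f f' g => by ext; simp) (fun c f g => by ext; simp) (fun f g g' => by ext; simp)
      (fun c f g => by ext; simp))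
    ‖P‖ fun f g => by
      rw [LinearMap.mk₂_apply]
      exact BoundedContinuousFunction.norm_ofNormedAddCommGroup_le _ (by positivity) _

lemma bcfBilin_apply (P : X →L[ℝ] Y →L[ℝ] Z) (f : BoundedContinuousFunction α X)
    (g : BoundedContinuousFunction α Y) (a : α) : bcfBilin α P f g a = P (f a) (g a) := rfl

lemma norm_bcfBilin_le (P : X →L[ℝ] Y →L[ℝ] Z) : ‖bcfBilin α P‖ ≤ ‖P‖ :=
  LinearMap.mkContinuous₂_norm_le _ (norm_nonneg P) _

end Lift

section LocalRegularity

variable {d : ℕ} {V : Type*} [NormedAddCommGroup V] [NormedSpace ℝ V]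

/-- Spatial translation of a path. -/
noncomputable def shiftPath {T : ℝ} {E : Type*} [NormedAddCommGroup E] (h : Euc d)
    (W : PathSpace T d E) : PathSpace T d E :=
  W.compContinuous ⟨fun p => (p.1, p.2 + h), by fun_prop⟩

lemma shiftPath_apply {T : ℝ} {E : Type*} [NormedAddCommGroup E] (h : Euc d)
    (W : PathSpace T d E) (p : Ioc (0 : ℝ) T × Euc d) : shiftPath h W p = W (p.1, p.2 + h) := rfl

lemma norm_shiftPath_le {T : ℝ} {E : Type*} [NormedAddCommGroup E] (h : Euc d)
    (W : PathSpace T d E) : ‖shiftPath h W‖ ≤ ‖W‖ :=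
  (BoundedContinuousFunction.norm_le (norm_nonneg _)).2 fun _ => W.norm_coe_le_norm _

/-- Spatial translation of a bounded continuous function. -/
noncomputable def shiftFun (h : Euc d) (f : BoundedContinuousFunction (Euc d) V) :
    BoundedContinuousFunction (Euc d) V :=
  f.compContinuous ⟨fun x => x + h, by fun_prop⟩

lemma shiftFun_apply (h : Euc d) (f : BoundedContinuousFunction (Euc d) V) (x : Euc d) :
    shiftFun h f x = f (x + h) := rfl

lemma pd_comp_add_right (f : Euc d → V) (h x : Euc d) (i : Fin d) :
    pd i (fun y => f (y + h)) x = pd i f (x + h) := by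
  rw [pd, fderiv_comp_add_right]; rfl

lemma weightedJet_shift (T b : ℝ) (B : ℝ → Euc d → V) (p : Ioc (0 : ℝ) T × Euc d) (h : Euc d) :
    weightedJet T b (fun s y => B s (y + h)) p = weightedJet T b B (p.1, p.2 + h) := by
  simp only [weightedJet, pd_comp_add_right]

/-- Continuity of the translations in `C ^ 1` makes them differentiable in `C ^ 0`. -/
lemma hasFDerivAt_shiftFun (f : BoundedContinuousFunction (Euc d) V) (hf : IsC1 f) :
    ∃ L : Euc d →L[ℝ] BoundedContinuousFunction (Euc d) V,
      HasFDerivAt (fun h => shiftFun h f) L 0 := by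
  have hper := isTorusFun_fderiv hf.1
  have hcf : Continuous (fderiv ℝ f) := hf.2.continuous_fderiv one_ne_zero
  choose C hC using fun i => (hf.1.pd i).exists_bound (hf.continuous_pd i)
  set g : Fin d → BoundedContinuousFunction (Euc d) V := fun i =>
    BoundedContinuousFunction.ofNormedAddCommGroup (pd i f) (hf.continuous_pd i) (C i) (hC i)
  set L : Euc d →L[ℝ] BoundedContinuousFunction (Euc d) V :=
    ∑ i, (EuclideanSpace.proj i).smulRight (g i) with hL
  have hLx : ∀ h x, L h x = fderiv ℝ f x h := fun h x => by
    rw [fderiv_apply_eq_sum_pd, hL]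
    simp [g]
  refine ⟨L, (hasFDerivAt_iff_isLittleO_nhds_zero).2 (Asymptotics.isLittleO_iff.2 fun ε hε => ?_)⟩
  have hu := isCompact_unitCube.uniformContinuousAt_of_continuousAt (fderiv ℝ f)
    (fun x _ => hcf.continuousAt) (Metric.dist_mem_uniformity hε) (s := unitCube d)
  obtain ⟨η, hη, hηs⟩ := Metric.mem_uniformity_dist.1 hu
  filter_upwards [Metric.ball_mem_nhds (0 : Euc d) hη] with h hh
  rw [zero_add]
  refine (BoundedContinuousFunction.norm_le (by positivity)).2 fun x => ?_
  rw [BoundedContinuousFunction.coe_sub, BoundedContinuousFunction.coe_sub, Pi.sub_apply,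
    Pi.sub_apply, hLx, shiftFun_apply, shiftFun_apply, add_zero]
  have h1 := (convex_ball (cubeRep x) η).norm_image_sub_le_of_norm_fderiv_le' (𝕜 := ℝ) (f := f)
    (φ := fderiv ℝ f (cubeRep x)) (C := ε) (x := cubeRep x) (y := cubeRep x + h)
    (fun y _ => hf.differentiable y) (fun y hy => ?_) (Metric.mem_ball_self hη)
    (by simpa using hh)
  · have e : f (cubeRep x + h) = f (x + h) := by
      have hp : IsTorusFun fun y => f (y + h) := fun i y => by
        simp only [add_right_comm _ _ h, hf.1 i]
      exact hp.apply_cubeRep x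
    rwa [e, hf.1.apply_cubeRep, add_sub_cancel_left, hper.apply_cubeRep] at h1
  · have := hηs (a := cubeRep x) (b := y) (by rw [dist_comm]; exact hy) (cubeRep_mem x)
    rw [← dist_eq_norm, dist_comm]
    exact le_of_lt this

variable [CompleteSpace V]

lemma jetBound_heat {f : Euc d → V} (hf : Continuous f) {C : ℝ} (hC : ∀ x, ‖f x‖ ≤ C) (T : ℝ) :
    JetBound T 0 ((1 + heatConst d) * C) (fun s => heat s f) := by
  intro t ht x
  have hc := heatConst_nonneg (d := d)
  have hC0 : 0 ≤ C := (norm_nonneg _).trans (hC 0)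
  have ht0 := ht.1
  have h1 : C ≤ (1 + heatConst d) * C := le_mul_of_one_le_left hC0 (by linarith)
  refine ⟨?_, fun i => (norm_pd_heat_le hf hC ht.1 i x).trans ?_⟩
  · simpa using (norm_heat_le hC t x).trans h1
  · rw [add_zero]
    gcongr
    linarith

/-- The heat semigroup, as an operator from initial values to weighted jets. -/
noncomputable def heatOp (T : ℝ) (d : ℕ) (V : Type*) [NormedAddCommGroup V] [NormedSpace ℝ V]
    [CompleteSpace V] : BoundedContinuousFunction (Euc d) V →L[ℝ] PathSpace T d (Jet d V) :=
  LinearMap.mkContinuous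
    { toFun := fun f => BoundedContinuousFunction.ofNormedAddCommGroup
        (weightedJet T 0 fun s => heat s f)
        (continuous_weightedJet
          (continuousOn_heat (P := ℝ × Euc d) (f := fun _ => f) (c := fun _ => ‖f‖)
            (r := fun p => p.1) (x := fun p => p.2) (by fun_prop) (by fun_prop)
            (fun _ _ => f.norm_coe_le_norm) (by fun_prop) (by fun_prop))
          fun i => (continuousOn_pd_heat (P := ℝ × Euc d) (f := fun _ => f) (c := fun _ => ‖f‖)
            (r := fun p => p.1) (x := fun p => p.2) (by fun_prop) (by fun_prop)
            (fun _ _ => f.norm_coe_le_norm) (by fun_prop) (fun p hp => hp.1.1) (by fun_prop) i))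
        ((1 + heatConst d) * ‖f‖) fun p => by
          have := heatConst_nonneg (d := d)
          exact (jetBound_heat f.continuous f.norm_coe_le_norm T).norm_weightedJet_le
            (by positivity) p
      map_add' := fun f g => by
        ext p : 1
        have e := heat_add_fun f.continuous f.norm_coe_le_norm g.continuous g.norm_coe_le_norm
        simp only [BoundedContinuousFunction.coe_ofNormedAddCommGroup, weightedJet,
          BoundedContinuousFunction.coe_add, e, Pi.add_apply, smul_add, Prod.mk_add_mk,
          Prod.mk.injEq, true_and]
        ext i : 1
        rw [pd_add (differentiable_heat f.continuous f.norm_coe_le_norm p.1.2.1 _)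
          (differentiable_heat g.continuous g.norm_coe_le_norm p.1.2.1 _), smul_add]
        rfl
      map_smul' := fun c f => by
        ext p : 1
        simp only [BoundedContinuousFunction.coe_ofNormedAddCommGroup, weightedJet,
          BoundedContinuousFunction.coe_smul]
        have e := fun t => heat_smul_fun c (f : Euc d → V) t
        have e' : (fun x => c • f x) = c • (f : Euc d → V) := rfl
        simp only [e', e, pd_const_smul, Pi.smul_apply, RingHom.id_apply, Prod.smul_mk,
          Prod.mk.injEq, smul_comm c, true_and]
        ext i : 1
        simp [smul_comm c] }
    (1 + heatConst d) fun f => by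
      have := heatConst_nonneg (d := d)
      exact (BoundedContinuousFunction.norm_le (by positivity)).2 fun p =>
        (jetBound_heat f.continuous f.norm_coe_le_norm T).norm_weightedJet_le (by positivity) p

lemma heatOp_apply (T : ℝ) (f : BoundedContinuousFunction (Euc d) V)
    (p : Ioc (0 : ℝ) T × Euc d) : heatOp T d V f p = weightedJet T 0 (fun s => heat s f) p := rfl

lemma heatOp_shiftFun (T : ℝ) (h : Euc d) (f : BoundedContinuousFunction (Euc d) V) :
    heatOp T d V (shiftFun h f) = shiftPath h (heatOp T d V f) := by
  ext p : 1
  rw [shiftPath_apply, heatOp_apply, heatOp_apply, ← weightedJet_shift]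
  congr 1
  ext s x
  exact heat_comp_add_right f s h x

lemma duhamelOp_shiftPath {T a b : ℝ} (ha0 : 0 ≤ a) (ha : a < 1) (hab : a ≤ 1 + b) (h : Euc d)
    (F : PathSpace T d V) : duhamelOp d V ha0 ha hab (shiftPath h F) =
      shiftPath h (duhamelOp d V ha0 ha hab F) := by
  ext p : 1
  rw [shiftPath_apply, duhamelOp_apply, duhamelOp_apply, ← weightedJet_shift]
  congr 1
  ext s x
  have : ∀ r, pathSource T a (shiftPath h F) r = fun y => pathSource T a F r (y + h) := fun r => by
    ext y
    by_cases hr : r ∈ Ioc 0 T <;> simp [pathSource, hr, shiftPath_apply]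
  simp only [duhamel, this, heat_comp_add_right]

end LocalRegularity

section SpatialRegularity

variable {d : ℕ} {V : Type*} [NormedAddCommGroup V] [NormedSpace ℝ V] [CompleteSpace V]
variable (P Q : V →L[ℝ] (Fin d → V) →L[ℝ] V) (R : V →L[ℝ] V →L[ℝ] (Fin d → V))

/-- The value component of a path of jets. -/
noncomputable def pathFst (T : ℝ) (d : ℕ) (V : Type*) [NormedAddCommGroup V] [NormedSpace ℝ V] :
    PathSpace T d (Jet d V) →L[ℝ] PathSpace T d V :=
  (ContinuousLinearMap.fst ℝ V (Fin d → V)).compLeftContinuousBounded _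

/-- The derivative component of a path of jets. -/
noncomputable def pathSnd (T : ℝ) (d : ℕ) (V : Type*) [NormedAddCommGroup V] [NormedSpace ℝ V] :
    PathSpace T d (Jet d V) →L[ℝ] PathSpace T d (Fin d → V) :=
  (ContinuousLinearMap.snd ℝ V (Fin d → V)).compLeftContinuousBounded _

lemma pathFst_apply {T : ℝ} (W : PathSpace T d (Jet d V)) (p : Ioc (0 : ℝ) T × Euc d) :
    pathFst T d V W p = (W p).1 := rfl

lemma pathSnd_apply {T : ℝ} (W : PathSpace T d (Jet d V)) (p : Ioc (0 : ℝ) T × Euc d) :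
    pathSnd T d V W p = (W p).2 := rfl

lemma norm_pathFst_le {T : ℝ} (W : PathSpace T d (Jet d V)) : ‖pathFst T d V W‖ ≤ ‖W‖ :=
  (BoundedContinuousFunction.norm_le (norm_nonneg _)).2 fun p =>
    (norm_fst_le (W p)).trans (W.norm_coe_le_norm p)

lemma norm_pathSnd_le {T : ℝ} (W : PathSpace T d (Jet d V)) : ‖pathSnd T d V W‖ ≤ ‖W‖ :=
  (BoundedContinuousFunction.norm_le (norm_nonneg _)).2 fun p =>
    (norm_snd_le (W p)).trans (W.norm_coe_le_norm p)

/-- The map from weighted jets of `u` to weighted jets of the Duhamel integral of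
`P(u, ∂u) + Q(u, R(u, u))`. The two terms of the source have singularities
`s ^ {-1/2}` and `s ^ 0`. -/
noncomputable def mildMap (T : ℝ) (W : PathSpace T d (Jet d V)) : PathSpace T d (Jet d V) :=
  duhamelOp d V (a := 1 / 2) (b := 0) (by norm_num) (by norm_num) (by norm_num)
      (bcfBilin _ P (pathFst T d V W) (pathSnd T d V W)) +
    duhamelOp d V (a := 0) (b := 0) le_rfl (by norm_num) (by norm_num)
      (bcfBilin _ Q (pathFst T d V W) (bcfBilin _ R (pathFst T d V W) (pathFst T d V W)))

lemma contDiff_mildMap (T : ℝ) : ContDiff ℝ 1 (mildMap P Q R T) := by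
  unfold mildMap
  fun_prop

lemma mildMap_shiftPath {T : ℝ} (h : Euc d) (W : PathSpace T d (Jet d V)) :
    mildMap P Q R T (shiftPath h W) = shiftPath h (mildMap P Q R T W) := by
  have e1 : bcfBilin _ P (pathFst T d V (shiftPath h W)) (pathSnd T d V (shiftPath h W)) =
      shiftPath h (bcfBilin _ P (pathFst T d V W) (pathSnd T d V W)) := rfl
  have e2 : bcfBilin _ Q (pathFst T d V (shiftPath h W)) (bcfBilin _ R
      (pathFst T d V (shiftPath h W)) (pathFst T d V (shiftPath h W))) =
      shiftPath h (bcfBilin _ Q (pathFst T d V W)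
        (bcfBilin _ R (pathFst T d V W) (pathFst T d V W))) := rfl
  rw [mildMap, e1, e2, duhamelOp_shiftPath, duhamelOp_shiftPath]
  rfl

/-- The Lipschitz constant of `mildMap` on a ball of radius `M`, up to a power of the time. -/
noncomputable def mildConst (M : ℝ) : ℝ :=
  duhamelConst d (1 / 2) * (‖P‖ * (2 * M)) + duhamelConst d 0 * (‖Q‖ * ‖R‖ * (3 * M ^ 2))

lemma norm_mildMap_sub_le {T M : ℝ} (hT0 : 0 < T) (hT : T ≤ 1) (hM : 0 ≤ M)
    {W W' : PathSpace T d (Jet d V)} (hW : ‖W‖ ≤ M) (hW' : ‖W'‖ ≤ M) :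
    ‖mildMap P Q R T W - mildMap P Q R T W'‖ ≤
      mildConst P Q R M * T ^ (1 / 2 : ℝ) * ‖W - W'‖ := by
  set D := ‖W - W'‖ with hD
  have hD0 : 0 ≤ D := norm_nonneg _
  have f1 := (norm_pathFst_le W).trans hW
  have f1' := (norm_pathFst_le W').trans hW'
  have f2 := (norm_pathSnd_le W).trans hW
  have g1 : ‖pathFst T d V W - pathFst T d V W'‖ ≤ D := by
    rw [← map_sub]; exact norm_pathFst_le _
  have g2 : ‖pathSnd T d V W - pathSnd T d V W'‖ ≤ D := by
    rw [← map_sub]; exact norm_pathSnd_le _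
  have hP := norm_bcfBilin_le (α := Ioc (0 : ℝ) T × Euc d) P
  have hQ := norm_bcfBilin_le (α := Ioc (0 : ℝ) T × Euc d) Q
  have hR := norm_bcfBilin_le (α := Ioc (0 : ℝ) T × Euc d) R
  have k1 := duhamelConst_nonneg (d := d) (a := 1 / 2) (by norm_num)
  have k2 := duhamelConst_nonneg (d := d) (a := 0) (by norm_num)
  have b1 : ‖bcfBilin _ P (pathFst T d V W) (pathSnd T d V W) -
      bcfBilin _ P (pathFst T d V W') (pathSnd T d V W')‖ ≤ ‖P‖ * (D * M + M * D) :=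
    (norm_bilin_sub_le _ _ _ _ _).trans (by gcongr)
  have b2 : ‖bcfBilin _ Q (pathFst T d V W) (bcfBilin _ R (pathFst T d V W) (pathFst T d V W)) -
      bcfBilin _ Q (pathFst T d V W') (bcfBilin _ R (pathFst T d V W') (pathFst T d V W'))‖ ≤
      ‖Q‖ * ‖R‖ * (D * M * M + M * D * M + M * M * D) :=
    (norm_trilin_sub_le _ _ _ _ _ _ _ _).trans (by gcongr)
  have n1 := norm_duhamelOp_le (d := d) (V := V) (a := 1 / 2) (b := 0) hT0 (by norm_num)
    (by norm_num) (by norm_num)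
  have n2 := norm_duhamelOp_le (d := d) (V := V) (a := 0) (b := 0) hT0 le_rfl
    (by norm_num) (by norm_num)
  have hTT : T ^ ((1 : ℝ) + 0 - 0) ≤ T ^ (1 / 2 : ℝ) :=
    Real.rpow_le_rpow_of_exponent_ge hT0 hT (by norm_num)
  rw [show (1 : ℝ) + 0 - 1 / 2 = 1 / 2 by norm_num] at n1
  rw [mildMap, mildMap, add_sub_add_comm, ← map_sub, ← map_sub]
  calc _ ≤ duhamelConst d (1 / 2) * T ^ (1 / 2 : ℝ) * (‖P‖ * (D * M + M * D)) +
        duhamelConst d 0 * T ^ (1 / 2 : ℝ) * (‖Q‖ * ‖R‖ * (D * M * M + M * D * M + M * M * D)) := by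
        refine (norm_add_le _ _).trans (add_le_add ?_ ?_)
        · refine (ContinuousLinearMap.le_opNorm _ _).trans ?_
          gcongr
        · refine (ContinuousLinearMap.le_opNorm _ _).trans ?_
          gcongr
          exact n2.trans (by gcongr)
    _ = _ := by unfold mildConst; ring

lemma mildMap_apply {T : ℝ} {u : ℝ → Euc d → V} {W : PathSpace T d (Jet d V)}
    (hW : ∀ p, W p = weightedJet T 0 u p) (p : Ioc (0 : ℝ) T × Euc d) :
    mildMap P Q R T W p = weightedJet T 0 (duhamel fun s => funNonlin P Q R (u s)) p := by
  set F₁ := bcfBilin _ P (pathFst T d V W) (pathSnd T d V W) with hF₁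
  set F₂ := bcfBilin _ Q (pathFst T d V W) (bcfBilin _ R (pathFst T d V W) (pathFst T d V W))
    with hF₂
  have s1 := isSource_pathSource (a := 1 / 2) F₁
  have s2 := isSource_pathSource (a := 0) F₂
  have e1 : ∀ s ∈ Ioc 0 T, funNonlin P Q R (u s) =
      (pathSource T (1 / 2) F₁ + pathSource T 0 F₂) s := by
    intro s hs
    ext x
    have hs0 : s ^ (-(1 / 2) : ℝ) * s ^ (1 / 2 : ℝ) = 1 := by
      rw [← Real.rpow_add hs.1]; simp
    have h1 := pathSource_apply (a := 1 / 2) F₁ ⟨s, hs⟩ x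
    have h2 := pathSource_apply (a := 0) F₂ ⟨s, hs⟩ x
    have e3 : (fun i => s ^ (1 / 2 : ℝ) • pd i (u s) x) =
        s ^ (1 / 2 : ℝ) • fun i => pd i (u s) x := rfl
    simp only [hF₁, hF₂, bcfBilin_apply, pathFst_apply, pathSnd_apply, hW, weightedJet, neg_zero,
      Real.rpow_zero, one_smul, add_zero] at h1 h2
    rw [e3, map_smul, smul_smul, hs0, one_smul] at h1
    rw [Pi.add_apply, Pi.add_apply, h1, h2]
    rfl
  have e2 : ∀ t ∈ Ioc 0 T, duhamel (fun s => funNonlin P Q R (u s)) t =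
      duhamel (pathSource T (1 / 2) F₁) t + duhamel (pathSource T 0 F₂) t := fun t ht => by
    rw [← duhamel_add s1 s2 (by norm_num) (by norm_num) ht]
    exact duhamel_congr ht.1 fun s hs => e1 s ⟨hs.1, hs.2.trans ht.2⟩
  rw [mildMap, BoundedContinuousFunction.coe_add, Pi.add_apply, duhamelOp_apply, duhamelOp_apply]
  simp only [weightedJet, e2 p.1 p.1.2, Pi.add_apply, smul_add, Prod.mk_add_mk, Prod.mk.injEq]
  refine ⟨rfl, ?_⟩
  ext i : 1
  rw [pd_add (differentiable_duhamel s1 (by norm_num) (by norm_num) (norm_nonneg _) p.1.2 _)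
    (differentiable_duhamel s2 le_rfl (by norm_num) (norm_nonneg _) p.1.2 _), smul_add]
  rfl

/-- A solution of the mild equation on a short time interval has one more spatial derivative: the
weighted jet of a translate of `u` is the solution of a fixed point equation whose initial value is
differentiable in the translation. -/
lemma jetCont_pd_of_mild {T M : ℝ} (hT0 : 0 < T) (hT : T ≤ 1) (hM : 0 ≤ M) {u₀ : Euc d → V}
    {u : ℝ → Euc d → V} (hu₀ : IsC1 u₀) (hu : JetCont (Ioc 0 T) u) (nu : JetBound T 0 M u)
    (hsmall : mildConst P Q R (M + 1) * T ^ (1 / 2 : ℝ) ≤ 1 / 2)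
    (heq : ∀ t ∈ Ioc 0 T, u t = heat t u₀ + duhamel (fun s => funNonlin P Q R (u s)) t)
    (i : Fin d) : JetCont (Ioc 0 T) fun s => pd i (u s) := by
  obtain ⟨C, hC⟩ := hu₀.1.exists_bound hu₀.2.continuous
  set f₀ : BoundedContinuousFunction (Euc d) V :=
    BoundedContinuousFunction.ofNormedAddCommGroup u₀ hu₀.2.continuous C hC with hf₀
  set W : PathSpace T d (Jet d V) := BoundedContinuousFunction.ofNormedAddCommGroup
    (weightedJet T 0 u) (continuous_weightedJet hu.cont hu.cont_pd) M
    (nu.norm_weightedJet_le hM) with hW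
  have hWM : ‖W‖ ≤ M := (BoundedContinuousFunction.norm_le hM).2 (nu.norm_weightedJet_le hM)
  -- the mild equation, and that for the translates, as identities between weighted jets
  have hfix : W - mildMap P Q R T W = heatOp T d V f₀ := by
    rw [sub_eq_iff_eq_add]
    ext p : 1
    have hdiff : Differentiable ℝ (duhamel (fun s => funNonlin P Q R (u s)) p.1) := by
      have e : duhamel (fun s => funNonlin P Q R (u s)) p.1 = u p.1 - heat p.1 u₀ := by
        rw [heq p.1 p.1.2]; simp
      rw [e]
      exact (hu.isC1 p.1 p.1.2).differentiable.sub
        (differentiable_heat hu₀.2.continuous hC p.1.2.1)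
    rw [BoundedContinuousFunction.coe_add, Pi.add_apply,
      mildMap_apply P Q R (u := u) (W := W) (fun _ => rfl), heatOp_apply]
    change weightedJet T 0 u p = _
    simp only [weightedJet, heq p.1 p.1.2, Pi.add_apply, smul_add, Prod.mk_add_mk, Prod.mk.injEq]
    refine ⟨rfl, ?_⟩
    ext i : 1
    rw [pd_add (differentiable_heat hu₀.2.continuous hC p.1.2.1 _) (hdiff _), smul_add]
    rfl
  obtain ⟨L, hL⟩ := hasFDerivAt_shiftFun f₀ hu₀
  obtain ⟨G, hG⟩ := exists_hasFDerivAt_of_sub_eq (M := M) (w := fun h => shiftPath h W)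
    (S := fun h => heatOp T d V (shiftFun h f₀)) (contDiff_mildMap P Q R T)
    (fun W W' hW hW' => (norm_mildMap_sub_le P Q R hT0 hT (by linarith) hW hW').trans (by gcongr))
    (fun h => (norm_shiftPath_le h W).trans hWM)
    (fun h => by
      rw [mildMap_shiftPath, heatOp_shiftFun, ← hfix]
      rfl)
    ((heatOp T d V).hasFDerivAt.comp 0 hL)
  -- the derivative of `pd j (u s)` in terms of `G`
  have hpd : ∀ (s : Ioc 0 T) (x : Euc d), HasFDerivAt (pd i (u s))
      ((s : ℝ) ^ (-(1 / 2) : ℝ) • ((ContinuousLinearMap.proj i).comp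
        ((ContinuousLinearMap.snd ℝ V (Fin d → V)).comp
          ((BoundedContinuousFunction.evalCLM ℝ (s, x)).comp G)))) x := by
    intro s x
    have h1 := ((ContinuousLinearMap.proj (R := ℝ) (φ := fun _ : Fin d => V) i).comp
      ((ContinuousLinearMap.snd ℝ V (Fin d → V)).comp
        (BoundedContinuousFunction.evalCLM ℝ (s, x)))).hasFDerivAt.comp (0 : Euc d) hG
    have h2 := h1.const_smul ((s : ℝ) ^ (-(1 / 2) : ℝ))
    have h3 : HasFDerivAt (fun h => pd i (u s) (x + h))
        ((s : ℝ) ^ (-(1 / 2) : ℝ) • ((ContinuousLinearMap.proj i).comp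
        ((ContinuousLinearMap.snd ℝ V (Fin d → V)).comp
          ((BoundedContinuousFunction.evalCLM ℝ (s, x)).comp G)))) 0 := by
      refine h2.congr_of_eventuallyEq (Eventually.of_forall fun h => ?_)
      change pd i (u s) (x + h) = (s : ℝ) ^ (-(1 / 2) : ℝ) • ((s : ℝ) ^ (1 / 2 + 0 : ℝ) •
        pd i (u s) (x + h))
      rw [smul_smul, ← Real.rpow_add s.2.1]
      simp
    have h4 := (hasFDerivAt_comp_add_left (f := pd i (u s)) (x := (0 : Euc d)) x).1 h3
    rwa [add_zero] at h4
  have hcont : ∀ j, ContinuousOn (fun p : ℝ × Euc d => pd j (pd i (u p.1)) p.2)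
      (Ioc 0 T ×ˢ univ) := fun j => by
    refine continuousOn_of_comp_subtype (G := fun s x => pd j (pd i (u s)) x) ?_
    have e : (fun p : Ioc 0 T × Euc d => pd j (pd i (u p.1)) p.2) = fun p =>
        (p.1 : ℝ) ^ (-(1 / 2) : ℝ) • (G (EuclideanSpace.single j 1) p).2 i := by
      ext p
      exact (hpd p.1 p.2).pd_eq j
    rw [e]
    exact (continuous_subtype_rpow T _).smul ((continuous_apply i).comp
      (continuous_snd.comp (G (EuclideanSpace.single j 1)).continuous))
  refine ⟨fun s hs => ⟨(hu.isC1 s hs).1.pd i, contDiff_one_of_pd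
    (fun x => (hpd ⟨s, hs⟩ x).differentiableAt) fun j => ?_⟩, hu.cont_pd i, hcont⟩
  rw [← continuousOn_univ]
  exact (hcont j).comp (f := fun y : Euc d => (s, y)) (by fun_prop) fun y _ => ⟨hs, mem_univ _⟩

end SpatialRegularity

/-! ### Prolongation of the equation to the jet -/

section Prolongation

variable {d : ℕ} {V : Type*} [NormedAddCommGroup V] [NormedSpace ℝ V]
variable (P Q : V →L[ℝ] (Fin d → V) →L[ℝ] V) (R : V →L[ℝ] V →L[ℝ] (Fin d → V))

/-- Composition of a continuous linear map with a continuous bilinear map. -/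
noncomputable def bilinPost {X Y Z Z' : Type*} [NormedAddCommGroup X] [NormedSpace ℝ X]
    [NormedAddCommGroup Y] [NormedSpace ℝ Y] [NormedAddCommGroup Z] [NormedSpace ℝ Z]
    [NormedAddCommGroup Z'] [NormedSpace ℝ Z'] (L : Z →L[ℝ] Z') (B : X →L[ℝ] Y →L[ℝ] Z) :
    X →L[ℝ] Y →L[ℝ] Z' :=
  (ContinuousLinearMap.compL ℝ Y Z Z' L).comp B

/-- The projection of a jet to the component of the `i`-th derivative. -/
noncomputable def jetProj (d : ℕ) (V : Type*) [NormedAddCommGroup V] [NormedSpace ℝ V] (i : Fin d) :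
    Jet d V →L[ℝ] V :=
  (ContinuousLinearMap.proj i).comp (ContinuousLinearMap.snd ℝ V (Fin d → V))

/-- The values of a family of jets. -/
noncomputable def jetValues (d : ℕ) (V : Type*) [NormedAddCommGroup V] [NormedSpace ℝ V] :
    (Fin d → Jet d V) →L[ℝ] (Fin d → V) :=
  ContinuousLinearMap.pi fun j => (ContinuousLinearMap.fst ℝ V (Fin d → V)).comp
    (ContinuousLinearMap.proj j)

/-- The bilinear map on jets encoding the product rule `∂ᵢ P(a, w) = P(∂ᵢ a, w) + P(a, ∂ᵢ w)`. In
the second argument, the values of the jets form `w`, and the derivatives in the `i`-th jet form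
`∂ᵢ w`; when that argument consists of the derivatives `∂ᵢ (a, ∂a)`, these are
`w = ∂a` and `∂ᵢ ∂a`. -/
noncomputable def prolong : Jet d V →L[ℝ] (Fin d → Jet d V) →L[ℝ] Jet d V :=
  bilinPost (ContinuousLinearMap.inl ℝ V (Fin d → V))
      (P.bilinearComp (ContinuousLinearMap.fst ℝ V (Fin d → V)) (jetValues d V)) +
    ∑ i, bilinPost ((ContinuousLinearMap.inr ℝ V (Fin d → V)).comp
        (ContinuousLinearMap.single ℝ (fun _ => V) i))
      (P.bilinearComp (jetProj d V i) (jetValues d V) +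
        P.bilinearComp (ContinuousLinearMap.fst ℝ V (Fin d → V))
          ((ContinuousLinearMap.snd ℝ V (Fin d → V)).comp (ContinuousLinearMap.proj i)))

lemma prolong_apply (U : Jet d V) (W : Fin d → Jet d V) :
    prolong P U W = (P U.1 (fun j => (W j).1),
      fun i => P (U.2 i) (fun j => (W j).1) + P U.1 (W i).2) := by
  have e : jetValues d V W = fun j => (W j).1 := rfl
  ext k
  · simp [prolong, bilinPost, e, Prod.fst_sum]
  · simp [prolong, bilinPost, e, jetProj, Prod.snd_sum, Finset.sum_apply, Pi.single_apply,
      Finset.sum_add_distrib]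

/-- The bilinear map on jets encoding the product rule `∂ᵢ R(a, b) = R(∂ᵢ a, b) + R(a, ∂ᵢ b)`, with
the same encoding of `R(a, b)` and `∂ᵢ R(a, b)` as in the second argument of `prolong`. -/
noncomputable def prolongPair : Jet d V →L[ℝ] Jet d V →L[ℝ] (Fin d → Jet d V) :=
  bilinPost (ContinuousLinearMap.pi fun j => (ContinuousLinearMap.inl ℝ V (Fin d → V)).comp
        (ContinuousLinearMap.proj j))
      (R.bilinearComp (ContinuousLinearMap.fst ℝ V (Fin d → V))
        (ContinuousLinearMap.fst ℝ V (Fin d → V))) +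
    ∑ i, bilinPost ((ContinuousLinearMap.single ℝ (fun _ => Jet d V) i).comp
        (ContinuousLinearMap.inr ℝ V (Fin d → V)))
      (R.bilinearComp (jetProj d V i) (ContinuousLinearMap.fst ℝ V (Fin d → V)) +
        R.bilinearComp (ContinuousLinearMap.fst ℝ V (Fin d → V)) (jetProj d V i))

lemma prolongPair_apply (U U' : Jet d V) : prolongPair R U U' =
    fun j => (R U.1 U'.1 j, R (U.2 j) U'.1 + R U.1 (U'.2 j)) := by
  ext j k
  · simp [prolongPair, bilinPost, Prod.fst_sum, Pi.single_apply, apply_ite Prod.fst]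
  · simp [prolongPair, bilinPost, jetProj, Pi.single_apply, Finset.sum_add_distrib]

lemma hasFDerivAt_jetAt {f : Euc d → V} (hf : Differentiable ℝ f)
    (hf' : ∀ i, Differentiable ℝ (pd i f)) (x : Euc d) : HasFDerivAt (jetAt f)
      ((fderiv ℝ f x).prod (ContinuousLinearMap.pi fun i => fderiv ℝ (pd i f) x)) x :=
  (hf x).hasFDerivAt.prodMk (hasFDerivAt_pi.2 fun i => (hf' i x).hasFDerivAt)

lemma pd_jetAt {f : Euc d → V} (hf : Differentiable ℝ f)
    (hf' : ∀ i, Differentiable ℝ (pd i f)) (j : Fin d) (x : Euc d) :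
    pd j (jetAt f) x = (pd j f x, fun i => pd j (pd i f) x) := by
  rw [(hasFDerivAt_jetAt hf hf' x).pd_eq]
  rfl

lemma isC1_jetAt {f : Euc d → V} (hf : IsC1 f) (hf' : ∀ i, IsC1 (pd i f)) : IsC1 (jetAt f) :=
  ⟨fun i x => by simp only [jetAt, hf.1 i x, fun j => hf.1.pd j i x],
    hf.2.prodMk (contDiff_pi.2 fun i => (hf' i).2)⟩

lemma pd_bilin {X Y Z : Type*} [NormedAddCommGroup X] [NormedSpace ℝ X]
    [NormedAddCommGroup Y] [NormedSpace ℝ Y] [NormedAddCommGroup Z] [NormedSpace ℝ Z]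
    (B : X →L[ℝ] Y →L[ℝ] Z) {f : Euc d → X} {g : Euc d → Y} {x : Euc d}
    (hf : DifferentiableAt ℝ f x) (hg : DifferentiableAt ℝ g x) (i : Fin d) :
    pd i (fun y => B (f y) (g y)) x = B (pd i f x) (g x) + B (f x) (pd i g x) := by
  rw [(B.hasFDerivAt_of_bilinear hf.hasFDerivAt hg.hasFDerivAt).pd_eq]
  simp [pd, add_comm]

lemma pd_pi {ι : Type*} [Fintype ι] {g : ι → Euc d → V} {x : Euc d}
    (hg : ∀ j, DifferentiableAt ℝ (g j) x) (i : Fin d) :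
    pd i (fun y j => g j y) x = fun j => pd i (g j) x := by
  rw [(hasFDerivAt_pi.2 fun j => (hg j).hasFDerivAt).pd_eq]
  rfl

/-- Differentiation of the nonlinearity: the jet of `P(f, ∂f) + Q(f, R(f, f))` is an expression of
the same kind in the jet of `f`. -/
lemma jetAt_funNonlin {f : Euc d → V} (hf : Differentiable ℝ f)
    (hf' : ∀ i, Differentiable ℝ (pd i f)) (x : Euc d) :
    jetAt (funNonlin P Q R f) x =
      funNonlin (prolong P) (prolong Q) (prolongPair R) (jetAt f) x := by
  have hdf : Differentiable ℝ fun y j => pd j f y := differentiable_pi.2 hf'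
  have hR : Differentiable ℝ fun y => R (f y) (f y) := by fun_prop
  have hpd : ∀ i, pd i (fun y j => pd j f y) x = fun j => pd i (pd j f) x := fun i =>
    pd_pi (fun j => hf' j x) i
  have e : funNonlin P Q R f = (fun y => P (f y) (fun j => pd j f y)) +
      fun y => Q (f y) (R (f y) (f y)) := rfl
  have h1 : Differentiable ℝ fun y => P (f y) (fun j => pd j f y) := by fun_prop
  have h2 : Differentiable ℝ fun y => Q (f y) (R (f y) (f y)) := by fun_prop
  simp only [funNonlin, jetNonlin, prolong_apply, prolongPair_apply, pd_jetAt hf hf']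
  refine Prod.ext rfl (funext fun i => ?_)
  change pd i (funNonlin P Q R f) x = _
  rw [e, pd_add (h1 x) (h2 x), pd_bilin P (hf x) (hdf x), pd_bilin Q (hf x) (hR x),
    pd_bilin R (hf x) (hf x), hpd]
  rfl

lemma contDiff_jetNonlin {n : ℕ∞} : ContDiff ℝ n (jetNonlin P Q R) := by
  unfold jetNonlin
  fun_prop

lemma isC1_funNonlin [CompleteSpace V] {f : Euc d → V} (hf : IsC1 f) (hf' : ∀ i, IsC1 (pd i f)) :
    IsC1 (funNonlin P Q R f) :=
  ⟨isTorusFun_funNonlin P Q R hf.1,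
    (contDiff_jetNonlin P Q R (n := 1)).comp (isC1_jetAt hf hf').2⟩

end Prolongation

section Mild

variable {d : ℕ} {V : Type*} [NormedAddCommGroup V] [NormedSpace ℝ V] [CompleteSpace V]
variable {P Q : V →L[ℝ] (Fin d → V) →L[ℝ] V} {R : V →L[ℝ] V →L[ℝ] (Fin d → V)}

lemma exists_bound_of_continuousOn {G : ℝ → Euc d → V} {a b : ℝ}
    (hper : ∀ s ∈ Icc a b, IsTorusFun (G s))
    (hG : ContinuousOn (fun p : ℝ × Euc d => G p.1 p.2) (Icc a b ×ˢ univ)) :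
    ∃ C, 0 ≤ C ∧ ∀ s ∈ Icc a b, ∀ x, ‖G s x‖ ≤ C := by
  obtain ⟨C, hC⟩ := (isCompact_Icc.prod (isCompact_unitCube (d := d))).exists_bound_of_continuousOn
    (hG.mono (prod_mono_right (subset_univ _)))
  refine ⟨max C 0, le_max_right _ _, fun s hs x => ?_⟩
  rw [← (hper s hs).apply_cubeRep x]
  exact (hC (s, cubeRep x) ⟨hs, cubeRep_mem x⟩).trans (le_max_left _ _)

lemma exists_isSource {G : ℝ → Euc d → V} {T t₀ t : ℝ} (ht₀ : 0 < t₀) (ht : t₀ + t < T)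
    (hper : ∀ s ∈ Ioo 0 T, IsTorusFun (G s))
    (hG : ContinuousOn (fun p : ℝ × Euc d => G p.1 p.2) (Ioo 0 T ×ˢ univ)) :
    ∃ C, 0 ≤ C ∧ IsSource t 0 C fun s => G (t₀ + s) := by
  have hsub : Icc t₀ (t₀ + t) ⊆ Ioo 0 T := fun s hs => ⟨ht₀.trans_le hs.1, hs.2.trans_lt ht⟩
  obtain ⟨C, hC0, hC⟩ := exists_bound_of_continuousOn (fun s hs => hper s (hsub hs))
    (hG.mono (prod_mono_left hsub))
  have hmem : ∀ s ∈ Ioc 0 t, t₀ + s ∈ Icc t₀ (t₀ + t) := fun s hs =>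
    ⟨by linarith [hs.1], by linarith [hs.2]⟩
  refine ⟨C, hC0, hG.comp (f := fun p : ℝ × Euc d => (t₀ + p.1, p.2)) (by fun_prop) fun p hp =>
    ⟨hsub (hmem _ hp.1), mem_univ _⟩, fun s hs x => ?_⟩
  simpa using hC _ (hmem s hs) x

lemma JetCont.of_local {S : Set ℝ} {A : ℝ → Euc d → V}
    (h : ∀ t ∈ S, ∃ U ∈ 𝓝 t, JetCont U A) : JetCont S A := by
  have key : ∀ {G : ℝ → Euc d → V} {t : ℝ} {U : Set ℝ}, U ∈ 𝓝 t →
      ContinuousOn (fun p : ℝ × Euc d => G p.1 p.2) (U ×ˢ univ) → ∀ x,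
      ContinuousAt (fun p : ℝ × Euc d => G p.1 p.2) (t, x) := fun hU hG x =>
    hG.continuousAt (prod_mem_nhds hU univ_mem)
  refine ⟨fun t ht => ?_, fun p hp => ?_, fun i p hp => ?_⟩
  · obtain ⟨U, hU, hA⟩ := h t ht
    exact hA.isC1 t (mem_of_mem_nhds hU)
  · obtain ⟨U, hU, hA⟩ := h p.1 hp.1
    exact (key hU hA.cont p.2).continuousWithinAt
  · obtain ⟨U, hU, hA⟩ := h p.1 hp.1
    exact (key (G := fun s => pd i (A s)) hU (hA.cont_pd i) p.2).continuousWithinAt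

lemma JetCont.comp_add_left {S S' : Set ℝ} {A : ℝ → Euc d → V} (h : JetCont S A) (t₀ : ℝ)
    (hS : ∀ s ∈ S', t₀ + s ∈ S) : JetCont S' fun s => A (t₀ + s) :=
  ⟨fun t ht => h.isC1 _ (hS t ht),
    h.cont.comp (f := fun p : ℝ × Euc d => (t₀ + p.1, p.2)) (by fun_prop)
      fun p hp => ⟨hS _ hp.1, mem_univ _⟩,
    fun i => (h.cont_pd i).comp (f := fun p : ℝ × Euc d => (t₀ + p.1, p.2)) (by fun_prop)
      fun p hp => ⟨hS _ hp.1, mem_univ _⟩⟩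

lemma JetCont.jetAt {S : Set ℝ} {A : ℝ → Euc d → V} (h : JetCont S A)
    (h' : ∀ i, JetCont S fun s => pd i (A s)) : JetCont S fun s => jetAt (A s) := by
  refine ⟨fun t ht => isC1_jetAt (h.isC1 t ht) fun i => (h' i).isC1 t ht, h.continuousOn_jetAt,
    fun j => ?_⟩
  refine ((h.cont_pd j).prodMk (continuousOn_pi.2 fun i => (h' i).cont_pd j)).congr fun p hp => ?_
  exact pd_jetAt (h.isC1 _ hp.1).differentiable (fun i => ((h' i).isC1 _ hp.1).differentiable) j p.2

/-- A path on `(0, T)` which solves `∂ₜ A = Δ A + P(A, ∂A) + Q(A, R(A, A))` in the integrated sense,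
from any positive time on. -/
structure IsMild (P Q : V →L[ℝ] (Fin d → V) →L[ℝ] V) (R : V →L[ℝ] V →L[ℝ] (Fin d → V)) (T : ℝ)
    (A : ℝ → Euc d → V) : Prop where
  jetCont : JetCont (Ioo 0 T) A
  eq : ∀ t₀ t, 0 < t₀ → 0 < t → t₀ + t < T →
    A (t₀ + t) = heat t (A t₀) + duhamel (fun s => funNonlin P Q R (A (t₀ + s))) t

lemma map_heat {W : Type*} [NormedAddCommGroup W] [NormedSpace ℝ W] [CompleteSpace W]
    (L : V →L[ℝ] W) {f : Euc d → V} (hf : Continuous f) {C : ℝ} (hC : ∀ x, ‖f x‖ ≤ C) (t : ℝ)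
    (x : Euc d) : L (heat t f x) = heat t (fun y => L (f y)) x := by
  rw [heat_eq, heat_eq, L.integral_comp_comm (integrable_heat hf hC t x)]

lemma map_duhamel {W : Type*} [NormedAddCommGroup W] [NormedSpace ℝ W] [CompleteSpace W]
    (L : V →L[ℝ] W) {T a M : ℝ} {F : ℝ → Euc d → V} (hF : IsSource T a M F) (ha : a < 1) {t : ℝ}
    (ht : t ∈ Ioc 0 T) (x : Euc d) : L (duhamel F t x) = duhamel (fun s y => L (F s y)) t x := by
  rw [duhamel, ← L.intervalIntegral_comp_comm (intervalIntegrable_duhamel hF ha ht x)]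
  refine intervalIntegral.integral_congr_ae (Eventually.of_forall fun s hs => ?_)
  rw [uIoc_of_le ht.1.le] at hs
  have hs' : s ∈ Ioc 0 T := ⟨hs.1, hs.2.trans ht.2⟩
  exact map_heat L (hF.continuous hs') (hF.bound s hs') _ _

/-- Mild solutions are twice continuously differentiable in space: this is local in time, and
`jetCont_pd_of_mild` applies on short intervals since the jet is bounded on compact ones. -/
lemma IsMild.jetCont_pd {T : ℝ} {A : ℝ → Euc d → V} (h : IsMild P Q R T A) (i : Fin d) :
    JetCont (Ioo 0 T) fun s => pd i (A s) := by
  refine JetCont.of_local fun t ht => ?_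
  have hsub : Icc (t / 2) ((t + T) / 2) ⊆ Ioo 0 T := fun s hs =>
    ⟨by linarith [hs.1, ht.1], by linarith [hs.2, ht.2]⟩
  obtain ⟨M, hM, hMb⟩ := exists_bound_of_continuousOn (G := fun s => jetAt (A s))
    (fun s hs j x => by
      simp only [_root_.jetAt, (h.jetCont.isC1 s (hsub hs)).1 j x,
        fun k => (h.jetCont.isC1 s (hsub hs)).1.pd k j x])
    (h.jetCont.continuousOn_jetAt.mono (prod_mono_left hsub))
  -- the length `δ` of a time interval around `t` on which the mild equation is a contraction
  have hlim : Tendsto (fun δ : ℝ => mildConst P Q R (M + 1) * δ ^ (1 / 2 : ℝ)) (𝓝[>] 0) (𝓝 0) := by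
    have h1 : Tendsto (fun δ : ℝ => δ ^ (1 / 2 : ℝ)) (𝓝[>] 0) (𝓝 0) := by
      have := (Real.continuousAt_rpow_const 0 (1 / 2) (Or.inr (by norm_num))).tendsto
      rw [Real.zero_rpow (by norm_num)] at this
      exact this.mono_left nhdsWithin_le_nhds
    simpa using h1.const_mul (mildConst P Q R (M + 1))
  have hev : ∀ᶠ δ : ℝ in 𝓝[>] 0, 0 < δ ∧ δ < 1 ∧ δ < t ∧ δ < T - t ∧
      mildConst P Q R (M + 1) * δ ^ (1 / 2 : ℝ) ≤ 1 / 2 := by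
    have h1 : ∀ c : ℝ, 0 < c → ∀ᶠ δ : ℝ in 𝓝[>] 0, δ < c := fun c hc =>
      mem_nhdsWithin_of_mem_nhds (Iio_mem_nhds hc)
    filter_upwards [self_mem_nhdsWithin, h1 1 one_pos, h1 t ht.1, h1 (T - t) (by linarith [ht.2]),
      hlim.eventually_lt_const (show (0 : ℝ) < 1 / 2 by norm_num)] with δ h1 h2 h3 h4 h5
    exact ⟨h1, h2, h3, h4, h5.le⟩
  obtain ⟨δ, hδ0, hδ1, hδt, hδT, hδ⟩ := hev.exists
  set t₀ := t - δ / 2 with ht₀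
  have hmem : ∀ s ∈ Ioc 0 δ, t₀ + s ∈ Icc (t / 2) ((t + T) / 2) := fun s hs =>
    ⟨by linarith [hs.1], by linarith [hs.2]⟩
  have ht₀m : t₀ ∈ Icc (t / 2) ((t + T) / 2) := ⟨by linarith, by linarith⟩
  have hj := jetCont_pd_of_mild P Q R hδ0 hδ1.le hM (u₀ := A t₀) (u := fun s => A (t₀ + s))
    (h.jetCont.isC1 _ (hsub ht₀m)) (h.jetCont.comp_add_left t₀ fun s hs => hsub (hmem s hs))
    (fun s hs x => by
      have h1 := hMb _ (hmem s hs) x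
      have h2 : 1 ≤ s ^ (-(1 / 2 + 0) : ℝ) :=
        Real.one_le_rpow_of_pos_of_le_one_of_nonpos hs.1 (hs.2.trans hδ1.le) (by norm_num)
      refine ⟨?_, fun k => ?_⟩
      · rw [neg_zero, Real.rpow_zero, mul_one]
        exact (norm_fst_le (_root_.jetAt (A (t₀ + s)) x)).trans h1
      exact ((norm_le_pi_norm (_root_.jetAt (A (t₀ + s)) x).2 k).trans
        ((norm_snd_le _).trans h1)).trans (le_mul_of_one_le_right hM h2))
    hδ (fun s hs => h.eq t₀ s (by linarith) hs.1 (by linarith [hs.2])) i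
  refine ⟨Ioo t₀ (t₀ + δ), Ioo_mem_nhds (by linarith) (by linarith), ?_⟩
  have := hj.comp_add_left (S' := Ioo t₀ (t₀ + δ)) (-t₀) fun s hs =>
    ⟨by linarith [hs.1], by linarith [hs.2]⟩
  simpa using this

lemma jetAt_heat {f : Euc d → V} (hf : IsC1 f) (hf' : ∀ i, IsC1 (pd i f)) (t : ℝ) (x : Euc d) :
    jetAt (heat t f) x = heat t (jetAt f) x := by
  have hj := isC1_jetAt hf hf'
  obtain ⟨c, hc⟩ := hj.1.exists_bound hj.2.continuous
  refine Prod.ext ?_ (funext fun i => ?_)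
  · exact (map_heat (ContinuousLinearMap.fst ℝ V (Fin d → V)) hj.2.continuous hc t x).symm
  · exact (pd_heat_eq_heat_pd hf t i x).trans
      (map_heat (jetProj d V i) hj.2.continuous hc t x).symm

lemma jetAt_duhamel {t C C' : ℝ} (ht : 0 < t) (hC : 0 ≤ C) {F : ℝ → Euc d → V}
    {F' : ℝ → Euc d → Jet d V} (hF : IsSource t 0 C F) (hF' : IsSource t 0 C' F')
    (hF1 : ∀ s ∈ Ioc 0 t, IsC1 (F s)) (hFF : ∀ s ∈ Ioc 0 t, F' s = jetAt (F s)) (x : Euc d) :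
    jetAt (duhamel F t) x = duhamel F' t x := by
  have htt : t ∈ Ioc 0 t := ⟨ht, le_rfl⟩
  refine Prod.ext ?_ (funext fun i => ?_)
  · refine Eq.trans ?_ (map_duhamel (ContinuousLinearMap.fst ℝ V (Fin d → V)) hF' one_pos
      htt x).symm
    refine congrFun (duhamel_congr ht fun s hs => ?_) x
    rw [hFF s hs]
    rfl
  · refine Eq.trans ?_ (map_duhamel (jetProj d V i) hF' one_pos htt x).symm
    refine (pd_duhamel hF le_rfl one_pos hC htt i x).trans ?_
    refine intervalIntegral.integral_congr_ae (Eventually.of_forall fun s hs => ?_)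
    rw [uIoc_of_le ht.le] at hs
    have e3 : (fun y => jetProj d V i (F' s y)) = pd i (F s) := by
      rw [hFF s hs]
      rfl
    simp only [e3]
    exact pd_heat_eq_heat_pd (hF1 s hs) _ i x

lemma JetCont.exists_isSource_funNonlin (P Q : V →L[ℝ] (Fin d → V) →L[ℝ] V)
    (R : V →L[ℝ] V →L[ℝ] (Fin d → V)) {T t₀ t : ℝ} {A : ℝ → Euc d → V}
    (h : JetCont (Ioo 0 T) A) (ht₀ : 0 < t₀) (ht : t₀ + t < T) :
    ∃ C, 0 ≤ C ∧ IsSource t 0 C fun s => funNonlin P Q R (A (t₀ + s)) :=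
  exists_isSource (G := fun s => funNonlin P Q R (A s)) ht₀ ht
    (fun s hs => isTorusFun_funNonlin P Q R (h.isC1 s hs).1) (continuousOn_funNonlin P Q R h)

lemma IsMild.jetAt_eq {T : ℝ} {A : ℝ → Euc d → V} (h : IsMild P Q R T A)
    {F' : ℝ → Euc d → Jet d V} (hF' : ∀ s ∈ Ioo 0 T, F' s = jetAt (funNonlin P Q R (A s)))
    (hper : ∀ s ∈ Ioo 0 T, IsTorusFun (F' s))
    (hcont : ContinuousOn (fun p : ℝ × Euc d => F' p.1 p.2) (Ioo 0 T ×ˢ univ))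
    {t₀ t : ℝ} (ht₀ : 0 < t₀) (ht : 0 < t) (htT : t₀ + t < T) (x : Euc d) :
    jetAt (A (t₀ + t)) x = heat t (jetAt (A t₀)) x + duhamel (fun s => F' (t₀ + s)) t x := by
  have hm : ∀ s ∈ Ioc 0 t, t₀ + s ∈ Ioo 0 T := fun s hs =>
    ⟨by linarith [hs.1], by linarith [hs.2]⟩
  have ht₀m : t₀ ∈ Ioo 0 T := ⟨ht₀, by linarith⟩
  obtain ⟨C, hC0, hsrc⟩ := h.jetCont.exists_isSource_funNonlin P Q R ht₀ htT
  obtain ⟨C', -, hsrc'⟩ := exists_isSource ht₀ htT hper hcont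
  have hA₀ := h.jetCont.isC1 t₀ ht₀m
  obtain ⟨c, hc⟩ := hA₀.1.exists_bound hA₀.2.continuous
  rw [← jetAt_heat hA₀ (fun i => (h.jetCont_pd i).isC1 _ ht₀m),
    ← jetAt_duhamel ht hC0 hsrc hsrc'
      (fun s hs => isC1_funNonlin P Q R (h.jetCont.isC1 _ (hm s hs))
        fun i => (h.jetCont_pd i).isC1 _ (hm s hs))
      (fun s hs => hF' _ (hm s hs)), h.eq t₀ t ht₀ ht htT]
  exact jetAt_add (differentiable_heat hA₀.2.continuous hc ht x)
    (differentiable_duhamel hsrc le_rfl one_pos hC0 ⟨ht, le_rfl⟩ x)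

/-- The jet of a solution solves the prolonged equation. -/
lemma IsMild.jet {T : ℝ} {A : ℝ → Euc d → V} (h : IsMild P Q R T A) :
    IsMild (V := Jet d V) (prolong P) (prolong Q) (prolongPair R) T fun s => jetAt (A s) := by
  have hjet := h.jetCont.jetAt h.jetCont_pd
  have h1 : ∀ s ∈ Ioo 0 T,
      funNonlin (V := Jet d V) (prolong P) (prolong Q) (prolongPair R) (jetAt (A s)) =
        jetAt (funNonlin P Q R (A s)) := fun s hs => funext fun y =>
    (jetAt_funNonlin P Q R (h.jetCont.isC1 s hs).differentiable
      (fun i => ((h.jetCont_pd i).isC1 s hs).differentiable) y).symm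
  have h2 : ∀ s ∈ Ioo 0 T, IsTorusFun
      (funNonlin (V := Jet d V) (prolong P) (prolong Q) (prolongPair R) (jetAt (A s))) :=
    fun s hs => isTorusFun_funNonlin (V := Jet d V) (prolong P) (prolong Q) (prolongPair R)
      (hjet.isC1 s hs).1
  have h3 := continuousOn_funNonlin (V := Jet d V) (prolong P) (prolong Q) (prolongPair R) hjet
  exact ⟨hjet, fun t₀ t ht₀ ht htT => funext (h.jetAt_eq (F' := fun s =>
    funNonlin (V := Jet d V) (prolong P) (prolong Q) (prolongPair R) (jetAt (A s)))
      h1 h2 h3 ht₀ ht htT)⟩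

end Mild

/-! ### Smoothness of mild solutions -/

section Smooth

variable {d : ℕ} {V : Type*} [NormedAddCommGroup V] [NormedSpace ℝ V] [CompleteSpace V]
variable {P Q : V →L[ℝ] (Fin d → V) →L[ℝ] V} {R : V →L[ℝ] V →L[ℝ] (Fin d → V)}

/-- The Duhamel integral of a bounded continuous source has the right derivative `F 0` at time
zero: it is `t` times an average of `heat (t (1 - σ)) (F (t σ))` over `σ`. -/
lemma hasDerivWithinAt_duhamel_zero {δ C : ℝ} (hδ : 0 < δ) {F : ℝ → Euc d → V}
    (hF : ContinuousOn (fun p : ℝ × Euc d => F p.1 p.2) (Icc 0 δ ×ˢ univ))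
    (hC : ∀ s ∈ Icc 0 δ, ∀ x, ‖F s x‖ ≤ C) (x : Euc d) :
    HasDerivWithinAt (fun t => duhamel F t x) (F 0 x) (Ici 0) 0 := by
  set g : ℝ → V := fun t => ∫ σ in (0 : ℝ)..1, heat (t * (1 - σ)) (F (t * σ)) x with hg
  have h0 : (0 : ℝ) ∈ Icc 0 δ := ⟨le_rfl, hδ.le⟩
  have hmem : ∀ t ∈ Icc 0 δ, ∀ σ ∈ Icc (0 : ℝ) 1, t * σ ∈ Icc 0 δ := fun t ht σ hσ =>
    ⟨mul_nonneg ht.1 hσ.1, (mul_le_of_le_one_right ht.1 hσ.2).trans ht.2⟩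
  have hI : uIoc (0 : ℝ) 1 ⊆ Icc 0 1 := by
    rw [uIoc_of_le zero_le_one]; exact Ioc_subset_Icc_self
  have hgc : ContinuousWithinAt g (Icc 0 δ) 0 := by
    refine intervalIntegral.continuousWithinAt_of_dominated_interval (bound := fun _ => C) ?_ ?_
      intervalIntegrable_const ?_
    · filter_upwards [self_mem_nhdsWithin] with t ht
      refine (ContinuousOn.mono ?_ hI).aestronglyMeasurable measurableSet_uIoc
      refine continuousOn_heat (c := fun _ => C) ?_ (by fun_prop)
        (fun σ hσ => hC _ (hmem t ht σ hσ)) (by fun_prop) (by fun_prop)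
      exact hF.comp (f := fun q : ℝ × Euc d => (t * q.1, q.2)) (by fun_prop)
        fun q hq => ⟨hmem t ht q.1 hq.1, mem_univ _⟩
    · filter_upwards [self_mem_nhdsWithin] with t ht
      exact Eventually.of_forall fun σ hσ => norm_heat_le (hC _ (hmem t ht σ (hI hσ))) _ _
    · refine Eventually.of_forall fun σ hσ => ?_
      have : ContinuousOn (fun t => heat (t * (1 - σ)) (F (t * σ)) x) (Icc 0 δ) := by
        refine continuousOn_heat (c := fun _ => C) ?_ (by fun_prop)
          (fun t ht => hC _ (hmem t ht σ (hI hσ))) (by fun_prop) (by fun_prop)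
        exact hF.comp (f := fun q : ℝ × Euc d => (q.1 * σ, q.2)) (by fun_prop)
          fun q hq => ⟨hmem q.1 hq.1 σ (hI hσ), mem_univ _⟩
      exact this 0 h0
  have hg0 : g 0 = F 0 x := by simp [hg, heat_zero]
  rw [hasDerivWithinAt_iff_tendsto_slope]
  have h1 : Tendsto g (𝓝[Ici 0 \ {0}] 0) (𝓝 (F 0 x)) := by
    rw [← hg0]
    refine hgc.tendsto.mono_left ?_
    rw [← nhdsWithin_inter_of_mem' (s := Ici (0 : ℝ) \ {0}) (t := Iic δ)
      (mem_nhdsWithin_of_mem_nhds (Iic_mem_nhds hδ))]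
    exact nhdsWithin_mono _ fun t ht => ⟨ht.1.1, ht.2⟩
  refine h1.congr' ?_
  filter_upwards [self_mem_nhdsWithin] with t ht
  have ht0 : t ≠ 0 := fun h => ht.2 h
  have e0 : duhamel F 0 x = 0 := by simp [duhamel]
  rw [slope_def_module, e0, sub_zero, sub_zero, duhamel_eq_smul_integral, smul_smul,
    inv_mul_cancel₀ ht0, one_smul]

lemma IsMild.hasDerivWithinAt {T : ℝ} {A : ℝ → Euc d → V} (h : IsMild P Q R T A) {t : ℝ}
    (ht : t ∈ Ioo 0 T) (x : Euc d) :
    HasDerivWithinAt (fun s => A s x) (lap (A t) x + funNonlin P Q R (A t) x) (Ioi t) t := by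
  set δ := (T - t) / 2 with hδ
  have hδ0 : 0 < δ := by linarith [ht.2]
  have hsub : Icc t (t + δ) ⊆ Ioo 0 T := fun s hs =>
    ⟨ht.1.trans_le hs.1, by linarith [hs.2, ht.2]⟩
  have hm : ∀ s ∈ Icc 0 δ, t + s ∈ Icc t (t + δ) := fun s hs =>
    ⟨by linarith [hs.1], by linarith [hs.2]⟩
  have hc := continuousOn_funNonlin P Q R h.jetCont
  obtain ⟨C, -, hC⟩ := exists_bound_of_continuousOn (G := fun s => funNonlin P Q R (A s))
    (fun s hs => isTorusFun_funNonlin P Q R (h.jetCont.isC1 s (hsub hs)).1)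
    (hc.mono (prod_mono_left hsub))
  have h1 := hasDerivWithinAt_duhamel_zero hδ0 (F := fun s => funNonlin P Q R (A (t + s)))
    (hc.comp (f := fun p : ℝ × Euc d => (t + p.1, p.2)) (by fun_prop)
      fun p hp => ⟨hsub (hm _ hp.1), mem_univ _⟩) (fun s hs => hC _ (hm s hs)) x
  have h2 := hasDerivWithinAt_heat_zero (h.jetCont.isC1 t ht)
    (fun i => (h.jetCont_pd i).isC1 t ht) x
  have h3 : HasDerivWithinAt (fun r => A (t + r) x)
      (lap (A t) x + funNonlin P Q R (A t) x) (Ici 0) 0 := by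
    have h4 := h2.add h1
    rw [add_zero] at h4
    refine h4.congr_of_eventuallyEq_of_mem ?_ self_mem_Ici
    filter_upwards [self_mem_nhdsWithin,
      mem_nhdsWithin_of_mem_nhds (Iio_mem_nhds hδ0)] with r hr hr'
    rcases (show (0 : ℝ) ≤ r from hr).eq_or_lt with rfl | hr0
    · simp [heat_zero, duhamel]
    · rw [h.eq t r ht.1 hr0 (by linarith [show r < δ from hr', ht.2])]
      rfl
  have h5 := h3.scomp_of_eq t (h := fun s => s - t) (s := Ioi t) (t' := Ici 0)
    ((hasDerivAt_id t).sub_const t).hasDerivWithinAt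
    (fun s hs => show (0 : ℝ) ≤ s - t from sub_nonneg.2 (le_of_lt hs))
    (sub_self t).symm
  simpa [Function.comp_def] using h5

lemma IsMild.continuousOn_lap {T : ℝ} {A : ℝ → Euc d → V} (h : IsMild P Q R T A) :
    ContinuousOn (fun p : ℝ × Euc d => lap (A p.1) p.2) (Ioo 0 T ×ˢ univ) :=
  continuousOn_finsetSum _ fun i _ => (h.jetCont_pd i).cont_pd i

/-- A mild solution is a classical solution in time. Its right derivative is continuous, and a
continuous function is the integral of its continuous right derivative. -/
lemma IsMild.hasDerivAt {T : ℝ} {A : ℝ → Euc d → V} (h : IsMild P Q R T A) {t : ℝ}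
    (ht : t ∈ Ioo 0 T) (x : Euc d) :
    HasDerivAt (fun s => A s x) (lap (A t) x + funNonlin P Q R (A t) x) t := by
  set w : ℝ → V := fun s => lap (A s) x + funNonlin P Q R (A s) x with hw
  have hwc : ContinuousOn w (Ioo 0 T) :=
    (h.continuousOn_lap.add (continuousOn_funNonlin P Q R h.jetCont)).comp
      (f := fun s => (s, x)) (by fun_prop) fun s hs => ⟨hs, mem_univ _⟩
  have hAc : ContinuousOn (fun s => A s x) (Ioo 0 T) :=
    h.jetCont.cont.comp (f := fun s => (s, x)) (by fun_prop) fun s hs => ⟨hs, mem_univ _⟩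
  set a := t / 2 with ha
  have ha0 : 0 < a := half_pos ht.1
  have hsub : ∀ {s}, a ≤ s → s < T → Icc a s ⊆ Ioo 0 T := fun hs hsT r hr =>
    ⟨ha0.trans_le hr.1, hr.2.trans_lt hsT⟩
  have hFTC : ∀ s, a ≤ s → s < T → A s x = A a x + ∫ r in a..s, w r := by
    intro s hs hsT
    have hsub' := hsub hs hsT
    rw [intervalIntegral.integral_eq_sub_of_hasDeriv_right (f := fun s => A s x)]
    · abel
    · rw [uIcc_of_le hs]
      exact hAc.mono hsub'
    · rw [min_eq_left hs, max_eq_right hs]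
      exact fun r hr => h.hasDerivWithinAt (hsub' (Ioo_subset_Icc_self hr)) x
    · refine ContinuousOn.intervalIntegrable ?_
      rw [uIcc_of_le hs]
      exact hwc.mono hsub'
  have hat : a < t := half_lt_self ht.1
  have hI : HasDerivAt (fun s => ∫ r in a..s, w r) (w t) t := by
    refine intervalIntegral.integral_hasDerivAt_right ?_ ?_
      (hwc.continuousAt (isOpen_Ioo.mem_nhds ht))
    · refine ContinuousOn.intervalIntegrable ?_
      rw [uIcc_of_le hat.le]
      exact hwc.mono (hsub hat.le ht.2)
    · exact hwc.stronglyMeasurableAtFilter isOpen_Ioo t ht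
  refine (hI.const_add (A a x)).congr_of_eventuallyEq ?_
  filter_upwards [Ioo_mem_nhds hat ht.2] with s hs
  exact hFTC s hs.1.le hs.2

lemma IsMild.hasFDerivAt_uncurry {T : ℝ} {A : ℝ → Euc d → V} (h : IsMild P Q R T A)
    {p : ℝ × Euc d} (hp : p ∈ Ioo 0 T ×ˢ (univ : Set (Euc d))) :
    HasFDerivAt (fun p : ℝ × Euc d => A p.1 p.2)
      ((ContinuousLinearMap.fst ℝ ℝ (Euc d)).smulRight
          (lap (A p.1) p.2 + funNonlin P Q R (A p.1) p.2) +
        ∑ i, ((EuclideanSpace.proj i).comp (ContinuousLinearMap.snd ℝ ℝ (Euc d))).smulRight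
          (pd i (A p.1) p.2)) p := by
  have hU : Ioo 0 T ×ˢ (univ : Set (Euc d)) ∈ 𝓝 p := (isOpen_Ioo.prod isOpen_univ).mem_nhds hp
  have hw := ((h.continuousOn_lap.add (continuousOn_funNonlin P Q R h.jetCont)).continuousAt hU)
  have key := hasStrictFDerivAt_uncurry_coprod (𝕜 := ℝ) (u := p) (f := A)
    (f₁ := fun t x => (ContinuousLinearMap.id ℝ ℝ).smulRight
      (lap (A t) x + funNonlin P Q R (A t) x))
    (f₂ := fun t x => ∑ i, (EuclideanSpace.proj i : Euc d →L[ℝ] ℝ).smulRight (pd i (A t) x))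
    ?_ ?_ ?_ ?_
  · refine key.hasFDerivAt.congr_fderiv ?_
    ext v <;> simp [Function.HasUncurry.uncurry]
  · filter_upwards [hU] with v hv
    refine (h.hasDerivAt hv.1 v.2).hasFDerivAt.congr_fderiv ?_
    ext
    simp [Function.HasUncurry.uncurry]
  · filter_upwards [hU] with v hv
    refine ((h.jetCont.isC1 _ hv.1).differentiable v.2).hasFDerivAt.congr_fderiv ?_
    exact fderiv_eq_sum_pd _ _
  · exact (ContinuousLinearMap.smulRightL ℝ ℝ V
      (ContinuousLinearMap.id ℝ ℝ)).continuous.continuousAt.comp hw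
  · have hi : ∀ i, ContinuousAt (fun v : ℝ × Euc d => ContinuousLinearMap.smulRightL ℝ (Euc d) V
        (EuclideanSpace.proj i) (pd i (A v.1) v.2)) p := fun i =>
      (ContinuousLinearMap.continuous _).continuousAt.comp ((h.jetCont.cont_pd i).continuousAt hU)
    have hs : ContinuousAt (fun v : ℝ × Euc d => ∑ i, ContinuousLinearMap.smulRightL ℝ (Euc d) V
        (EuclideanSpace.proj i) (pd i (A v.1) v.2)) p := tendsto_finsetSum _ fun i _ => hi i
    exact hs

lemma contDiffOn_smulRight {E : Type*} [NormedAddCommGroup E] [NormedSpace ℝ E] {n : ℕ∞}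
    (c : E →L[ℝ] ℝ) {f : E → V} {s : Set E} (hf : ContDiffOn ℝ n f s) :
    ContDiffOn ℝ n (fun x => c.smulRight (f x)) s :=
  (ContinuousLinearMap.smulRightL ℝ E V c).contDiff.comp_contDiffOn hf

end Smooth

section SmoothInduction

variable {d : ℕ}

/-- Mild solutions are smooth: the first derivatives of a solution are expressions in its jet and
in the jet of its jet, which are solutions of equations of the same form. -/
lemma IsMild.contDiffOn_nat {T : ℝ} (k : ℕ) : ∀ {V : Type*} [NormedAddCommGroup V]
    [NormedSpace ℝ V] [CompleteSpace V] {P Q : V →L[ℝ] (Fin d → V) →L[ℝ] V}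
    {R : V →L[ℝ] V →L[ℝ] (Fin d → V)} {A : ℝ → Euc d → V}, IsMild P Q R T A →
    ContDiffOn ℝ k (fun p : ℝ × Euc d => A p.1 p.2) (Ioo 0 T ×ˢ univ) := by
  induction k with
  | zero => exact fun h => contDiffOn_zero.2 h.jetCont.cont
  | succ k ih =>
    intro V _ _ _ P Q R A h
    have hopen : IsOpen (Ioo 0 T ×ˢ (univ : Set (Euc d))) := isOpen_Ioo.prod isOpen_univ
    have h1 := ih h.jet
    have h2 := ih h.jet.jet
    have hpd : ∀ i, ContDiffOn ℝ k (fun p : ℝ × Euc d => pd i (A p.1) p.2) (Ioo 0 T ×ˢ univ) :=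
      fun i => (jetProj d V i).contDiff.comp_contDiffOn h1
    have hlap : ContDiffOn ℝ k (fun p : ℝ × Euc d => lap (A p.1) p.2) (Ioo 0 T ×ˢ univ) := by
      refine ContDiffOn.sum fun i _ => ?_
      refine (((jetProj d V i).comp (jetProj d (Jet d V) i)).contDiff.comp_contDiffOn h2).congr
        fun p hp => ?_
      have := pd_jetAt (h.jetCont.isC1 _ hp.1).differentiable
        (fun j => ((h.jetCont_pd j).isC1 _ hp.1).differentiable) i p.2
      change _ = (pd i (jetAt (A p.1)) p.2).2 i
      rw [this]
    have hX : ContDiffOn ℝ k (fun p : ℝ × Euc d => funNonlin P Q R (A p.1) p.2)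
        (Ioo 0 T ×ˢ univ) := (contDiff_jetNonlin P Q R (n := k)).comp_contDiffOn h1
    rw [Nat.cast_add, Nat.cast_one, contDiffOn_succ_iff_fderiv_of_isOpen hopen]
    refine ⟨fun p hp => (h.hasFDerivAt_uncurry hp).differentiableAt.differentiableWithinAt,
      by simp, ?_⟩
    refine ContDiffOn.congr ?_ fun p hp => (h.hasFDerivAt_uncurry hp).fderiv
    exact (contDiffOn_smulRight _ (hlap.add hX)).add
      (ContDiffOn.sum fun i _ => contDiffOn_smulRight _ (hpd i))

lemma IsMild.contDiffOn {V : Type*} [NormedAddCommGroup V] [NormedSpace ℝ V] [CompleteSpace V]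
    {P Q : V →L[ℝ] (Fin d → V) →L[ℝ] V} {R : V →L[ℝ] V →L[ℝ] (Fin d → V)} {T : ℝ}
    {A : ℝ → Euc d → V} (h : IsMild P Q R T A) :
    ContDiffOn ℝ ∞ (fun p : ℝ × Euc d => A p.1 p.2) (Ioo 0 T ×ˢ univ) :=
  contDiffOn_infty.2 fun k => IsMild.contDiffOn_nat k h

end SmoothInduction

/-! ### Properties of the remainder -/

section RemainderProperties

variable {d : ℕ} {V : Type*} [NormedAddCommGroup V] [NormedSpace ℝ V] [CompleteSpace V]

lemma duhamel_add_time {T a M : ℝ} {F : ℝ → Euc d → V} (hF : IsSource T a M F) (ha : a < 1)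
    {t₀ t : ℝ} (ht₀ : 0 < t₀) (ht : 0 < t) (htT : t₀ + t ≤ T) :
    duhamel F (t₀ + t) = heat t (duhamel F t₀) + duhamel (fun s => F (t₀ + s)) t := by
  ext x
  have hlt : t₀ ≤ t₀ + t := by linarith
  have hi := intervalIntegrable_duhamel hF ha (t := t₀ + t) ⟨by linarith, htT⟩ x
  have h1 := heat_duhamel hF ha ht₀ hlt htT x
  rw [add_sub_cancel_left] at h1
  have h2 : duhamel (fun s => F (t₀ + s)) t x = ∫ s in t₀..t₀ + t, heat (t₀ + t - s) (F s) x := by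
    have h3 := intervalIntegral.integral_comp_add_left (a := 0) (b := t)
      (fun s => heat (t₀ + t - s) (F s) x) t₀
    rw [add_zero] at h3
    rw [← h3, duhamel]
    simp only [add_sub_add_left_eq_sub]
  rw [Pi.add_apply, h1, h2, intervalIntegral.integral_add_adjacent_intervals]
  · rfl
  · exact hi.mono_set (by
      rw [uIcc_of_le ht₀.le, uIcc_of_le (ht₀.le.trans hlt)]
      exact Icc_subset_Icc_right hlt)
  · exact hi.mono_set (by
      rw [uIcc_of_le hlt, uIcc_of_le (ht₀.le.trans hlt)]
      exact Icc_subset_Icc_left ht₀.le)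

lemma qNorm_congr {T γ : ℝ} {A B : ℝ → Euc d → V} (h : ∀ t ∈ Ioc 0 T, A t = B t) :
    qNorm T γ A = qNorm T γ B := by
  unfold qNorm
  congr 1 <;> exact iSup_congr fun t => iSup_congr fun ht => by rw [h t ht]

variable (P Q : V →L[ℝ] (Fin d → V) →L[ℝ] V) (R : V →L[ℝ] V →L[ℝ] (Fin d → V))

lemma increment_zero_left (B : ℝ → Euc d → V) :
    increment P Q R 0 B = fun s => funNonlin P Q R (B s) := by
  ext s x
  simp [increment, funNonlin, jetNonlin]

section Sources

variable {T γ b M : ℝ} {A B : ℝ → Euc d → V}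

lemma isSource_funNonlin (hT : T ≤ 1) (hbγ : b ≤ γ) (hγ : γ < 1 / 2) (hM : 0 ≤ M)
    (hB : JetCont (Ioc 0 T) B) (nB : JetBound T b M B) :
    IsSource T (1 / 2 + γ + b) (nonlinConst P Q R * (1 + M) ^ 2 * M)
      (fun s => funNonlin P Q R (B s)) := by
  rw [← increment_zero_left]
  exact isSource_increment P Q R hT hbγ hγ.le hM hM le_rfl (jetCont_zero _) hB
    (jetBound_zero T γ hM) nB

lemma duhamelConverges_funNonlin (hT : T ≤ 1) (hb : 0 ≤ b) (hbγ : b ≤ γ) (hγ : γ < 1 / 2)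
    (hγb : γ + b < 1 / 2) (hM : 0 ≤ M) (hB : JetCont (Ioc 0 T) B) (nB : JetBound T b M B) :
    DuhamelConverges T fun s => funNonlin P Q R (B s) := by
  have hk := nonlinConst_nonneg P Q R
  exact duhamelConverges (isSource_funNonlin P Q R hT hbγ hγ hM hB nB) (by linarith) (by linarith)
    (by positivity) fun s hs => isTorusFun_funNonlin P Q R (hB.isC1 s hs).1

/-- The cross terms `X(A + B) - X(A) - X(B)` of the nonlinearity have an absolutely convergent
Duhamel integral, and together with `X(B)` they form the increment `X(A + B) - X(A)`. -/
lemma duhamel_cross (hT : T ≤ 1) (hb : 0 ≤ b) (hbγ : b ≤ γ) (hγ : γ < 1 / 2)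
    (hγb : γ + b < 1 / 2) (hM : 0 ≤ M) (hA : JetCont (Ioc 0 T) A) (hB : JetCont (Ioc 0 T) B)
    (nA : JetBound T γ M A) (nB : JetBound T b M B) :
    DuhamelConverges T (increment P Q R A B - fun s => funNonlin P Q R (B s)) ∧
      ∀ t ∈ Ioc 0 T, duhamel (fun s => funNonlin P Q R (B s)) t +
        duhamel (increment P Q R A B - fun s => funNonlin P Q R (B s)) t =
        duhamel (increment P Q R A B) t := by
  have hk := nonlinConst_nonneg P Q R
  have hY := isSource_increment P Q R hT hbγ hγ.le hM hM le_rfl hA hB nA nB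
  have hX := isSource_funNonlin P Q R hT hbγ hγ hM hB nB
  refine ⟨duhamelConverges (a := 1 / 2 + γ + b) (M := nonlinConst P Q R * (1 + M) ^ 2 * (M + 0))
    ?_ (by linarith) (by linarith) (by positivity) fun s hs i x => ?_, fun t ht => ?_⟩
  · rw [← increment_zero_left]
    exact isSource_increment_sub P Q R hT hbγ hγ.le hM hM le_rfl hA (jetCont_zero _) hB hB nA
      (jetBound_zero T γ hM) nB nB (by simpa using nA) (by simpa using jetBound_zero T b le_rfl)
  · simp only [Pi.sub_apply, isTorusFun_increment P Q R hA hB hs i x,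
      isTorusFun_funNonlin P Q R (hB.isC1 s hs).1 i x]
  · rw [duhamel_sub hY hX (by linarith) ht]
    abel

end Sources

/-- If `A` is caloric, `B₁` solves `∂ₜ B₁ = Δ B₁ + X(A)` and `B - B₁` is the Duhamel integral of
`X(A + B) - X(A)`, then `A + B` solves the full equation. -/
lemma isMild_of_remainder {T a M : ℝ} (hT : T ≤ 1) (ha : a < 1) {A B₁ B : ℝ → Euc d → V}
    (hA : JetCont (Ioc 0 1) A) (hB₁ : JetCont (Ioc 0 1) B₁) (hB : JetCont (Ioc 0 T) B)
    (hcal : IsCaloric A)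
    (hfirst : ∀ t₀ ∈ Ioo (0 : ℝ) 1, ∀ t ∈ Icc (0 : ℝ) (1 - t₀),
      B₁ (t₀ + t) = heat t (B₁ t₀) + duhamel (fun s => funNonlin P Q R (A (t₀ + s))) t)
    (hsrc : IsSource T a M (increment P Q R A B))
    (heq : ∀ t ∈ Ioc 0 T, B t = B₁ t + duhamel (increment P Q R A B) t) :
    IsMild P Q R T (A + B) := by
  have hAT := hA.mono (Ioc_subset_Ioc_right hT)
  have hsub : Ioo 0 T ⊆ Ioc 0 T := Ioo_subset_Ioc_self
  have hAB := (hAT.add hB).mono hsub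
  refine ⟨hAB, fun t₀ t ht₀ ht htT => ?_⟩
  have m₀ : t₀ ∈ Ioc 0 T := ⟨ht₀, by linarith⟩
  have m₁ : t₀ + t ∈ Ioc 0 T := ⟨by linarith, htT.le⟩
  have n₀ : t₀ ∈ Ioc 0 1 := ⟨ht₀, by linarith⟩
  have htt : t ∈ Ioc 0 t := ⟨ht, le_rfl⟩
  obtain ⟨C, -, s₁⟩ := (hAT.mono hsub).exists_isSource_funNonlin P Q R ht₀ htT
  obtain ⟨C', -, s₂⟩ := exists_isSource (G := increment P Q R A B) ht₀ htT
    (fun s hs => isTorusFun_increment P Q R hAT hB (hsub hs))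
    ((continuousOn_increment P Q R hAT hB).mono (prod_mono_left hsub))
  have cA := (hA.isC1 t₀ n₀).2.continuous
  have cB₁ := (hB₁.isC1 t₀ n₀).2.continuous
  have cB := (hB.isC1 t₀ m₀).2.continuous
  obtain ⟨KA, bA⟩ := (hA.isC1 t₀ n₀).1.exists_bound cA
  obtain ⟨KB₁, bB₁⟩ := (hB₁.isC1 t₀ n₀).1.exists_bound cB₁
  obtain ⟨KB, bB⟩ := (hB.isC1 t₀ m₀).1.exists_bound cB
  have hD : duhamel (increment P Q R A B) t₀ = B t₀ - B₁ t₀ := by rw [heq t₀ m₀]; simp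
  have e1 : A (t₀ + t) = heat t (A t₀) := by
    have := hcal t₀ n₀ (t₀ + t) ⟨by linarith, by linarith⟩ (by linarith)
    rwa [add_sub_cancel_left] at this
  have e2 := hfirst t₀ ⟨ht₀, by linarith⟩ t ⟨ht.le, by linarith⟩
  have e3 := duhamel_add_time hsrc ha ht₀ ht htT.le
  rw [hD, heat_sub_fun cB bB cB₁ bB₁] at e3
  -- `X(A + B)` is `X(A)`, which drives `B₁`, plus the increment, which drives `B - B₁`
  have e4 : (fun s => funNonlin P Q R ((A + B) (t₀ + s))) =
      (fun s => funNonlin P Q R (A (t₀ + s))) + fun s => increment P Q R A B (t₀ + s) := by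
    ext s x
    simp [increment]
  rw [e4, duhamel_add s₁ s₂ zero_lt_one zero_lt_one htt, Pi.add_apply, Pi.add_apply,
    heat_add_fun cA bA cB bB, heq _ m₁, e3, e2, e1]
  abel

/-- Stability of the remainder: the difference of two remainders is controlled by the difference
of the data. -/
lemma qNorm_remainder_sub_le {T γ₁ γ b M : ℝ} (hT : T ≤ 1) (hb : 0 ≤ b) (hbγ : b ≤ γ)
    (hγ₁ : γ₁ ≤ γ) (hγ : γ < 1 / 2) (hγb : γ + b < 1 / 2) (hM : 0 ≤ M)
    (hsmall : duhamelConst d (1 / 2 + γ + b) * T ^ (1 / 2 - γ) *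
      (nonlinConst P Q R * (1 + M) ^ 2) ≤ 1 / 4)
    {A A' B₁ B₁' B B' : ℝ → Euc d → V}
    (hA : JetCont (Ioc 0 T) A) (hA' : JetCont (Ioc 0 T) A') (hB₁ : JetCont (Ioc 0 T) B₁)
    (hB₁' : JetCont (Ioc 0 T) B₁') (hB : JetCont (Ioc 0 T) B) (hB' : JetCont (Ioc 0 T) B')
    (nA : JetBound T γ M A) (nA' : JetBound T γ M A') (nB : JetBound T b M B)
    (nB' : JetBound T b M B')
    (fA : qNorm T γ₁ (A - A') ≠ ⊤) (fB₁ : qNorm T b (B₁ - B₁') ≠ ⊤) (fB : qNorm T b (B - B') ≠ ⊤)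
    (heq : ∀ t ∈ Ioc 0 T, B t = B₁ t + duhamel (increment P Q R A B) t)
    (heq' : ∀ t ∈ Ioc 0 T, B' t = B₁' t + duhamel (increment P Q R A' B') t) :
    qNorm T b (B - B') ≤ 2 * qNorm T b (B₁ - B₁') + qNorm T γ₁ (A - A') := by
  set D := (qNorm T γ₁ (A - A')).toReal with hD
  set D' := (qNorm T b (B - B')).toReal with hD'
  set D₁ := (qNorm T b (B₁ - B₁')).toReal with hD₁
  have p1 : 0 ≤ D := ENNReal.toReal_nonneg
  have p2 : 0 ≤ D' := ENNReal.toReal_nonneg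
  have p3 : 0 ≤ D₁ := ENNReal.toReal_nonneg
  have q1 : qNorm T γ₁ (A - A') = ENNReal.ofReal D := (ENNReal.ofReal_toReal fA).symm
  have q2 : qNorm T b (B - B') = ENNReal.ofReal D' := (ENNReal.ofReal_toReal fB).symm
  have q3 : qNorm T b (B₁ - B₁') = ENNReal.ofReal D₁ := (ENNReal.ofReal_toReal fB₁).symm
  have nAA : JetBound T γ D (A - A') := (jetBound_of_qNorm_le p1 q1.le).weaken p1 hT hγ₁
  have nBB : JetBound T b D' (B - B') := jetBound_of_qNorm_le p2 q2.le
  have h1 := jetBound_remainder_sub P Q R hT hb hbγ hγ hγb hM p1 p2 hA hA' hB hB' nA nA' nB nB'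
    nAA nBB
  have h2 : JetBound T b ((D + D') / 4)
      (duhamel (increment P Q R A B) - duhamel (increment P Q R A' B')) := by
    refine h1.mono le_rfl ?_
    calc _ = duhamelConst d (1 / 2 + γ + b) * T ^ (1 / 2 - γ) *
          (nonlinConst P Q R * (1 + M) ^ 2) * (D + D') := by ring
      _ ≤ 1 / 4 * (D + D') := by gcongr
      _ = _ := by ring
  have h3 := h2.qNorm_le (by positivity) hT
  have h4 : qNorm T b (B - B') ≤ qNorm T b (B₁ - B₁') +
      qNorm T b ((B - B') - (B₁ - B₁')) := by
    have := qNorm_add_le (T := T) (γ := b) (A := B₁ - B₁') (B := (B - B') - (B₁ - B₁'))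
      (fun t ht => (hB₁.isC1 t ht).sub (hB₁'.isC1 t ht))
      (fun t ht => ((hB.isC1 t ht).sub (hB'.isC1 t ht)).sub
        ((hB₁.isC1 t ht).sub (hB₁'.isC1 t ht)))
    rwa [add_sub_cancel] at this
  have h5 : qNorm T b ((B - B') - (B₁ - B₁')) =
      qNorm T b (duhamel (increment P Q R A B) - duhamel (increment P Q R A' B')) := by
    refine qNorm_congr fun t ht => ?_
    simp only [Pi.sub_apply, heq t ht, heq' t ht]
    abel
  -- the term `D' / 2` on the right is absorbed, which needs `D'` to be finite
  have h6 : ENNReal.ofReal D' ≤ ENNReal.ofReal (D₁ + 2 * ((D + D') / 4)) := by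
    rw [ENNReal.ofReal_add p3 (by positivity), ← q2, ← q3]
    exact h4.trans (add_le_add_right (h5.le.trans h3) _)
  rw [ENNReal.ofReal_le_ofReal_iff (by positivity)] at h6
  have e : 2 * qNorm T b (B₁ - B₁') + qNorm T γ₁ (A - A') = ENNReal.ofReal (2 * D₁ + D) := by
    rw [q1, q3, ENNReal.ofReal_add (by positivity) p1, ENNReal.ofReal_mul (by norm_num)]
    simp
  rw [e, q2]
  exact ENNReal.ofReal_le_ofReal (by linarith)

end RemainderProperties

/-! ### The Yang-Mills nonlinearity -/

section YangMillsNonlinearity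

variable {N d : ℕ} (𝔤 : LieSubalgebra ℝ (HSMat N))

/-- The bilinear map `P(a, p)ᵢ = ∑ⱼ [aⱼ, 2 (pⱼ)ᵢ - (pᵢ)ⱼ]`, where `pⱼ` stands for `∂ⱼ a`. -/
noncomputable def ymQuad (d : ℕ) :
    FormVal 𝔤 d →L[ℝ] (Fin d → FormVal 𝔤 d) →L[ℝ] FormVal 𝔤 d :=
  (LinearMap.mk₂ ℝ (fun (a : FormVal 𝔤 d) (p : Fin d → FormVal 𝔤 d) =>
      (WithLp.toLp 2 fun i => ∑ j, ⁅a j, (2 : ℝ) • p j i - p i j⁆ : FormVal 𝔤 d))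
    (fun a a' p => by ext1 i; simp only [PiLp.add_apply, add_lie, Finset.sum_add_distrib])
    (fun c a p => by ext1 i; simp only [PiLp.smul_apply, smul_lie, Finset.smul_sum])
    (fun a p p' => by
      ext1 i
      simp only [Pi.add_apply, PiLp.add_apply, ← Finset.sum_add_distrib, ← lie_add]
      refine Finset.sum_congr rfl fun j _ => ?_
      congr 1
      module)
    (fun c a p => by
      ext1 i
      simp only [Pi.smul_apply, PiLp.smul_apply, Finset.smul_sum, ← lie_smul]
      refine Finset.sum_congr rfl fun j _ => ?_
      congr 1
      module)).toContinuousBilinearMap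

/-- The bilinear map `Q(a, w)ᵢ = ∑ⱼ [aⱼ, (wⱼ)ᵢ]`. -/
noncomputable def ymCubicOuter (d : ℕ) :
    FormVal 𝔤 d →L[ℝ] (Fin d → FormVal 𝔤 d) →L[ℝ] FormVal 𝔤 d :=
  (LinearMap.mk₂ ℝ (fun (a : FormVal 𝔤 d) (w : Fin d → FormVal 𝔤 d) =>
      (WithLp.toLp 2 fun i => ∑ j, ⁅a j, w j i⁆ : FormVal 𝔤 d))
    (fun a a' p => by ext1 i; simp only [PiLp.add_apply, add_lie, Finset.sum_add_distrib])
    (fun c a p => by ext1 i; simp only [PiLp.smul_apply, smul_lie, Finset.smul_sum])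
    (fun a p p' => by
      ext1 i; simp only [Pi.add_apply, PiLp.add_apply, lie_add, Finset.sum_add_distrib])
    (fun c a p => by
      ext1 i
      simp only [Pi.smul_apply, PiLp.smul_apply, lie_smul, Finset.smul_sum]
      )).toContinuousBilinearMap

/-- The bilinear map `(R(a, b)ⱼ)ᵢ = [aⱼ, bᵢ]`. -/
noncomputable def ymCubicInner (d : ℕ) :
    FormVal 𝔤 d →L[ℝ] FormVal 𝔤 d →L[ℝ] (Fin d → FormVal 𝔤 d) :=
  (LinearMap.mk₂ ℝ (fun (a b : FormVal 𝔤 d) =>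
      (fun j => WithLp.toLp 2 fun i => ⁅a j, b i⁆ : Fin d → FormVal 𝔤 d))
    (fun a a' p => by ext1 j; ext1 i; simp)
    (fun c a p => by ext1 j; ext1 i; simp)
    (fun a p p' => by ext1 j; ext1 i; simp)
    (fun c a p => by ext1 j; ext1 i; simp)).toContinuousBilinearMap

variable {𝔤}

lemma nonlin2_eq (A : Euc d → FormVal 𝔤 d) : nonlin2 A = funNonlin (ymQuad 𝔤 d) 0 0 A := by
  ext x
  simp [funNonlin, jetNonlin, nonlin2, ymQuad]

lemma nonlin3_eq (A : Euc d → FormVal 𝔤 d) :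
    nonlin3 A = funNonlin 0 (ymCubicOuter 𝔤 d) (ymCubicInner 𝔤 d) A := by
  ext x
  simp [funNonlin, jetNonlin, nonlin3, ymCubicOuter, ymCubicInner]

lemma nonlin_eq (A : Euc d → FormVal 𝔤 d) :
    nonlin A = funNonlin (ymQuad 𝔤 d) (ymCubicOuter 𝔤 d) (ymCubicInner 𝔤 d) A := by
  ext x
  simp [funNonlin, jetNonlin, nonlin, ymQuad, ymCubicOuter, ymCubicInner, Finset.sum_add_distrib]

end YangMillsNonlinearity

/-! ### The existence time -/

section ExistenceTime

/-- The existence time for data of size `R`. The exponent is such that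
`τ ^ {1/2 - γ} = 1 / (c (1 + 3 R) ^ 2)`. -/
noncomputable def existenceTime (c γ : ℝ) (R : ℝ≥0) : ℝ :=
  (c * (1 + 3 * R) ^ 2) ^ (-(2 / (1 - 2 * γ)))

variable {c γ : ℝ}

lemma one_le_existenceTime_base (hc : 1 ≤ c) (R : ℝ≥0) : 1 ≤ c * (1 + 3 * (R : ℝ)) ^ 2 := by
  have h : 1 ≤ 1 + 3 * (R : ℝ) := by have := R.2; linarith [R.coe_nonneg]
  exact one_le_mul_of_one_le_of_one_le hc (one_le_pow₀ h)

lemma continuous_existenceTime (hc : 1 ≤ c) : Continuous (existenceTime c γ) :=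
  Continuous.rpow_const (by fun_prop) fun R => Or.inl
    (zero_lt_one.trans_le (one_le_existenceTime_base hc R)).ne'

lemma existenceTime_pos (hc : 1 ≤ c) (R : ℝ≥0) : 0 < existenceTime c γ R :=
  Real.rpow_pos_of_pos (zero_lt_one.trans_le (one_le_existenceTime_base hc R)) _

lemma existenceTime_le_one (hc : 1 ≤ c) (hγ : γ < 1 / 2) (R : ℝ≥0) : existenceTime c γ R ≤ 1 := by
  have : 0 < 1 - 2 * γ := by linarith
  exact Real.rpow_le_one_of_one_le_of_nonpos (one_le_existenceTime_base hc R)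
    (neg_nonpos.2 (by positivity))

lemma antitone_existenceTime (hc : 1 ≤ c) (hγ : γ < 1 / 2) : Antitone (existenceTime c γ) := by
  intro R R' h
  have h1 : 0 < 1 - 2 * γ := by linarith
  have h2 : (R : ℝ) ≤ R' := by exact_mod_cast h
  refine Real.rpow_le_rpow_of_nonpos (zero_lt_one.trans_le (one_le_existenceTime_base hc R)) ?_
    (neg_nonpos.2 (by positivity))
  have := R.coe_nonneg
  gcongr

lemma existenceTime_rpow (hc : 1 ≤ c) (hγ : γ < 1 / 2) (R : ℝ≥0) :
    existenceTime c γ R ^ (1 / 2 - γ) * (c * (1 + 3 * R) ^ 2) = 1 := by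
  have h0 := zero_lt_one.trans_le (one_le_existenceTime_base hc R)
  have h1 : 1 - 2 * γ ≠ 0 := by linarith
  have e : -(2 / (1 - 2 * γ)) * (1 / 2 - γ) = -1 := by field_simp
  rw [existenceTime, ← Real.rpow_mul h0.le, e, Real.rpow_neg_one, inv_mul_cancel₀ h0.ne']

lemma inv_existenceTime_le (hc : 1 ≤ c) (hγ : γ < 1 / 2) (R : ℝ≥0) :
    (existenceTime c γ R)⁻¹ ≤ c ^ (2 / (1 - 2 * γ)) * 4 ^ (4 / (1 - 2 * γ)) *
      (1 + (R : ℝ) ^ (4 / (1 - 2 * γ))) := by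
  have hR := R.coe_nonneg
  have h1 : 0 < 1 - 2 * γ := by linarith
  have h0 := zero_lt_one.trans_le (one_le_existenceTime_base hc R)
  have hc0 : 0 ≤ c := zero_le_one.trans hc
  have e : (4 : ℝ) / (1 - 2 * γ) = 2 * (2 / (1 - 2 * γ)) := by ring
  rw [existenceTime, Real.rpow_neg h0.le, inv_inv, Real.mul_rpow hc0 (by positivity),
    ← Real.rpow_two, ← Real.rpow_mul (by positivity), ← e, mul_assoc]
  refine mul_le_mul_of_nonneg_left ?_ (by positivity)
  have hp : 0 ≤ 4 / (1 - 2 * γ) := by positivity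
  have h2 : 1 + 3 * (R : ℝ) ≤ 4 * max 1 (R : ℝ) := by
    linarith [le_max_left 1 (R : ℝ), le_max_right 1 (R : ℝ)]
  calc (1 + 3 * (R : ℝ)) ^ (4 / (1 - 2 * γ)) ≤ (4 * max 1 (R : ℝ)) ^ (4 / (1 - 2 * γ)) :=
        Real.rpow_le_rpow (by positivity) h2 hp
    _ = 4 ^ (4 / (1 - 2 * γ)) * (max 1 (R : ℝ)) ^ (4 / (1 - 2 * γ)) :=
        Real.mul_rpow (by norm_num) (by positivity)
    _ ≤ _ := by
        refine mul_le_mul_of_nonneg_left ?_ (by positivity)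
        rcases max_cases 1 (R : ℝ) with h | h
        · rw [h.1, Real.one_rpow]
          exact le_add_of_nonneg_right (by positivity)
        · rw [h.1]
          exact le_add_of_nonneg_left zero_le_one

end ExistenceTime

/-! ### Existence and stability for the remainder -/

section Data

variable {N d : ℕ} {𝔤 : LieSubalgebra ℝ (HSMat N)} {γ₁ γ₂ : ℝ}
  {A₁ B₁ A₁' B₁' : ℝ → Euc d → FormVal 𝔤 d}

lemma IsData.qNorm_max_ne_top (h : IsData γ₁ γ₂ A₁ B₁) :
    max (qNorm 1 γ₁ A₁) (qNorm 1 γ₂ B₁) ≠ ⊤ :=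
  (max_lt h.memQ_A.finite h.memQ_B.finite).ne

lemma IsData.qNorm_le (h : IsData γ₁ γ₂ A₁ B₁) :
    qNorm 1 γ₁ A₁ ≤ dataSize γ₁ γ₂ A₁ B₁ ∧ qNorm 1 γ₂ B₁ ≤ dataSize γ₁ γ₂ A₁ B₁ := by
  rw [dataSize, ENNReal.coe_toNNReal h.qNorm_max_ne_top]
  exact ⟨le_max_left _ _, le_max_right _ _⟩

lemma jetBound_of_qNorm_le_coe {T γ : ℝ} {M : ℝ≥0} {A : ℝ → Euc d → FormVal 𝔤 d}
    (h : qNorm T γ A ≤ M) : JetBound T γ M A :=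
  jetBound_of_qNorm_le M.coe_nonneg (by rwa [ENNReal.ofReal_coe_nnreal])

lemma IsData.jetBound_A (h : IsData γ₁ γ₂ A₁ B₁) {T γ : ℝ} (hT : T ≤ 1) (hγ : γ₁ ≤ γ) :
    JetBound T γ (dataSize γ₁ γ₂ A₁ B₁) A₁ :=
  ((jetBound_of_qNorm_le_coe h.qNorm_le.1).mono hT le_rfl).weaken (NNReal.coe_nonneg _) hT hγ

lemma IsData.jetBound_B (h : IsData γ₁ γ₂ A₁ B₁) {T : ℝ} (hT : T ≤ 1) :
    JetBound T γ₂ (dataSize γ₁ γ₂ A₁ B₁) B₁ :=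
  (jetBound_of_qNorm_le_coe h.qNorm_le.2).mono hT le_rfl

lemma crossTerm_eq (A B : ℝ → Euc d → FormVal 𝔤 d) :
    (fun s => crossTerm (A s) (B s)) =
      increment (ymQuad 𝔤 d) (ymCubicOuter 𝔤 d) (ymCubicInner 𝔤 d) A B -
        fun s => funNonlin (ymQuad 𝔤 d) (ymCubicOuter 𝔤 d) (ymCubicInner 𝔤 d) (B s) := by
  ext1 s
  simp only [crossTerm, Pi.sub_apply, increment, ← nonlin_eq]

end Data

section Remainder

variable {N d : ℕ} {𝔤 : LieSubalgebra ℝ (HSMat N)} {γ₁ γ₂ γ T M : ℝ}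
  {A₁ B₁ A B : ℝ → Euc d → FormVal 𝔤 d}

/-- The terms of the remainder equation are Duhamel integrals of sources with an integrable
singularity. -/
lemma wellDefined_of_jetBound (hT : T ≤ 1) (hγ₂0 : 0 ≤ γ₂) (hγ₂ : γ₂ ≤ γ) (hγ : γ < 1 / 2)
    (hγγ : γ + γ₂ < 1 / 2) (hM : 0 ≤ M) (hA : JetCont (Ioc 0 T) A) (hB : JetCont (Ioc 0 T) B)
    (nA : JetBound T γ M A) (nB : JetBound T γ₂ M B) :
    DuhamelConverges T (fun s => nonlin2 (B s)) ∧ DuhamelConverges T (fun s => nonlin3 (B s)) ∧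
      DuhamelConverges T (fun s => crossTerm (A s) (B s)) ∧
      ∀ t ∈ Ioc 0 T, rho B t + eta A B t =
        duhamel (increment (ymQuad 𝔤 d) (ymCubicOuter 𝔤 d) (ymCubicInner 𝔤 d) A B) t := by
  have h2 := duhamelConverges_funNonlin (ymQuad 𝔤 d) 0 0 hT hγ₂0 hγ₂ hγ hγγ hM hB nB
  have h3 := duhamelConverges_funNonlin 0 (ymCubicOuter 𝔤 d) (ymCubicInner 𝔤 d) hT hγ₂0 hγ₂ hγ hγγ
    hM hB nB
  have hc := duhamel_cross (ymQuad 𝔤 d) (ymCubicOuter 𝔤 d) (ymCubicInner 𝔤 d) hT hγ₂0 hγ₂ hγ hγγ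
    hM hA hB nA nB
  simp only [← nonlin2_eq] at h2
  simp only [← nonlin3_eq] at h3
  rw [← crossTerm_eq] at hc
  simp only [← nonlin_eq] at hc
  exact ⟨h2, h3, hc⟩

variable (𝔤 d) in
/-- The constant in the definition of the existence time. -/
noncomputable def timeConst (γ γ₂ : ℝ) : ℝ :=
  4 * (duhamelConst d (1 / 2 + γ + γ₂) *
    nonlinConst (ymQuad 𝔤 d) (ymCubicOuter 𝔤 d) (ymCubicInner 𝔤 d)) + 1

lemma one_le_timeConst (hγγ : γ + γ₂ < 1 / 2) : 1 ≤ timeConst d 𝔤 γ γ₂ := by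
  have h1 := duhamelConst_nonneg (d := d) (a := 1 / 2 + γ + γ₂) (by linarith)
  have h2 := nonlinConst_nonneg (ymQuad 𝔤 d) (ymCubicOuter 𝔤 d) (ymCubicInner 𝔤 d)
  exact le_add_of_nonneg_left (by positivity)

/-- Up to the existence time, the remainder equation is a contraction on the ball of radius
`3 R`. -/
lemma small_of_le_existenceTime (hγ : γ < 1 / 2) (hγγ : γ + γ₂ < 1 / 2) (hT0 : 0 < T) {R : ℝ≥0}
    (hT : T ≤ existenceTime (timeConst d 𝔤 γ γ₂) γ R) :
    duhamelConst d (1 / 2 + γ + γ₂) * T ^ (1 / 2 - γ) *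
      (nonlinConst (ymQuad 𝔤 d) (ymCubicOuter 𝔤 d) (ymCubicInner 𝔤 d) * (1 + 3 * R) ^ 2) ≤
      1 / 4 := by
  have h1 := duhamelConst_nonneg (d := d) (a := 1 / 2 + γ + γ₂) (by linarith)
  have h2 := nonlinConst_nonneg (ymQuad 𝔤 d) (ymCubicOuter 𝔤 d) (ymCubicInner 𝔤 d)
  have h3 := existenceTime_rpow (one_le_timeConst (d := d) (𝔤 := 𝔤) hγγ) hγ R
  have h4 : T ^ (1 / 2 - γ) ≤ existenceTime (timeConst d 𝔤 γ γ₂) γ R ^ (1 / 2 - γ) :=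
    Real.rpow_le_rpow hT0.le hT (by linarith)
  set k := duhamelConst d (1 / 2 + γ + γ₂)
  set n := nonlinConst (ymQuad 𝔤 d) (ymCubicOuter 𝔤 d) (ymCubicInner 𝔤 d)
  set p := existenceTime (timeConst d 𝔤 γ γ₂) γ R ^ (1 / 2 - γ)
  have h5 : 0 ≤ T ^ (1 / 2 - γ) := by positivity
  have h6 : 0 ≤ (1 + 3 * (R : ℝ)) ^ 2 := by positivity
  have h7 : 4 * (k * n) ≤ timeConst d 𝔤 γ γ₂ := le_add_of_nonneg_right zero_le_one
  have h8 : 4 * (k * n) * (1 + 3 * (R : ℝ)) ^ 2 * T ^ (1 / 2 - γ) ≤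
      timeConst d 𝔤 γ γ₂ * (1 + 3 * (R : ℝ)) ^ 2 * p := by
    have h9 := h5.trans h4
    have h10 : 0 ≤ timeConst d 𝔤 γ γ₂ := (by positivity : 0 ≤ 4 * (k * n)).trans h7
    gcongr
  linarith

lemma exists_isRemainder (hγ₂0 : 0 ≤ γ₂) (hγ₁ : γ₁ ≤ γ) (hγ₂ : γ₂ ≤ γ) (hγ : γ < 1 / 2)
    (hγγ : γ + γ₂ < 1 / 2) (hdata : IsData γ₁ γ₂ A₁ B₁) {R : ℝ≥0}
    (hR : R = dataSize γ₁ γ₂ A₁ B₁)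
    (hT : T = existenceTime (timeConst d 𝔤 γ γ₂) γ R) :
    ∃ B : ℝ → Euc d → FormVal 𝔤 d,
      IsRemainder γ₂ T (3 * R) A₁ B₁ B ∧ IsZDDSSolution T (A₁ + B) := by
  have hc := one_le_timeConst (d := d) (𝔤 := 𝔤) hγγ
  have hT0 : 0 < T := hT ▸ existenceTime_pos hc R
  have hT1 : T ≤ 1 := hT ▸ existenceTime_le_one hc hγ R
  have hA := hdata.memQ_A.jetCont
  have hB₁ := hdata.memQ_B.jetCont
  have hAT := hA.mono (Ioc_subset_Ioc_right hT1)
  have hBT := hB₁.mono (Ioc_subset_Ioc_right hT1)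
  have nA := hdata.jetBound_A hT1 hγ₁
  have nB₁ := hdata.jetBound_B hT1
  have qB₁ := hdata.qNorm_le.2
  rw [← hR] at nA nB₁ qB₁
  have hR0 := R.coe_nonneg
  have hk := nonlinConst_nonneg (ymQuad 𝔤 d) (ymCubicOuter 𝔤 d) (ymCubicInner 𝔤 d)
  have hD := duhamelConst_nonneg (d := d) (a := 1 / 2 + γ + γ₂) (by linarith)
  obtain ⟨B, hB, nB, nD, heq⟩ := exists_remainder (ymQuad 𝔤 d) (ymCubicOuter 𝔤 d)
    (ymCubicInner 𝔤 d) hT0 hT1 hγ₂0 hγ₂ hγ hγγ hR0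
    ((small_of_le_existenceTime hγ hγγ hT0 hT.le).trans' (by gcongr; norm_num)) hAT hBT nA nB₁
  have nA' := nA.mono le_rfl (show (R : ℝ) ≤ 2 * R by linarith)
  obtain ⟨w2, w3, wc, wsum⟩ := wellDefined_of_jetBound hT1 hγ₂0 hγ₂ hγ hγγ
    (show (0 : ℝ) ≤ 2 * R by linarith) hAT hB nA' nB
  have hsrc := isSource_increment (ymQuad 𝔤 d) (ymCubicOuter 𝔤 d) (ymCubicInner 𝔤 d) hT1 hγ₂
    hγ.le (show (0 : ℝ) ≤ 2 * R by linarith) (show (0 : ℝ) ≤ 2 * R by linarith) le_rfl hAT hB nA' nB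
  -- the data contribute `R`, and the two suprema in the norm of the Duhamel term `R` each
  have hnorm : qNorm T γ₂ B ≤ ((3 * R : ℝ≥0) : ℝ≥0∞) := by
    have e : qNorm T γ₂ B = qNorm T γ₂ (B₁ + duhamel (increment (ymQuad 𝔤 d) (ymCubicOuter 𝔤 d)
      (ymCubicInner 𝔤 d) A₁ B)) := qNorm_congr fun t ht => heq t ht
    have hjD := jetCont_duhamel hsrc (by linarith) (by linarith) (by positivity)
      fun s hs => isTorusFun_increment (ymQuad 𝔤 d) (ymCubicOuter 𝔤 d) (ymCubicInner 𝔤 d) hAT hB hs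
    rw [e]
    refine (qNorm_add_le hBT.isC1 hjD.isC1).trans ((add_le_add
      ((qNorm_mono hT1 hT1 le_rfl B₁).trans qB₁) (nD.qNorm_le hR0 hT1)).trans ?_)
    rw [← ENNReal.ofReal_coe_nnreal, ← ENNReal.ofReal_coe_nnreal,
      ← ENNReal.ofReal_add hR0 (by positivity)]
    refine ENNReal.ofReal_le_ofReal ?_
    push_cast
    linarith
  have hmild : IsMild (ymQuad 𝔤 d) (ymCubicOuter 𝔤 d) (ymCubicInner 𝔤 d) T (A₁ + B) := by
    refine isMild_of_remainder _ _ _ hT1 (by linarith) hA hB₁ hB hdata.caloric ?_ hsrc heq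
    intro t₀ ht₀ t ht
    rw [hdata.firstNonlinearPart t₀ ht₀ t ht, rho]
    simp only [nonlin_eq]
  refine ⟨B, ⟨hB.memQ (hnorm.trans_lt ENNReal.coe_lt_top), hnorm, w2, w3, wc, fun t ht => ?_⟩,
    ⟨fun t ht => (hmild.jetCont.isC1 t ht).1, hmild.contDiffOn, fun t ht x => ?_⟩⟩
  · rw [add_assoc, wsum t ht]
    exact heq t ht
  · rw [nonlin_eq]
    exact (hmild.hasDerivAt ht x).deriv

/-! ### Convergence of the data -/

lemma tendsto_qNorm {ι : Type*} {l : Filter ι} {A : ℝ → Euc d → FormVal 𝔤 d}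
    {A' : ι → ℝ → Euc d → FormVal 𝔤 d} (hA : ∀ t ∈ Ioc 0 T, IsC1 (A t))
    (hA' : ∀ n, ∀ t ∈ Ioc 0 T, IsC1 (A' n t)) (hfin : qNorm T γ A ≠ ⊤)
    (h : Tendsto (fun n => qNorm T γ (A' n - A)) l (𝓝 0)) :
    Tendsto (fun n => qNorm T γ (A' n)) l (𝓝 (qNorm T γ A)) := by
  have h1 : ∀ n, qNorm T γ (A' n) ≤ qNorm T γ A + qNorm T γ (A' n - A) := fun n => by
    have := qNorm_add_le (γ := γ) hA fun t ht => (hA' n t ht).sub (hA t ht)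
    change qNorm T γ (A + (A' n - A)) ≤ qNorm T γ A + qNorm T γ (A' n - A) at this
    rwa [add_sub_cancel] at this
  have h2 : ∀ n, qNorm T γ A - qNorm T γ (A' n - A) ≤ qNorm T γ (A' n) := fun n => by
    rw [tsub_le_iff_right]
    have := qNorm_sub_le (γ := γ) (hA' n) fun t ht => (hA' n t ht).sub (hA t ht)
    change qNorm T γ (A' n - (A' n - A)) ≤ qNorm T γ (A' n) + qNorm T γ (A' n - A) at this
    rwa [sub_sub_cancel] at this
  have l1 : Tendsto (fun n => qNorm T γ A + qNorm T γ (A' n - A)) l (𝓝 (qNorm T γ A)) := by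
    simpa using tendsto_const_nhds.add h
  have l2 : Tendsto (fun n => qNorm T γ A - qNorm T γ (A' n - A)) l (𝓝 (qNorm T γ A)) := by
    simpa using ENNReal.Tendsto.sub tendsto_const_nhds h (Or.inl hfin)
  exact tendsto_of_tendsto_of_tendsto_of_le_of_le l2 l1 h2 h1

lemma tendsto_dataSize {ι : Type*} {l : Filter ι} {A' B' : ι → ℝ → Euc d → FormVal 𝔤 d}
    (hdata : IsData γ₁ γ₂ A B) (hdata' : ∀ n, IsData γ₁ γ₂ (A' n) (B' n))
    (hA : Tendsto (fun n => qNorm 1 γ₁ (A' n - A)) l (𝓝 0))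
    (hB : Tendsto (fun n => qNorm 1 γ₂ (B' n - B)) l (𝓝 0)) :
    Tendsto (fun n => dataSize γ₁ γ₂ (A' n) (B' n)) l (𝓝 (dataSize γ₁ γ₂ A B)) :=
  (ENNReal.tendsto_toNNReal hdata.qNorm_max_ne_top).comp
    ((tendsto_qNorm hdata.memQ_A.isC1 (fun n => (hdata' n).memQ_A.isC1) hdata.memQ_A.finite.ne
      hA).max
    (tendsto_qNorm hdata.memQ_B.isC1 (fun n => (hdata' n).memQ_B.isC1) hdata.memQ_B.finite.ne hB))

end Remainder

/-! ### Local well-posedness -/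

section Stability

variable {N d : ℕ} {𝔤 : LieSubalgebra ℝ (HSMat N)} {γ₁ γ₂ γ T T₀ : ℝ}
  {A₁ B₁ B A₁' B₁' B' : ℝ → Euc d → FormVal 𝔤 d}

/-- The difference of the remainders of two data on a common time interval is controlled by the
difference of the data. -/
lemma IsRemainder.qNorm_sub_le (hγ₂0 : 0 ≤ γ₂) (hγ₁ : γ₁ ≤ γ) (hγ₂ : γ₂ ≤ γ) (hγ : γ < 1 / 2)
    (hγγ : γ + γ₂ < 1 / 2) (hdata : IsData γ₁ γ₂ A₁ B₁) (hdata' : IsData γ₁ γ₂ A₁' B₁')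
    {R R' : ℝ≥0} (hR : R = dataSize γ₁ γ₂ A₁ B₁) (hR' : R' = dataSize γ₁ γ₂ A₁' B₁') {T' : ℝ}
    (hT : T = existenceTime (timeConst d 𝔤 γ γ₂) γ R)
    (hT' : T' = existenceTime (timeConst d 𝔤 γ γ₂) γ R')
    (h : IsRemainder γ₂ T (3 * R) A₁ B₁ B) (h' : IsRemainder γ₂ T' (3 * R') A₁' B₁' B')
    (hT₀ : 0 < T₀) (hT₀T : T₀ ≤ T) (hT₀T' : T₀ ≤ T') :
    qNorm T₀ γ₂ (B - B') ≤ 2 * qNorm 1 γ₂ (B₁ - B₁') + qNorm 1 γ₁ (A₁ - A₁') := by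
  have hc := one_le_timeConst (d := d) (𝔤 := 𝔤) hγγ
  have hT1 : T ≤ 1 := hT ▸ existenceTime_le_one hc hγ R
  have hT1' : T' ≤ 1 := hT' ▸ existenceTime_le_one hc hγ R'
  have hT₀1 : T₀ ≤ 1 := hT₀T.trans hT1
  have i1 : Ioc 0 T₀ ⊆ Ioc 0 1 := Ioc_subset_Ioc_right hT₀1
  have hA := hdata.memQ_A.jetCont.mono i1
  have hB₁ := hdata.memQ_B.jetCont.mono i1
  have hA' := hdata'.memQ_A.jetCont.mono i1
  have hB₁' := hdata'.memQ_B.jetCont.mono i1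
  have hB := h.memQ.jetCont
  have hB' := h'.memQ.jetCont
  -- `T₀` is at most both existence times, hence at most that of the larger of the two sizes
  set m := max R R' with hm
  have hmT : T₀ ≤ existenceTime (timeConst d 𝔤 γ γ₂) γ m := by
    rcases max_choice R R' with e | e <;> rw [hm, e]
    · exact hT₀T.trans hT.le
    · exact hT₀T'.trans hT'.le
  have r0 := R.coe_nonneg
  have r0' := R'.coe_nonneg
  have m0 := m.coe_nonneg
  have hRm : (R : ℝ) ≤ m := by exact_mod_cast le_max_left R R'
  have hRm' : (R' : ℝ) ≤ m := by exact_mod_cast le_max_right R R'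
  have n3 : ∀ x : ℝ≥0, ((3 * x : ℝ≥0) : ℝ) = 3 * x := fun x => by push_cast; rfl
  have nB := jetBound_of_qNorm_le_coe h.norm_le
  have nB' := jetBound_of_qNorm_le_coe h'.norm_le
  rw [n3] at nB nB'
  have nA := hdata.jetBound_A hT1 hγ₁
  have nA' := hdata'.jetBound_A hT1' hγ₁
  rw [← hR] at nA
  rw [← hR'] at nA'
  have heq : ∀ t ∈ Ioc 0 T, B t = B₁ t + duhamel (increment (ymQuad 𝔤 d) (ymCubicOuter 𝔤 d)
      (ymCubicInner 𝔤 d) A₁ B) t := fun t ht => by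
    rw [h.eq t ht, add_assoc, (wellDefined_of_jetBound hT1 hγ₂0 hγ₂ hγ hγγ
      (show (0 : ℝ) ≤ 3 * R by linarith) (hdata.memQ_A.jetCont.mono (Ioc_subset_Ioc_right hT1)) hB
      (nA.mono le_rfl (by linarith)) nB).2.2.2 t ht]
  have heq' : ∀ t ∈ Ioc 0 T', B' t = B₁' t + duhamel (increment (ymQuad 𝔤 d) (ymCubicOuter 𝔤 d)
      (ymCubicInner 𝔤 d) A₁' B') t := fun t ht => by
    rw [h'.eq t ht, add_assoc, (wellDefined_of_jetBound hT1' hγ₂0 hγ₂ hγ hγγ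
      (show (0 : ℝ) ≤ 3 * R' by linarith) (hdata'.memQ_A.jetCont.mono (Ioc_subset_Ioc_right hT1'))
      hB' (nA'.mono le_rfl (by linarith)) nB').2.2.2 t ht]
  have j : Ioc 0 T₀ ⊆ Ioc 0 T := Ioc_subset_Ioc_right hT₀T
  have j' : Ioc 0 T₀ ⊆ Ioc 0 T' := Ioc_subset_Ioc_right hT₀T'
  have fA := (_root_.qNorm_sub_le (γ := γ₁) hA.isC1 hA'.isC1).trans (add_le_add
    (qNorm_mono hT₀1 hT₀1 le_rfl A₁) (qNorm_mono hT₀1 hT₀1 le_rfl A₁'))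
  have fB₁ := (_root_.qNorm_sub_le (γ := γ₂) hB₁.isC1 hB₁'.isC1).trans (add_le_add
    (qNorm_mono hT₀1 hT₀1 le_rfl B₁) (qNorm_mono hT₀1 hT₀1 le_rfl B₁'))
  have fB := (_root_.qNorm_sub_le (γ := γ₂) (hB.mono j).isC1 (hB'.mono j').isC1).trans (add_le_add
    (qNorm_mono hT₀T hT₀1 le_rfl B) (qNorm_mono hT₀T' hT₀1 le_rfl B'))
  refine (qNorm_remainder_sub_le (ymQuad 𝔤 d) (ymCubicOuter 𝔤 d) (ymCubicInner 𝔤 d) (γ₁ := γ₁)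
    hT₀1 hγ₂0 hγ₂ hγ₁ hγ hγγ (show (0 : ℝ) ≤ 3 * m by linarith)
    (small_of_le_existenceTime hγ hγγ hT₀ hmT) hA hA' hB₁ hB₁' (hB.mono j) (hB'.mono j')
    (nA.mono hT₀T (by linarith)) (nA'.mono hT₀T' (by linarith))
    (nB.mono hT₀T (by linarith)) (nB'.mono hT₀T' (by linarith))
    (fA.trans_lt (ENNReal.add_lt_top.2 ⟨hdata.memQ_A.finite, hdata'.memQ_A.finite⟩)).ne
    (fB₁.trans_lt (ENNReal.add_lt_top.2 ⟨hdata.memQ_B.finite, hdata'.memQ_B.finite⟩)).ne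
    (fB.trans_lt (ENNReal.add_lt_top.2 ⟨h.memQ.finite, h'.memQ.finite⟩)).ne
    (fun t ht => heq t (j ht)) (fun t ht => heq' t (j' ht))).trans ?_
  gcongr
  · exact qNorm_mono hT₀1 hT₀1 le_rfl _
  · exact qNorm_mono hT₀1 hT₀1 le_rfl _

end Stability

theorem mainTheorem3 {N d : ℕ} (hd : 2 ≤ d)
    (𝔤 : LieSubalgebra ℝ (HSMat N)) (h𝔤 : ∀ S ∈ 𝔤, star S = -S)
    (γ₁ γ₂ : ℝ) (hγ₁ : 0 ≤ γ₁ ∧ γ₁ < 1 / 2) (hγ₂ : 0 ≤ γ₂ ∧ γ₂ < 1 / 4)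
    (hγ : γ₁ + γ₂ < 1 / 2) :
    ∃ τ : ℝ≥0 → ℝ,
      Continuous τ ∧ Antitone τ ∧ (∀ R, 0 < τ R ∧ τ R ≤ 1) ∧
      (∃ C : ℝ, ∀ R : ℝ≥0,
        (τ R)⁻¹ ≤ C * (1 + (R : ℝ) ^ (4 / (1 - 2 * max γ₁ γ₂)))) ∧
      ∀ (A₁ B₁ : ℝ → Euc d → FormVal 𝔤 d) (R : ℝ≥0) (T : ℝ),
        IsData γ₁ γ₂ A₁ B₁ → R = dataSize γ₁ γ₂ A₁ B₁ → T = τ R →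
        (∃ B : ℝ → Euc d → FormVal 𝔤 d,
          IsRemainder γ₂ T (3 * R) A₁ B₁ B ∧ IsZDDSSolution T (A₁ + B)) ∧
        ∀ B : ℝ → Euc d → FormVal 𝔤 d, IsRemainder γ₂ T (3 * R) A₁ B₁ B →
          ∀ (A₁' B₁' B' : ℕ → ℝ → Euc d → FormVal 𝔤 d) (R' : ℕ → ℝ≥0) (T' : ℕ → ℝ),
            (∀ n, IsData γ₁ γ₂ (A₁' n) (B₁' n)) →
            (∀ n, R' n = dataSize γ₁ γ₂ (A₁' n) (B₁' n)) →
            (∀ n, T' n = τ (R' n)) →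
            (∀ n, IsRemainder γ₂ (T' n) (3 * R' n) (A₁' n) (B₁' n) (B' n)) →
            Tendsto (fun n => qNorm 1 γ₁ (A₁' n - A₁)) atTop (𝓝 0) →
            Tendsto (fun n => qNorm 1 γ₂ (B₁' n - B₁)) atTop (𝓝 0) →
            Tendsto T' atTop (𝓝 T) ∧
            ∀ T₀ : ℝ, 0 < T₀ → T₀ < T →
              Tendsto (fun n => qNorm T₀ γ₂ (B' n - B)) atTop (𝓝 0) ∧
              Tendsto (fun n => qNorm T₀ (max γ₁ γ₂) ((A₁' n + B' n) - (A₁ + B)))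
                atTop (𝓝 0) := by
  obtain ⟨hγ₂0, hγ₂4⟩ := hγ₂
  set γ := max γ₁ γ₂ with hγdef
  have h1 : γ₁ ≤ γ := le_max_left _ _
  have h2 : γ₂ ≤ γ := le_max_right _ _
  have hγ2 : γ < 1 / 2 := max_lt hγ₁.2 (by linarith)
  have hγγ : γ + γ₂ < 1 / 2 := by
    -- this is `γ₁ + γ₂ < 1 / 2` or `2 γ₂ < 1 / 2`
    rcases max_choice γ₁ γ₂ with e | e <;> rw [hγdef, e] <;> linarith
  have hc := one_le_timeConst (d := d) (𝔤 := 𝔤) hγγ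
  refine ⟨existenceTime (timeConst d 𝔤 γ γ₂) γ, continuous_existenceTime hc,
    antitone_existenceTime hc hγ2, fun R => ⟨existenceTime_pos hc R, existenceTime_le_one hc hγ2 R⟩,
    ⟨_, inv_existenceTime_le hc hγ2⟩, fun A₁ B₁ R T hdata hR hT =>
    ⟨exists_isRemainder hγ₂0 h1 h2 hγ2 hγγ hdata hR hT, ?_⟩⟩
  intro B hB A₁' B₁' B' R' T' hdata' hR' hT' hB' hA hB₁
  have hRlim : Tendsto R' atTop (𝓝 R) := by
    rw [hR, funext hR']
    exact tendsto_dataSize hdata hdata' hA hB₁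
  have hTlim : Tendsto T' atTop (𝓝 T) := by
    rw [hT, funext hT']
    exact ((continuous_existenceTime hc).tendsto R).comp hRlim
  refine ⟨hTlim, fun T₀ hT₀ hT₀T => ?_⟩
  have hT₀1 : T₀ ≤ 1 := hT₀T.le.trans (hT ▸ existenceTime_le_one hc hγ2 R)
  have hev : ∀ᶠ n in atTop, T₀ ≤ T' n :=
    (hTlim.eventually_const_lt hT₀T).mono fun n hn => hn.le
  have hlim : Tendsto (fun n => qNorm T₀ γ₂ (B' n - B)) atTop (𝓝 0) := by
    have h3 : Tendsto (fun n => 2 * qNorm 1 γ₂ (B₁' n - B₁) + qNorm 1 γ₁ (A₁' n - A₁)) atTop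
        (𝓝 0) := by
      simpa using (ENNReal.Tendsto.const_mul hB₁ (Or.inr (by simp : (2 : ℝ≥0∞) ≠ ⊤))).add hA
    refine tendsto_of_tendsto_of_tendsto_of_le_of_le' tendsto_const_nhds h3
      (Eventually.of_forall fun _ => zero_le) ?_
    filter_upwards [hev] with n hn
    exact (hB' n).qNorm_sub_le hγ₂0 h1 h2 hγ2 hγγ (hdata' n) hdata (hR' n) hR (hT' n) hT hB hT₀ hn
      hT₀T.le
  refine ⟨hlim, ?_⟩
  have h4 : Tendsto (fun n => qNorm 1 γ₁ (A₁' n - A₁) + qNorm T₀ γ₂ (B' n - B)) atTop (𝓝 0) := by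
    simpa using hA.add hlim
  refine tendsto_of_tendsto_of_tendsto_of_le_of_le' tendsto_const_nhds h4
    (Eventually.of_forall fun _ => zero_le) ?_
  filter_upwards [hev] with n hn
  rw [add_sub_add_comm]
  have i1 : Ioc 0 T₀ ⊆ Ioc 0 1 := Ioc_subset_Ioc_right hT₀1
  refine (qNorm_add_le
    (fun t ht => ((hdata' n).memQ_A.isC1 t (i1 ht)).sub (hdata.memQ_A.isC1 t (i1 ht)))
    (fun t ht => ((hB' n).memQ.isC1 t (Ioc_subset_Ioc_right hn ht)).sub
      (hB.memQ.isC1 t (Ioc_subset_Ioc_right hT₀T.le ht)))).trans ?_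
  exact add_le_add (qNorm_mono hT₀1 hT₀1 h1 _) (qNorm_mono le_rfl hT₀1 h2 _)
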